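/- **Conventions.** $\lambda$ is the security parameter; every algorithm also receives $1^\lambda$. PPT (QPT) means probabilistic (quantum) algorithms halting in time polynomial in the input size; adversaries are QPT with classical advice of polynomial size and quantum advice on polynomially many qubits, and they keep their internal state between their stages $\mathcal A_1,\mathcal A_2,\dots$. A function $\mu(\lambda)$ is negligible if $\lambda^a\mu(\lambda)\to0$ for all $a$; a probability is overwhelming if it is at least $1-\mu(\lambda)$ for some negligible $\mu$. For bit strings, $\langle b,x\rangle=\bigoplus_j b_jx_j$. **HGHZ capable.** Consider functions $f_k:\mathcal X_\lambda\to\mathcal Y_\lambda$ ($k\in\mathcal K_\lambda$, $\mathcal X_\lambda\subseteq\{0,1\}^{l(\lambda)}$), with a relation "$t$ is a trapdoor of $k$", a function $h:\mathcal X_\lambda\to\{0,1\}^{n(\lambda)}$ and strings $d_0(k)\in\{0,1\}^{n(\lambda)}$. Call $x\ne x'$ *twins* of $y$ under $f_k$ if $f_k^{-1}(y)=\{x,x'\}$. The family is *$\delta$-HGHZ capable* if: (1) a PPT algorithm $\mathsf{Gen}(1^\lambda,d)$, $d\in\{0,1\}^{n}$, outputs with overwhelming probability (uniformly in $d$) a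 key $k\in\mathcal K_\lambda$ and a trapdoor $t$ of $k$, and each $k\in\mathcal K_\lambda$ that it can output satisfies $d_0(k)=d$; (2) PPT algorithms compute, without error, $f_k(x)$ from $(k,x)$, $h(x)$ from $x$, and $d_0(k)$ from any trapdoor of $k$; (3) a PPT algorithm $\mathsf{Invert}(t,y)$, for $t$ a trapdoor of $k\in\mathcal K_\lambda$ and $y\in\mathcal Y_\lambda$, outputs the two twins (in some order) if $y$ has exactly two preimages under $f_k$, and $\bot$ otherwise; (4) a QPT algorithm, on input $1^\lambda$, prepares $|\mathcal X_\lambda|^{-1/2}\sum_{x\in\mathcal X_\lambda}|x\rangle$ with overwhelming fidelity; (5) for every $k\in\mathcal K_\lambda$ and uniform $x\in\mathcal X_\lambda$, $f_k(x)$ has exactly two preimages with probability at least $1-\delta(\lambda)$; (6) $h(x)\oplus h(x')=d_0(k)$ for all twins $x,x'$ under $f_k$, $k\in\mathcal K_\lambda$; (7) every adversary wins the game IND-D0 with probability at most $\frac12$ plus a negligible function: $\mathcal A_1$ outputs $d^{(0)},d^{(1)}\in\{0,1\}^n$; for a uniform bit $c$, $(k,t)\leftarrow\mathsf{Gen}(1^\lambda,d^{(c)})$;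 $\mathcal A_2(k)$ outputs $\tilde c$ and wins if $\tilde c=c$. **GHZcan capable.** The family is *$\delta$-GHZcan capable* if moreover there is a PPT algorithm $\mathsf{PartInfo}$ such that, for $t$ a trapdoor of $k\in\mathcal K_\lambda$ and $y\in\mathcal Y_\lambda$, every output $v$ of $\mathsf{PartInfo}(t,y)$ is in $\{0,1,✗,\bot\}^n$ and satisfies: $|f_k^{-1}(y)|=2$ iff no entry of $v$ is $\bot$; $v[i]\in\{0,1\}$ implies $d_0(k)[i]=1$, and $v[i]=✗$ implies $d_0(k)[i]=0$; if $f_k^{-1}(y)=\{x,x'\}$ with $x\neq x'$, there is $u\in\{h(x),h(x')\}$ with $v[i]=u[i]$ whenever $d_0(k)[i]=1$. And every adversary wins the game IND-PARTIAL with probability at most $\frac12$ plus a negligible function: $\mathcal A_1$ outputs $M\subseteq\{1,\dots,n\}$ and $d^{(0)},d^{(1)}\in\{0,1\}^n$, and loses if $d^{(0)}[i]\ne d^{(1)}[i]$ for some $i\in M$; for a uniform bit $c$, $(k,t)\leftarrow\mathsf{Gen}(1^\lambda,d^{(c)})$, $y\leftarrow\mathcal A_2(k)$, $v\leftarrow\mathsf{PartInfo}(t,y)$;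 $\mathcal A_3(\{(i,v[i])\}_{i\in M})$ outputs $\tilde c$ and wins if $\tilde c=c$. **Distributable.** A GHZcan capable family is *distributable* if there are local keys $\mathcal K_{\mathrm{Loc}}$, each with a bit, and a local trapdoor relation, such that: $\mathcal K=\mathcal K_{\mathrm{Loc}}^n$, trapdoors of $(k^{(1)},\dots,k^{(n)})$ are the tuples of trapdoors of the $k^{(i)}$, and $d_0(k)[i]$ is the bit of $k^{(i)}$; and PPT algorithms such that $\mathsf{Gen}(1^\lambda,d)$ has the distribution of $((k^{(i)})_i,(t^{(i)})_i)$ with independent $(k^{(i)},t^{(i)})\leftarrow\mathsf{Gen_{Loc}}(1^\lambda,d[i])$; for trapdoors $t=(t^{(i)})_i$, $\mathsf{PartInfo}(t,y)$ has the distribution of $(v[i])_i$ with independent $v[i]\leftarrow\mathsf{PartInfo_{Loc}}(i,t^{(i)},y)$; and if $x,x'$ are twins of $y$ under $f_k$ and $b\in\{0,1\}^{l}$, then $\langle b,x\oplus x'\rangle=\bigoplus_i\mathsf{PartAlpha_{Loc}}(i,t^{(i)},y,b)$. **Theorem.** Let $\delta=\delta(\lambda)\in[0,1]$ and let $n=n(\lambda)\ge1$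 be such that $1^\lambda\mapsto1^{n(\lambda)}$ is computable in polynomial time. Let $\{f_k\}$ be a $\delta$-HGHZ capable family for strings $d_0$ of length one (algorithms $\mathsf{H.Gen}$, …), with $\mathcal X_\lambda=\{0,1\}\times\bar{\mathcal X}_\lambda$, such that no $y$ has more than two preimages under an $f_k$ ($k\in\mathcal K_\lambda$), and such that, if $y$ has exactly two preimages under $f_k$, they have the form $(0,\bar x)$ and $(1,\bar x')$. For $k=(k^{(1)},\dots,k^{(n)})\in\mathcal K_\lambda^n$ define $$f'_k(c,\bar x^{(1)},\dots,\bar x^{(n)})=\big(f_{k^{(1)}}(c,\bar x^{(1)}),\dots,f_{k^{(n)}}(c,\bar x^{(n)})\big)\in\mathcal Y_\lambda^n$$ on $\{0,1\}\times\bar{\mathcal X}_\lambda^n$, with $h'(c,\bar x^{(1)},\dots,\bar x^{(n)})=h(c,\bar x^{(1)})|\cdots|h(c,\bar x^{(n)})$, with $d_0'(k)=d_0(k^{(1)})|\cdots|d_0(k^{(n)})$, and with the tuples of trapdoors of the $k^{(i)}$ as the trapdoors of $k$. Then $\{f'_k\}$ is a distributable $\delta'$-GHZcan capable family with $$\delta'=1-(1-\delta)^n\le\delta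 n .$$ In particular $\delta'$ is negligible if $\delta$ is. One may take $\mathcal K_{\mathrm{Loc}}=\mathcal K_\lambda$ with the trapdoors and bits of $\{f_k\}$, $\mathsf{Gen_{Loc}}=\mathsf{H.Gen}$, and local procedures that satisfy the following for $k^{(i)}\in\mathcal K_\lambda$ with trapdoor $t^{(i)}$ and $y=(y^{(1)},\dots,y^{(n)})\in\mathcal Y_\lambda^n$. If $y^{(i)}$ does not have exactly two preimages under $f_{k^{(i)}}$, then $\mathsf{PartInfo_{Loc}}(i,t^{(i)},y)=\mathsf{PartAlpha_{Loc}}(i,t^{(i)},y,b)=\bot$. Otherwise, let $(0,\bar x),(1,\bar x')$ be the two preimages and $b=(b_c,b^{(1)},\dots,b^{(n)})$: $\mathsf{PartInfo_{Loc}}(i,t^{(i)},y)$ is ✗ if $d_0(k^{(i)})=0$ and $h(0,\bar x)$ if $d_0(k^{(i)})=1$; and $\mathsf{PartAlpha_{Loc}}(i,t^{(i)},y,b)$ is $\langle b^{(i)},\bar x\oplus\bar x'\rangle$ if $i\ne1$ and $b_c\oplus\langle b^{(1)},\bar x\oplus\bar x'\rangle$ if $i=1$. Finally, if a PPT algorithm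 $\mathsf{H.CheckTrapdoor}_\lambda(d,t,k)$ outputs $1$ iff $k\in\mathcal K_\lambda$, $t$ is a trapdoor of $k$ and $d=d_0(k)$, then $\mathsf{CheckTrapdoor}_\lambda=\mathsf{H.CheckTrapdoor}_\lambda$ outputs $1$ on $(d,t^{(i)},k^{(i)})$ iff $k^{(i)}\in\mathcal K_{\mathrm{Loc}}$ and $t^{(i)}$ is a trapdoor of $k^{(i)}$, whose bit is $d$. -/

import Mathlib

open scoped BigOperators Classical
open Filter

namespace GHZ

/-! ## Data

All objects handled by algorithms (bit strings, tuples, keys, trapdoors, images) are finite binary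
trees; tuples are right-nested lists of trees and a bit string is a list of bits. -/

inductive Val : Type
  | nil : Val
  | cons : Val → Val → Val

namespace Val

def size : Val → ℕ
  | nil => 1
  | cons a b => 1 + a.size + b.size

def hd : Val → Val
  | nil => nil
  | cons a _ => a

def tl : Val → Val
  | nil => nil
  | cons _ b => b

def toList : Val → List Val
  | nil => []
  | cons a b => a :: b.toList

def ofList : List Val → Val
  | [] => nil
  | a :: t => cons a (ofList t)

/-- Number of entries, when the tree is read as a list. -/
def len (v : Val) : ℕ := v.toList.length

/-- The `i`-th entry (counted from `0`); `nil` if there is none. -/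
def nth (v : Val) (i : ℕ) : Val := v.toList.getD i nil

def bit : Bool → Val
  | false => nil
  | true => cons nil nil

/-- A tree read as a bit. -/
noncomputable def truth (v : Val) : Bool := decide (v ≠ nil)

def ofBits (b : List Bool) : Val := ofList (b.map bit)

/-- The unary numeral `1^m`. -/
def num (m : ℕ) : Val := ofList (List.replicate m nil)

def tuple {m : ℕ} (v : Fin m → Val) : Val := ofList (List.ofFn v)

end Val

/-! ## Quantum register

Qubits are named by trees. A computational basis state is the finite set of the qubits that are
`1`; all other qubits are `0`. A register is a (possibly unnormalised) finite superposition. -/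

abbrev QReg : Type := Finset Val →₀ ℂ

namespace QReg

noncomputable def zeroState : QReg := Finsupp.single ∅ 1

noncomputable def normSq (ψ : QReg) : ℝ := ψ.sum fun _ a => ‖a‖ ^ 2

/-- Hadamard gate on the qubit `q`. -/
noncomputable def hadamard (q : Val) : QReg →ₗ[ℂ] QReg :=
  Finsupp.linearCombination ℂ fun s : Finset Val =>
    ((1 / Real.sqrt 2 : ℝ) : ℂ) •
      ((Finsupp.single (s.erase q) (1 : ℂ) : QReg)
        + Finsupp.single (insert q s) (if q ∈ s then (-1 : ℂ) else 1))

/-- `T` gate, `|0⟩ ↦ |0⟩` and `|1⟩ ↦ exp(iπ/4)|1⟩`, on the qubit `q`. -/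
noncomputable def tGate (q : Val) : QReg →ₗ[ℂ] QReg :=
  Finsupp.linearCombination ℂ fun s : Finset Val =>
    (Finsupp.single s (if q ∈ s then Complex.exp (Complex.I * (Real.pi / 4)) else 1) : QReg)

/-- Controlled-not with control `a` and target `b`; the identity if `a = b`. -/
noncomputable def cnot (a b : Val) : QReg →ₗ[ℂ] QReg :=
  Finsupp.linearCombination ℂ fun s : Finset Val =>
    (Finsupp.single
      (if a ∈ s ∧ a ≠ b then (if b ∈ s then s.erase b else insert b s) else s) 1 : QReg)

/-- Projection onto the subspace where the qubit `q` has the value `b`. -/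
noncomputable def proj (q : Val) (b : Bool) (ψ : QReg) : QReg :=
  ψ.filter fun s => (q ∈ s ↔ b = true)

/-- The partial inner product `(⟨u| ⊗ I)ψ`, where `u` is the uniform superposition
`|X|^(-1/2) ∑_{x ∈ X} |x⟩` on the listed qubits. -/
noncomputable def uniformPart (names : List Val) (X : Set (List Bool)) (ψ : QReg) : QReg :=
  ψ.sum fun s a =>
    if (names.map fun q => decide (q ∈ s)) ∈ X then
      Finsupp.single (s \ names.toFinset) (a / ((Real.sqrt (X.ncard : ℝ) : ℝ) : ℂ))
    else 0

end QReg

/-! ## Machine model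

Programs over trees with coin flips and with a quantum register on which the universal gate set
`{H, T, CNOT}` and measurements in the computational basis are available. Every instruction costs
one plus the size of the data it handles. The number of iterations of a loop is fixed when the loop
is entered, so all programs halt; clocked Turing machines are such programs, hence polynomial time
in this model is polynomial time on Turing machines (deterministic, probabilistic, quantum). -/

inductive Prog : Type
  | id : Prog
  | nil : Prog
  | hd : Prog
  | tl : Prog
  /-- `x ↦ cons (p x) (q x)` -/
  | pair : Prog → Prog → Prog
  /-- first the left program, then the right one on its output -/
  | seq : Prog → Prog → Prog
  /-- `ite p q r`: on `x`, run `q` on `x` if `p` outputs a non-empty tree, and `r` otherwise -/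
  | ite : Prog → Prog → Prog → Prog
  /-- on input `cons m x`, iterate the body, starting from `x`, as many times as `m` has entries -/
  | loop : Prog → Prog
  /-- a uniformly random bit -/
  | flip : Prog
  /-- Hadamard gate on the qubit named by the input -/
  | had : Prog
  /-- `T` gate on the qubit named by the input -/
  | tee : Prog
  /-- on input `cons a b`, controlled-not from the qubit `a` to the qubit `b` -/
  | cnot : Prog
  /-- measure the qubit named by the input, and output the result -/
  | meas : Prog
  /-- on input `cons a x`, run the body on `x`, where each of its qubit names `q` stands for the
  qubit `cons a q` -/
  | scoped : Prog → Prog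

/-- One branch of a computation, i.e. one sequence of coin flips and measurement results: the
probability of the coin flips, the current data, the register projected according to the
measurement results, and the time used. -/
structure Conf where
  wt : ℝ
  val : Val
  reg : QReg
  time : ℕ

namespace Conf

def start (v : Val) (ψ : QReg) : Conf := ⟨1, v, ψ, 0⟩

def tick (c : Conf) : Conf := { c with time := c.time + 1 + c.val.size }

/-- The probability of the branch. -/
noncomputable def weight (c : Conf) : ℝ := c.wt * QReg.normSq c.reg

end Conf

namespace Prog

/-- The list of all branches; `ρ` translates the qubit names of the program to those of the
register. -/
noncomputable def eval : (Val → Val) → Prog → Conf → List Conf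
  | _, .id, c => [c.tick]
  | _, .nil, c => [{ c.tick with val := Val.nil }]
  | _, .hd, c => [{ c.tick with val := c.val.hd }]
  | _, .tl, c => [{ c.tick with val := c.val.tl }]
  | ρ, .pair p q, c =>
      (eval ρ p c.tick).flatMap fun c₁ =>
        (eval ρ q { c₁ with val := c.val }).map fun c₂ =>
          Conf.tick { c₂ with val := Val.cons c₁.val c₂.val }
  | ρ, .seq p q, c => (eval ρ p c.tick).flatMap fun c₁ => eval ρ q c₁
  | ρ, .ite p q r, c =>
      (eval ρ p c.tick).flatMap fun c₁ =>
        if c₁.val = Val.nil then eval ρ r { c₁ with val := c.val }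
        else eval ρ q { c₁ with val := c.val }
  | ρ, .loop p, c =>
      (fun L : List Conf => L.flatMap fun c₁ => eval ρ p c₁)^[c.val.hd.len]
        [{ c.tick with val := c.val.tl }]
  | _, .flip, c =>
      [{ c.tick with wt := c.wt / 2, val := Val.bit false },
       { c.tick with wt := c.wt / 2, val := Val.bit true }]
  | ρ, .had, c => [{ c.tick with reg := QReg.hadamard (ρ c.val) c.reg }]
  | ρ, .tee, c => [{ c.tick with reg := QReg.tGate (ρ c.val) c.reg }]
  | ρ, .cnot, c => [{ c.tick with reg := QReg.cnot (ρ c.val.hd) (ρ c.val.tl) c.reg }]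
  | ρ, .meas, c =>
      [{ c.tick with val := Val.bit false, reg := QReg.proj (ρ c.val) false c.reg },
       { c.tick with val := Val.bit true, reg := QReg.proj (ρ c.val) true c.reg }]
  | ρ, .scoped p, c => eval (fun q => ρ (Val.cons c.val.hd q)) p { c.tick with val := c.val.tl }

/-- The program does not use the quantum register. -/
def Classical : Prog → Prop
  | .pair p q => p.Classical ∧ q.Classical
  | .seq p q => p.Classical ∧ q.Classical
  | .ite p q r => p.Classical ∧ q.Classical ∧ r.Classical
  | .loop p => p.Classical
  | .had => False
  | .tee => False
  | .cnot => False
  | .meas => False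
  | .scoped _ => False
  | _ => True

/-- The branches of a run of `p` from the configuration `c`. -/
noncomputable def run (p : Prog) (c : Conf) : List Conf := p.eval (fun q => q) c

/-- Sum of `φ` over the branches of a run. -/
noncomputable def total (p : Prog) (c : Conf) (φ : Conf → ℝ) : ℝ := ((p.run c).map φ).sum

/-- Quantum polynomial time: on every input, every branch halts in time polynomial in the input
size. -/
def QPT (p : Prog) : Prop :=
  ∃ P : Polynomial ℕ, ∀ (v : Val) (ψ : QReg), ∀ c ∈ p.run (Conf.start v ψ), c.time ≤ P.eval v.size

/-- Probabilistic polynomial time. -/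
def PPT (p : Prog) : Prop := p.Classical ∧ p.QPT

/-- On input `v`, the program always outputs `w`. -/
def Outputs (p : Prog) (v w : Val) : Prop := ∀ c ∈ p.run (Conf.start v QReg.zeroState), c.val = w

/-- The probability that the output on input `v` satisfies `S`. -/
noncomputable def prob (p : Prog) (v : Val) (S : Val → Prop) : ℝ :=
  p.total (Conf.start v QReg.zeroState) fun c => if S c.val then c.weight else 0

end Prog

/-- `1^κ ↦ 1^(n κ)` is computable in polynomial time (so `n` is polynomially bounded). -/
def PolyTimeComputable (n : ℕ → ℕ) : Prop :=
  ∃ p : Prog, p.PPT ∧ ∀ κ, p.Outputs (Val.num κ) (Val.num (n κ))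

def Negligible (μ : ℕ → ℝ) : Prop :=
  Asymptotics.SuperpolynomialDecay atTop (fun κ : ℕ => (κ : ℝ)) μ

/-- Advice of a non-uniform quantum adversary: for each security parameter, a string of polynomial
size and a pure state of polynomially many qubits. -/
structure Advice where
  str : ℕ → Val
  reg : ℕ → QReg
  str_poly : ∃ P : Polynomial ℕ, ∀ κ, (str κ).size ≤ P.eval κ
  reg_unit : ∀ κ, QReg.normSq (reg κ) = 1
  reg_poly : ∃ P : Polynomial ℕ, ∀ κ, ∃ Q : Finset Val,
    Q.card ≤ P.eval κ ∧ ∀ s ∈ (reg κ).support, s ⊆ Q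

/-! ## Bit strings -/

/-- `⟨b, x⟩ = ⨁ⱼ bⱼ xⱼ`. -/
def innerBits (b x : List Bool) : Bool := (List.zipWith and b x).foldr xor false

def xorBits (x y : List Bool) : List Bool := List.zipWith xor x y

/-! ## Families of functions -/

/-- A family `f_k : X_κ → Y_κ`, `k ∈ K_κ`, with `X_κ ⊆ {0,1}^(l κ)`, together with the relation
"`t` is a trapdoor of `k`", the function `h : X_κ → {0,1}^(n κ)`, and the string
`d₀(k) ∈ {0,1}^(n κ)` attached to a key. -/
structure Family (n : ℕ → ℕ) where
  l : ℕ → ℕ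
  X : ℕ → Set (List Bool)
  X_length : ∀ κ, ∀ x ∈ X κ, x.length = l κ
  Y : ℕ → Set Val
  K : ℕ → Set Val
  IsTrapdoor : ℕ → (key trapdoor : Val) → Prop
  f : ℕ → (key : Val) → List Bool → Val
  h : (κ : ℕ) → List Bool → Fin (n κ) → Bool
  d₀ : (κ : ℕ) → (key : Val) → Fin (n κ) → Bool

/-- The algorithms that come with a family. -/
structure Algorithms where
  gen : Prog
  evaluate : Prog
  invert : Prog
  support : Prog
  hash : Prog
  superpose : Prog

/-- The input `(1^κ, d)` of the key generation. -/
def genInput {m : ℕ} (κ : ℕ) (d : Fin m → Bool) : Val :=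
  Val.cons (Val.num κ) (Val.ofBits (List.ofFn d))

/-- `y` has exactly the two distinct preimages `x` and `x'` under `f_k`. -/
def Family.Twin {n : ℕ → ℕ} (F : Family n) (κ : ℕ) (k y : Val) (x x' : List Bool) : Prop :=
  x ≠ x' ∧ {z | z ∈ F.X κ ∧ F.f κ k z = y} = {x, x'}

/-- Winning probability in the game `IND-D0` of the adversary `(A₁, A₂)` with the given advice. -/
noncomputable def indD0 (n : ℕ → ℕ) (gen : Prog) (a : Advice) (A₁ A₂ : Prog) (κ : ℕ) : ℝ :=
  A₁.total (Conf.start (Val.cons (Val.num κ) (a.str κ)) (a.reg κ)) fun c₁ =>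
    let msg : Val := c₁.val.hd
    let state : Val := c₁.val.tl
    let d : Bool → Fin (n κ) → Bool := fun b i => ((if b then msg.tl else msg.hd).nth i).truth
    ∑ b : Bool,
      gen.total { c₁ with wt := c₁.wt / 2, val := genInput κ (d b) } fun c₂ =>
        A₂.total { c₂ with val := Val.cons state c₂.val.hd } fun c₃ =>
          if c₃.val.truth = b then c₃.weight else 0

/-- The symbols `0`, `1`, `✗` and `⊥`. -/
inductive Info : Type
  | bit : Bool → Info
  | cross : Info
  | bot : Info

def Info.enc : Info → Val
  | .bot => Val.nil
  | .cross => Val.cons Val.nil Val.nil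
  | .bit b => Val.cons (Val.bit true) (Val.bit b)

/-- `{(i, v[i])}_{i ∈ M}` -/
noncomputable def leak {m : ℕ} (M : Fin m → Bool) (v : Val) : Val :=
  Val.ofList (((List.finRange m).filter fun i => M i).map fun i => Val.cons (Val.num i) (v.nth i))

/-- Winning probability in the game `IND-PARTIAL` of the adversary `(A₁, A₂, A₃)` with the given
advice. -/
noncomputable def indPartial (n : ℕ → ℕ) (gen partInfo : Prog) (a : Advice) (A₁ A₂ A₃ : Prog)
    (κ : ℕ) : ℝ :=
  A₁.total (Conf.start (Val.cons (Val.num κ) (a.str κ)) (a.reg κ)) fun c₁ =>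
    let msg : Val := c₁.val.hd
    let state : Val := c₁.val.tl
    let M : Fin (n κ) → Bool := fun i => (msg.hd.nth i).truth
    let d : Bool → Fin (n κ) → Bool := fun b i =>
      ((if b then msg.tl.tl else msg.tl.hd).nth i).truth
    if ∃ i, M i = true ∧ d false i ≠ d true i then 0
    else
      ∑ b : Bool,
        gen.total { c₁ with wt := c₁.wt / 2, val := genInput κ (d b) } fun c₂ =>
          A₂.total { c₂ with val := Val.cons state c₂.val.hd } fun c₃ =>
            partInfo.total
                { c₃ with val := Val.cons (Val.num κ) (Val.cons c₂.val.tl c₃.val.hd) } fun c₄ =>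
              A₃.total { c₄ with val := Val.cons c₃.val.tl (leak M c₄.val) } fun c₅ =>
                if c₅.val.truth = b then c₅.weight else 0

/-- The family `F` with the algorithms `A` is `δ`-HGHZ capable. -/
structure IsHGHZCapable {n : ℕ → ℕ} (F : Family n) (A : Algorithms) (δ : ℕ → ℝ) : Prop where
  maps_to : ∀ κ, ∀ k ∈ F.K κ, ∀ x ∈ F.X κ, F.f κ k x ∈ F.Y κ
  gen_ppt : A.gen.PPT
  gen_overwhelming : ∃ μ, Negligible μ ∧ ∀ κ (d : Fin (n κ) → Bool),
    1 - μ κ ≤ A.gen.prob (genInput κ d) fun v => v.hd ∈ F.K κ ∧ F.IsTrapdoor κ v.hd v.tl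
  eval_ppt : A.evaluate.PPT
  eval_correct : ∀ κ, ∀ k ∈ F.K κ, ∀ x ∈ F.X κ,
    A.evaluate.Outputs (Val.cons (Val.num κ) (Val.cons k (Val.ofBits x))) (F.f κ k x)
  invert_ppt : A.invert.PPT
  invert_correct : ∀ κ, ∀ k ∈ F.K κ, ∀ t, F.IsTrapdoor κ k t → ∀ y ∈ F.Y κ,
    ∀ c ∈ A.invert.run
        (Conf.start (Val.cons (Val.num κ) (Val.cons t y)) QReg.zeroState),
      (∃ x x', F.Twin κ k y x x' ∧ c.val = Val.cons (Val.ofBits x) (Val.ofBits x')) ∨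
        ((¬ ∃ x x', F.Twin κ k y x x') ∧ c.val = Val.nil)
  superpose_qpt : A.superpose.QPT
  /-- The program outputs the names of `l κ` qubits; the fidelity of their (mixed) state with the
  uniform superposition over `X_κ` is overwhelming. -/
  superpose_correct : ∃ μ, Negligible μ ∧ ∀ κ,
    1 - μ κ ≤ A.superpose.total (Conf.start (Val.num κ) QReg.zeroState) fun c =>
      if c.val.toList.Nodup ∧ c.val.len = F.l κ then
        c.wt * QReg.normSq (QReg.uniformPart c.val.toList (F.X κ) c.reg)
      else 0
  two_to_one : ∀ κ, ∀ k ∈ F.K κ,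
    (1 - δ κ) * ((F.X κ).ncard : ℝ) ≤
      ({x | x ∈ F.X κ ∧ ∃ z z', F.Twin κ k (F.f κ k x) z z'}.ncard : ℝ)
  hash_ppt : A.hash.PPT
  hash_correct : ∀ κ, ∀ x ∈ F.X κ,
    A.hash.Outputs (Val.cons (Val.num κ) (Val.ofBits x)) (Val.ofBits (List.ofFn (F.h κ x)))
  xor_h : ∀ κ, ∀ k ∈ F.K κ, ∀ y x x', F.Twin κ k y x x' →
    ∀ i, xor (F.h κ x i) (F.h κ x' i) = F.d₀ κ k i
  d₀_gen : ∀ κ (d : Fin (n κ) → Bool),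
    ∀ c ∈ A.gen.run (Conf.start (genInput κ d) QReg.zeroState),
      c.val.hd ∈ F.K κ → F.d₀ κ c.val.hd = d
  support_ppt : A.support.PPT
  support_correct : ∀ κ, ∀ k ∈ F.K κ, ∀ t, F.IsTrapdoor κ k t →
    A.support.Outputs (Val.cons (Val.num κ) t) (Val.ofBits (List.ofFn (F.d₀ κ k)))
  indistinguishability : ∀ (a : Advice) (A₁ A₂ : Prog), A₁.QPT → A₂.QPT →
    ∃ μ, Negligible μ ∧ ∀ κ, indD0 n A.gen a A₁ A₂ κ ≤ 1 / 2 + μ κ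

/-- The family `F` with the algorithms `A` and `partInfo` is `δ`-GHZcan capable. -/
structure IsGHZCanCapable {n : ℕ → ℕ} (F : Family n) (A : Algorithms) (partInfo : Prog)
    (δ : ℕ → ℝ) : Prop where
  hghz : IsHGHZCapable F A δ
  partInfo_ppt : partInfo.PPT
  partInfo_correct : ∀ κ, ∀ k ∈ F.K κ, ∀ t, F.IsTrapdoor κ k t → ∀ y ∈ F.Y κ,
    ∀ c ∈ partInfo.run (Conf.start (Val.cons (Val.num κ) (Val.cons t y)) QReg.zeroState),
      ∃ v : Fin (n κ) → Info, c.val = Val.tuple (fun i => (v i).enc) ∧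
        ((∃ x x', F.Twin κ k y x x') ↔ ∀ i, v i ≠ Info.bot) ∧
        (∀ i, (∀ b, v i = Info.bit b → F.d₀ κ k i = true) ∧
          (v i = Info.cross → F.d₀ κ k i = false)) ∧
        (∀ x x', F.Twin κ k y x x' → ∃ u : Fin (n κ) → Bool, (u = F.h κ x ∨ u = F.h κ x') ∧
          ∀ i, F.d₀ κ k i = true → v i = Info.bit (u i))
  partInfo_secure : ∀ (a : Advice) (A₁ A₂ A₃ : Prog), A₁.QPT → A₂.QPT → A₃.QPT →
    ∃ μ, Negligible μ ∧ ∀ κ, indPartial n A.gen partInfo a A₁ A₂ A₃ κ ≤ 1 / 2 + μ κ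

/-- The keys of one party: the set of keys, the trapdoor relation, and the bit of a key. -/
structure LocalKeys where
  K : ℕ → Set Val
  IsTrapdoor : ℕ → (key trapdoor : Val) → Prop
  bit : ℕ → (key : Val) → Bool

/-- The input `(1^κ, i, t, y)` of a local procedure (`i` is counted from `0`). -/
def locInput (κ i : ℕ) (t y : Val) : Val :=
  Val.cons (Val.num κ) (Val.cons (Val.num i) (Val.cons t y))

/-- The input `(1^κ, i, t, y, b)`. -/
def alphaInput (κ i : ℕ) (t y : Val) (b : List Bool) : Val :=
  locInput κ i t (Val.cons y (Val.ofBits b))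

/-- The family is distributable, with the local keys `L` and the procedures `genLoc`, `partInfoLoc`
and `partAlphaLoc`. The existence of a local trapdoor check is `IsLocalCheckTrapdoor` below. -/
structure IsDistributable {n : ℕ → ℕ} (F : Family n) (A : Algorithms) (partInfo : Prog)
    (L : LocalKeys) (genLoc partInfoLoc partAlphaLoc : Prog) : Prop where
  K_eq : ∀ κ, F.K κ = {k | ∃ ks : Fin (n κ) → Val, (∀ i, ks i ∈ L.K κ) ∧ k = Val.tuple ks}
  trapdoor_iff : ∀ κ k t, F.IsTrapdoor κ k t ↔
    ∃ ks ts : Fin (n κ) → Val, k = Val.tuple ks ∧ t = Val.tuple ts ∧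
      ∀ i, L.IsTrapdoor κ (ks i) (ts i)
  d₀_eq : ∀ κ (ks : Fin (n κ) → Val), (∀ i, ks i ∈ L.K κ) →
    ∀ i, F.d₀ κ (Val.tuple ks) i = L.bit κ (ks i)
  genLoc_ppt : genLoc.PPT
  gen_eq : ∀ κ (d : Fin (n κ) → Bool) (ks ts : Fin (n κ) → Val),
    A.gen.prob (genInput κ d) (fun v => v.hd = Val.tuple ks ∧ v.tl = Val.tuple ts) =
      ∏ i : Fin (n κ), genLoc.prob (genInput κ (fun _ : Fin 1 => d i)) fun v => v.hd = ks i ∧ v.tl = ts i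
  partInfoLoc_ppt : partInfoLoc.PPT
  partInfo_eq : ∀ κ (ks ts : Fin (n κ) → Val), (∀ i, ks i ∈ L.K κ) →
    (∀ i, L.IsTrapdoor κ (ks i) (ts i)) → ∀ y ∈ F.Y κ, ∀ v : Fin (n κ) → Info,
      partInfo.prob (Val.cons (Val.num κ) (Val.cons (Val.tuple ts) y))
          (fun w => w = Val.tuple fun i => (v i).enc) =
        ∏ i : Fin (n κ), partInfoLoc.prob (locInput κ i (ts i) y) fun w => w = (v i).enc
  partAlphaLoc_ppt : partAlphaLoc.PPT
  partAlpha_correct : ∀ κ (ks ts : Fin (n κ) → Val), (∀ i, ks i ∈ L.K κ) →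
    (∀ i, L.IsTrapdoor κ (ks i) (ts i)) → ∀ (y : Val) (x x' b : List Bool),
      F.Twin κ (Val.tuple ks) y x x' → b.length = F.l κ →
        ∃ α : Fin (n κ) → Bool,
          (∀ i : Fin (n κ), partAlphaLoc.Outputs (alphaInput κ i (ts i) y b) (Info.bit (α i)).enc) ∧
          innerBits b (xorBits x x') = (List.ofFn α).foldr xor false

/-- The input `(1^κ, d, t, k)` of a trapdoor check. -/
def checkInput (κ : ℕ) (d : List Bool) (t k : Val) : Val :=
  Val.cons (Val.num κ) (Val.cons (Val.ofBits d) (Val.cons t k))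

/-- `chk` accepts `(d, t, k)` iff `k` is a key with trapdoor `t` and `d = d₀(k)`. -/
def IsCheckTrapdoor {n : ℕ → ℕ} (F : Family n) (chk : Prog) : Prop :=
  chk.PPT ∧ ∀ κ (d : Fin (n κ) → Bool) (t k : Val),
    chk.Outputs (checkInput κ (List.ofFn d) t k)
      (Val.bit (decide (k ∈ F.K κ ∧ F.IsTrapdoor κ k t ∧ F.d₀ κ k = d)))

/-- `chk` accepts `(d, t, k)` iff `k` is a local key with trapdoor `t` and with the bit `d`. -/
def IsLocalCheckTrapdoor (L : LocalKeys) (chk : Prog) : Prop :=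
  chk.PPT ∧ ∀ κ (d : Bool) (t k : Val),
    chk.Outputs (checkInput κ [d] t k)
      (Val.bit (decide (k ∈ L.K κ ∧ L.IsTrapdoor κ k t ∧ L.bit κ k = d)))

/-! ## The concatenated family -/

namespace Family

/-- `X_κ = {0,1} × X̄_κ`, every image has at most two preimages, and two twin preimages have the
forms `(0, x̄)` and `(1, x̄')`. -/
structure LabelledTwins {n : ℕ → ℕ} (F : Family n) : Prop where
  ne_nil : ∀ κ, ∀ x ∈ F.X κ, x ≠ []
  label : ∀ κ (b b' : Bool) (x : List Bool), b :: x ∈ F.X κ → b' :: x ∈ F.X κ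
  le_two : ∀ κ, ∀ k ∈ F.K κ, ∀ y, {z | z ∈ F.X κ ∧ F.f κ k z = y}.ncard ≤ 2
  twin : ∀ κ, ∀ k ∈ F.K κ, ∀ y x x', F.Twin κ k y x x' →
    ∃ z z', (x = false :: z ∧ x' = true :: z') ∨ (x = true :: z ∧ x' = false :: z')

/-- The `i`-th block `s⁽ⁱ⁾` (counted from `0`) of a string `c | s⁽⁰⁾ | … | s⁽ⁿ⁻¹⁾` whose blocks have
length `l κ - 1`. -/
def block {n : ℕ → ℕ} (F : Family n) (κ : ℕ) (x : List Bool) (i : ℕ) : List Bool :=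
  (x.tail.drop (i * (F.l κ - 1))).take (F.l κ - 1)

/-- `(c, x̄⁽ⁱ⁾)`, for `x = (c, x̄⁽⁰⁾, …, x̄⁽ⁿ⁻¹⁾)`. -/
def part {n : ℕ → ℕ} (F : Family n) (κ : ℕ) (x : List Bool) (i : ℕ) : List Bool :=
  x.headD false :: F.block κ x i

/-- `f'_(k⁽⁰⁾, …)(c, x̄⁽⁰⁾, …) = (f_k⁽⁰⁾(c, x̄⁽⁰⁾), …)`, for `n κ` keys. -/
def concat (F : Family fun _ => 1) (n : ℕ → ℕ) : Family n where
  l κ := 1 + n κ * (F.l κ - 1)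
  X κ := {x | x.length = 1 + n κ * (F.l κ - 1) ∧ ∀ i : Fin (n κ), F.part κ x i ∈ F.X κ}
  X_length _ _ hx := hx.1
  Y κ := {y | ∃ ys : Fin (n κ) → Val, (∀ i, ys i ∈ F.Y κ) ∧ y = Val.tuple ys}
  K κ := {k | ∃ ks : Fin (n κ) → Val, (∀ i, ks i ∈ F.K κ) ∧ k = Val.tuple ks}
  IsTrapdoor κ k t := ∃ ks ts : Fin (n κ) → Val, k = Val.tuple ks ∧ t = Val.tuple ts ∧
    ∀ i, F.IsTrapdoor κ (ks i) (ts i)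
  f κ k x := Val.tuple fun i : Fin (n κ) => F.f κ (k.nth i) (F.part κ x i)
  h κ x i := F.h κ (F.part κ x i) 0
  d₀ κ k i := F.d₀ κ (k.nth i) 0

def toLocalKeys (F : Family fun _ => 1) : LocalKeys where
  K := F.K
  IsTrapdoor := F.IsTrapdoor
  bit κ k := F.d₀ κ k 0

/-- `PartInfo_Loc` for the key `k` and its component `y` of the image. -/
noncomputable def partInfoLoc (F : Family fun _ => 1) (κ : ℕ) (k y : Val) : Info :=
  if H : ∃ z : List Bool, ∃ z', F.Twin κ k y (false :: z) (true :: z') then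
    if F.d₀ κ k 0 = false then Info.cross
    else Info.bit (F.h κ (false :: H.choose) 0)
  else Info.bot

/-- `PartAlpha_Loc` for the `i`-th key `k`, its component `y` of the image, and the string `b`. -/
noncomputable def partAlphaLoc (F : Family fun _ => 1) (κ : ℕ) (i : ℕ) (k y : Val)
    (b : List Bool) : Info :=
  if H : ∃ p : List Bool × List Bool, F.Twin κ k y (false :: p.1) (true :: p.2) then
    let a : Bool := innerBits (F.block κ b i) (xorBits H.choose.1 H.choose.2)
    Info.bit (if i = 0 then xor (b.headD false) a else a)
  else Info.bot

end Family

end GHZ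

open GHZ

/-!
# Concatenation of one-bit HGHZ capable families

*Twins.* If two different preimages of `y = (y⁽⁰⁾, …)` under `f'_k` had the same first bit, they
would differ in some block, and the two corresponding preimages of `y⁽ⁱ⁾` would be twins with the
same first bit, which the hypothesis excludes. So their first bits differ, hence all their
components do, and since an image under `f` has at most two preimages, the components are twins
throughout (`LabelledTwins.twins_of_twin_concat`). Conversely, a preimage of a `y` all of whose
components have twins is determined by its first bit (`twin_concat_of_twins`). Passing to the twin
is a bijection between the two values of the first bit; therefore, for each of them, the proportion
of the strings whose image has two preimages is at least `1 - δ`, and these proportions multiply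
(`LabelledTwins.concat_two_to_one`). The bound `1 - (1 - δ)^n ≤ δ n` is Bernoulli's inequality.

*Programs.* The branches of a program do not depend on the register: each is a coin weight, an
output, a running time and a linear map (`Prog.br`, `Prog.eval_eq`). Hence a run is described by
`Prog.always`, for the properties of all outputs, and by `Prog.expect`, for the winning
probabilities and overlaps (`Prog.total_eq`), and both are compositional. The classical algorithms
of the concatenated family tabulate those of the given one over the components (`Prog.tab`), and
the joint law of the entries of a table is that of independent runs (`Prog.meanPi`). This gives the
product formulas of a distributable family (`prob_concatGen`, `prob_concatInfo`) and, with
Bernoulli's inequality, overwhelming correctness of the key generation. The formula for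
`⟨b, x ⊕ x'⟩` is bilinearity, where the first bits of the twins contribute `b_c` to the component
with the index `0` (`innerBits_concat`).

*Uniform superposition.* The given program is run once for each component, in pairwise disjoint
scopes, and the qubits that hold the first bit are dropped in all runs but one. Runs in disjoint
scopes yield a product state (`Prog.expect_scope`), and the overlap with the uniform superposition
over a product set factorizes (`QReg.uniformL_tens`). Dropping a qubit does not decrease the
overlap (`QReg.normSq_uniformL_cons_le`): because the first bit is arbitrary in `X`, the uniform
superposition over `X` is the product of `H |0⟩` with a uniform superposition of the other bits.
So the fidelity is at least the `n`-th power of the given one (`Prog.overlap_le`).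

*Security.* A hybrid argument changes the bits outside `M` one at a time, from `d⁽⁰⁾` to `d⁽¹⁾`.
An adversary against the concatenated family yields one against the given family: it embeds its
challenge as the `j`-th local key and generates the other local keys itself. The trapdoor of the
challenge, which it does not know, is not needed, as the partial information outside `M` is never
shown (`Prog.lastStages_congr`), and if `j ∈ M` the two hybrids agree and it guesses. The winning
probabilities of these adversaries telescope over `j` (`Prog.sum_expect_hybridA₂`,
`Prog.indPartial_le_sum`). The best index `j` for each security parameter is given as advice, so
one adversary covers all hybrid steps and the advantage grows by a factor `n` at most
(`IsHGHZCapable.concat_partInfo_secure`). The game `IND-D0` is the case `M = ∅`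
(`indD0_eq_indPartial`).
-/

namespace GHZ

/-! ### Norms of registers -/

namespace QReg

theorem normSq_eq_sum {ψ : QReg} {U : Finset (Finset Val)} (h : ψ.support ⊆ U) :
    normSq ψ = ∑ s ∈ U, ‖ψ s‖ ^ 2 :=
  Finsupp.sum_of_support_subset _ h _ (by simp)

theorem normSq_nonneg (ψ : QReg) : 0 ≤ normSq ψ :=
  Finset.sum_nonneg fun _ _ => by positivity

@[simp] theorem normSq_zero : normSq 0 = 0 := by simp [normSq]

@[simp] theorem normSq_single (s : Finset Val) (a : ℂ) :
    normSq (Finsupp.single s a) = ‖a‖ ^ 2 := by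
  simp [normSq]

/-- Up to a finite set of qubits that contains `q`, a register is a function on the subsets of a
finite set, and these come in pairs that differ in `q` only. -/
theorem normSq_pairs (q : Val) (ψ : QReg) : ∃ U : Finset Val, q ∉ U ∧
    ∀ φ : QReg, (∀ s ∈ φ.support, ∃ t ∈ ψ.support, s ⊆ insert q t) →
      normSq φ = ∑ s ∈ U.powerset, (‖φ s‖ ^ 2 + ‖φ (insert q s)‖ ^ 2) := by
  refine ⟨(ψ.support.sup id).erase q, by simp, fun φ h => ?_⟩
  rw [Finset.sum_add_distrib, ← Finset.sum_powerset_insert (by simp)]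
  apply normSq_eq_sum
  intro s hs
  obtain ⟨t, ht, hst⟩ := h s hs
  rw [Finset.mem_powerset]
  intro x hx
  by_cases hxq : x = q
  · simp [hxq]
  · have : x ∈ t := by simpa [hxq] using hst hx
    simp only [Finset.mem_insert, Finset.mem_erase, hxq, false_or, ne_eq, not_false_eq_true,
      true_and]
    exact Finset.mem_sup.2 ⟨t, ht, this⟩

/-- The Hadamard gate acts on each pair of basis states that differ in `q` only. -/
theorem hadamard_apply (q : Val) (ψ : QReg) {s : Finset Val} (hs : q ∉ s) :
    hadamard q ψ s = ((1 / Real.sqrt 2 : ℝ) : ℂ) * (ψ s + ψ (insert q s)) ∧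
    hadamard q ψ (insert q s) = ((1 / Real.sqrt 2 : ℝ) : ℂ) * (ψ s - ψ (insert q s)) := by
  have hne : s ≠ insert q s := fun h => hs (h ▸ Finset.mem_insert_self q s)
  induction ψ using Finsupp.induction_linear with
  | zero => simp
  | add f g hf hg =>
    simp only [map_add, Finsupp.add_apply, hf.1, hg.1, hf.2, hg.2]
    constructor <;> ring
  | single t a =>
    simp only [hadamard, Finsupp.linearCombination_single, Finsupp.smul_apply, Finsupp.add_apply,
      smul_eq_mul]
    by_cases ht : q ∈ t
    · have e1 : insert q t = t := Finset.insert_eq_of_mem ht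
      have e2 : t ≠ s := fun h => hs (h ▸ ht)
      have e3 : t.erase q = s ↔ t = insert q s :=
        ⟨fun h => by rw [← h, Finset.insert_erase ht], fun h => by rw [h, Finset.erase_insert hs]⟩
      have e4 : t.erase q ≠ insert q s := fun h =>
        Finset.notMem_erase q t (h ▸ Finset.mem_insert_self q s)
      simp only [Finsupp.single_apply, e1, e2, e3, e4, ht, if_true, if_false]
      constructor <;> split_ifs <;> ring
    · have e1 : t.erase q = t := Finset.erase_eq_of_notMem ht
      have e2 : t ≠ insert q s := fun h => ht (h ▸ Finset.mem_insert_self q s)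
      have e3 : insert q t = insert q s ↔ t = s :=
        ⟨fun h => by rw [← Finset.erase_insert ht, h, Finset.erase_insert hs], fun h => by rw [h]⟩
      have e4 : insert q t ≠ s := fun h => hs (h ▸ Finset.mem_insert_self q t)
      simp only [Finsupp.single_apply, e1, e2, e3, e4, ht, if_false]
      constructor <;> split_ifs <;> ring

theorem support_hadamard (q : Val) (ψ : QReg) :
    ∀ s ∈ (hadamard q ψ).support, ∃ t ∈ ψ.support, s ⊆ insert q t := by
  intro s hs
  by_contra hcon
  push Not at hcon
  have hz : ∀ t, s ⊆ insert q t → ψ t = 0 := fun t ht => by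
    by_contra h
    exact hcon t (Finsupp.mem_support_iff.2 h) ht
  apply Finsupp.mem_support_iff.1 hs
  by_cases hq : q ∈ s
  · have := (hadamard_apply q ψ (Finset.notMem_erase q s)).2
    rw [Finset.insert_erase hq] at this
    rw [this, hz (s.erase q) (by rw [Finset.insert_erase hq]), hz s (Finset.subset_insert _ _),
      sub_self, mul_zero]
  · rw [(hadamard_apply q ψ hq).1, hz, hz, add_zero, mul_zero] <;>
      simp [Finset.subset_insert]

theorem normSq_hadamard (q : Val) (ψ : QReg) : normSq (hadamard q ψ) = normSq ψ := by
  obtain ⟨U, hU, h⟩ := normSq_pairs q ψ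
  rw [h _ (support_hadamard q ψ), h ψ fun s hs => ⟨s, hs, Finset.subset_insert _ _⟩]
  refine Finset.sum_congr rfl fun s hs => ?_
  have hq : q ∉ s := fun hq => hU (Finset.mem_powerset.1 hs hq)
  rw [(hadamard_apply q ψ hq).1, (hadamard_apply q ψ hq).2, norm_mul, norm_mul, mul_pow, mul_pow,
    ← mul_add]
  have hp := parallelogram_law_with_norm ℝ (ψ s) (ψ (insert q s))
  have hc : ‖((1 / Real.sqrt 2 : ℝ) : ℂ)‖ ^ 2 = 1 / 2 := by
    rw [Complex.norm_real, Real.norm_eq_abs, sq_abs, div_pow, Real.sq_sqrt (by norm_num), one_pow]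
  rw [hc]
  nlinarith [hp]

/-- A sum of orthogonal multiples of basis states. -/
theorem normSq_sum_single {ι : Type*} (I : Finset ι) (f : ι → Finset Val) (a : ι → ℂ)
    (hf : Set.InjOn f I) :
    normSq (∑ i ∈ I, Finsupp.single (f i) (a i)) = ∑ i ∈ I, ‖a i‖ ^ 2 := by
  have hsub : (∑ i ∈ I, Finsupp.single (f i) (a i) : QReg).support ⊆ I.image f := by
    refine (Finsupp.support_finsetSum).trans fun s hs => ?_
    obtain ⟨i, hi, h⟩ := Finset.mem_biUnion.1 hs
    have := Finsupp.support_single_subset h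
    exact Finset.mem_image.2 ⟨i, hi, (Finset.mem_singleton.1 this).symm⟩
  rw [normSq_eq_sum hsub, Finset.sum_image hf]
  refine Finset.sum_congr rfl fun i hi => ?_
  rw [Finsupp.finsetSum_apply, Finset.sum_eq_single i]
  · simp
  · intro j hj hji
    exact Finsupp.single_eq_of_ne fun h => hji (hf hj hi h.symm)
  · exact fun h => (h hi).elim

/-- A linear map that permutes the basis states up to phases is unitary. -/
theorem normSq_monomial (f : Finset Val → Finset Val) (hf : Function.Injective f)
    (a : Finset Val → ℂ) (ha : ∀ s, ‖a s‖ = 1) (ψ : QReg) :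
    normSq (Finsupp.linearCombination ℂ (fun s => (Finsupp.single (f s) (a s) : QReg)) ψ)
      = normSq ψ := by
  rw [Finsupp.linearCombination_apply, Finsupp.sum]
  simp only [Finsupp.smul_single, smul_eq_mul]
  rw [normSq_sum_single _ _ _ hf.injOn]
  exact Finset.sum_congr rfl fun s _ => by simp [ha]

theorem normSq_tGate (q : Val) (ψ : QReg) : normSq (tGate q ψ) = normSq ψ := by
  refine normSq_monomial (fun s => s) (fun _ _ h => h) _ (fun s => ?_) ψ
  split_ifs
  · rw [mul_comm]
    exact_mod_cast Complex.norm_exp_ofReal_mul_I (Real.pi / 4)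
  · simp

theorem normSq_cnot (a b : Val) (ψ : QReg) : normSq (cnot a b ψ) = normSq ψ := by
  refine normSq_monomial _ (Function.Involutive.injective fun s => ?_) _ (fun s => by simp) ψ
  by_cases h : a ∈ s ∧ a ≠ b
  · by_cases hb : b ∈ s
    · simp [h, hb, Finset.insert_erase]
    · simp [h, hb]
  · simp [h]

/-- `QReg.proj` as a linear map. -/
noncomputable def projL (q : Val) (b : Bool) : QReg →ₗ[ℂ] QReg where
  toFun := proj q b
  map_add' _ _ := Finsupp.filter_add
  map_smul' _ _ := Finsupp.filter_smul

@[simp] theorem projL_apply (q : Val) (b : Bool) (ψ : QReg) : projL q b ψ = proj q b ψ := rfl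

theorem normSq_proj (q : Val) (ψ : QReg) :
    normSq (proj q false ψ) + normSq (proj q true ψ) = normSq ψ := by
  have h : ∀ b, (proj q b ψ).support ⊆ ψ.support := fun b =>
    Finsupp.support_filter (fun s => (q ∈ s ↔ b = true)) ψ ▸ Finset.filter_subset _ _
  rw [normSq_eq_sum (h false), normSq_eq_sum (h true), normSq_eq_sum (Finset.Subset.refl _),
    ← Finset.sum_add_distrib]
  refine Finset.sum_congr rfl fun s _ => ?_
  by_cases hq : q ∈ s <;> simp [proj, hq]

theorem normSq_zeroState : normSq zeroState = 1 := by simp [zeroState]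

end QReg

/-! ### Branches of a computation -/

/-- A branch of a computation, without reference to the configuration in which it starts: the
probability of its coin flips, its output, its running time, and its action on the register (for
each translation of the qubit names). -/
structure Branch where
  wt : ℝ
  val : Val
  time : ℕ
  op : (Val → Val) → QReg →ₗ[ℂ] QReg

namespace Branch

/-- A step that leaves the register alone. -/
noncomputable def step (v : Val) (t : ℕ) : Branch := ⟨1, v, t, fun _ => LinearMap.id⟩

/-- First `b`, then `c`. -/
noncomputable def comp (b c : Branch) : Branch :=
  ⟨b.wt * c.wt, c.val, b.time + c.time, fun ρ => (c.op ρ).comp (b.op ρ)⟩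

/-- The configuration that the branch leads to. -/
noncomputable def app (ρ : Val → Val) (c : Conf) (b : Branch) : Conf :=
  ⟨c.wt * b.wt, b.val, b.op ρ c.reg, c.time + b.time⟩

end Branch

namespace Prog

open Branch

/-- The branches of a program on a given input. They do not depend on the register. -/
noncomputable def br : Prog → Val → List Branch
  | .id, v => [step v (1 + v.size)]
  | .nil, v => [step Val.nil (1 + v.size)]
  | .hd, v => [step v.hd (1 + v.size)]
  | .tl, v => [step v.tl (1 + v.size)]
  | .pair p q, v => (br p v).flatMap fun b => (br q v).map fun c =>
      (step v (1 + v.size)).comp ((b.comp c).comp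
        (step (Val.cons b.val c.val) (1 + (Val.cons b.val c.val).size)))
  | .seq p q, v => (br p v).flatMap fun b => (br q b.val).map fun c =>
      (step v (1 + v.size)).comp (b.comp c)
  | .ite p q r, v => (br p v).flatMap fun b =>
      (if b.val = Val.nil then br r v else br q v).map fun c =>
        (step v (1 + v.size)).comp (b.comp c)
  | .loop p, v =>
      (fun L : List Branch => L.flatMap fun b => (br p b.val).map b.comp)^[v.hd.len]
        [step v.tl (1 + v.size)]
  | .flip, v =>
      [⟨1 / 2, Val.bit false, 1 + v.size, fun _ => LinearMap.id⟩,
       ⟨1 / 2, Val.bit true, 1 + v.size, fun _ => LinearMap.id⟩]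
  | .had, v => [⟨1, v, 1 + v.size, fun ρ => QReg.hadamard (ρ v)⟩]
  | .tee, v => [⟨1, v, 1 + v.size, fun ρ => QReg.tGate (ρ v)⟩]
  | .cnot, v => [⟨1, v, 1 + v.size, fun ρ => QReg.cnot (ρ v.hd) (ρ v.tl)⟩]
  | .meas, v =>
      [⟨1, Val.bit false, 1 + v.size, fun ρ => QReg.projL (ρ v) false⟩,
       ⟨1, Val.bit true, 1 + v.size, fun ρ => QReg.projL (ρ v) true⟩]
  | .scoped p, v => (br p v.tl).map fun b =>
      ⟨b.wt, b.val, 1 + v.size + b.time, fun ρ => b.op fun q => ρ (Val.cons v.hd q)⟩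

/-- The branches in the sense of `br` describe every run, in every scope. -/
theorem eval_eq (p : Prog) : ∀ (ρ : Val → Val) (c : Conf),
    p.eval ρ c = (p.br c.val).map (app ρ c) := by
  induction p with
  | id | nil | hd | tl | had | tee | cnot =>
    intro ρ c
    simp [eval, br, app, step, Conf.tick, add_assoc]
  | flip | meas =>
    intro ρ c
    simp [eval, br, app, Conf.tick, add_assoc, div_eq_mul_inv]
  | pair p q hp hq =>
    intro ρ c
    simp only [eval, br, hp, hq, List.flatMap_map, List.map_flatMap, List.map_map]
    refine List.flatMap_congr fun b _ => List.map_congr_left fun d _ => ?_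
    simp only [app, step, comp, Conf.tick, Function.comp, Conf.mk.injEq, LinearMap.comp_apply,
      LinearMap.id_apply, true_and]
    constructor
    · ring
    · omega
  | seq p q hp hq =>
    intro ρ c
    simp only [eval, br, hp, hq, List.flatMap_map, List.map_flatMap, List.map_map]
    refine List.flatMap_congr fun b _ => List.map_congr_left fun d _ => ?_
    simp only [app, step, comp, Conf.tick, Function.comp, Conf.mk.injEq, LinearMap.comp_apply,
      LinearMap.id_apply, true_and]
    constructor
    · ring
    · omega
  | ite p q r hp hq hr =>
    intro ρ c
    simp only [eval, br, hp, hq, hr, List.flatMap_map, List.map_flatMap, List.map_map]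
    refine List.flatMap_congr fun b _ => ?_
    have e : (app ρ c.tick b).val = b.val := rfl
    simp only [e]
    split_ifs <;>
    · refine List.map_congr_left fun d _ => ?_
      simp only [app, step, comp, Conf.tick, Function.comp, Conf.mk.injEq, LinearMap.comp_apply,
        LinearMap.id_apply, true_and]
      constructor
      · ring
      · omega
  | loop p hp =>
    intro ρ c
    simp only [eval, br]
    generalize c.val.hd.len = m
    have h0 : ([{ c.tick with val := c.val.tl }] : List Conf) =
        [step c.val.tl (1 + c.val.size)].map (app ρ c) := by
      simp [app, step, Conf.tick, add_assoc]
    rw [h0]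
    generalize [step c.val.tl (1 + c.val.size)] = L
    induction m generalizing L with
    | zero => rfl
    | succ m ih =>
      rw [Function.iterate_succ_apply, Function.iterate_succ_apply, ← ih]
      congr 1
      simp only [hp, List.flatMap_map, List.map_flatMap, List.map_map]
      refine List.flatMap_congr fun b _ => List.map_congr_left fun d _ => ?_
      simp only [app, comp, Function.comp, Conf.mk.injEq, LinearMap.comp_apply, true_and]
      constructor
      · ring
      · omega
  | _ p hp =>
    intro ρ c
    simp only [eval, br, hp, List.map_map]
    refine List.map_congr_left fun d _ => ?_
    simp only [app, Conf.tick, Function.comp, Conf.mk.injEq, true_and]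
    omega

theorem run_eq (p : Prog) (c : Conf) : p.run c = (p.br c.val).map (app (fun q => q) c) :=
  eval_eq p _ c

end Prog

theorem sum_map_flatMap {α β : Type*} (L : List α) (f : α → List β) (g : β → ℝ) :
    ((L.flatMap f).map g).sum = (L.map fun a => ((f a).map g).sum).sum := by
  induction L with
  | nil => rfl
  | cons a L ih => simp [ih]

theorem sum_map_comm {α β : Type*} (L : List α) (M : List β) (f : α → β → ℝ) :
    (L.map fun a => (M.map fun b => f a b).sum).sum =
      (M.map fun b => (L.map fun a => f a b).sum).sum := by
  induction L with
  | nil => simp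
  | cons a L ih => simp [ih, List.sum_map_add]

namespace Val

/-- `a` if `c` is a non-empty tree, and `b` otherwise. -/
def select {α : Type*} (c : Val) (a b : α) : α :=
  match c with
  | nil => b
  | cons _ _ => a

section
variable {α : Type*} (a b : α)

@[simp] theorem select_nil : select nil a b = b := rfl
@[simp] theorem select_cons (c d : Val) : select (cons c d) a b = a := rfl
theorem select_of_ne {c : Val} (h : c ≠ nil) : select c a b = a := by
  cases c
  · exact absurd rfl h
  · rfl
@[simp] theorem select_bit (c : Bool) : select (bit c) a b = if c then a else b := by
  cases c <;> rfl

end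

end Val

namespace Branch

theorem comp_assoc (a b c : Branch) : (a.comp b).comp c = a.comp (b.comp c) := by
  simp [comp, mul_assoc, add_assoc, LinearMap.comp_assoc]

theorem comp_step (b : Branch) : b.comp (step b.val 0) = b := by
  cases b
  simp only [comp, step, mul_one, add_zero, LinearMap.id_comp]

end Branch

namespace Prog

open Branch

/-- The branches of `m` iterations of a program. -/
noncomputable def brIter (p : Prog) : ℕ → Val → List Branch
  | 0, v => [step v 0]
  | m + 1, v => (p.br v).flatMap fun b => (brIter p m b.val).map b.comp

theorem iterate_eq (p : Prog) (m : ℕ) (L : List Branch) :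
    (fun L : List Branch => L.flatMap fun b => (br p b.val).map b.comp)^[m] L =
      L.flatMap fun b => (p.brIter m b.val).map b.comp := by
  induction m generalizing L with
  | zero =>
    simp [brIter, comp_step]
  | succ m ih =>
    rw [Function.iterate_succ_apply, ih]
    simp only [brIter, List.flatMap_assoc, List.flatMap_map, List.map_flatMap, List.map_map]
    refine List.flatMap_congr fun b _ => List.flatMap_congr fun c _ =>
      List.map_congr_left fun d _ => ?_
    exact comp_assoc _ _ _

theorem br_loop (p : Prog) (v : Val) : (loop p).br v =
    (p.brIter v.hd.len v.tl).map (step v.tl (1 + v.size)).comp := by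
  rw [br, iterate_eq]
  simp [step]

/-! ### Properties of all outputs -/

/-- Every branch has an output with the property `Q`. -/
def always (p : Prog) (v : Val) (Q : Val → Prop) : Prop := ∀ b ∈ p.br v, Q b.val

/-- The analogue of `always` for `m` iterations. -/
def alwaysIter (p : Prog) : ℕ → Val → (Val → Prop) → Prop
  | 0, v, Q => Q v
  | m + 1, v, Q => p.always v fun w => alwaysIter p m w Q

section always
variable (p q r : Prog) (v : Val) (Q : Val → Prop)

@[simp] theorem always_id : id.always v Q ↔ Q v := by simp [always, br, step]
@[simp] theorem always_nil : nil.always v Q ↔ Q Val.nil := by simp [always, br, step]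
@[simp] theorem always_hd : hd.always v Q ↔ Q v.hd := by simp [always, br, step]
@[simp] theorem always_tl : tl.always v Q ↔ Q v.tl := by simp [always, br, step]

@[simp] theorem always_pair : (pair p q).always v Q ↔
    p.always v fun a => q.always v fun b => Q (Val.cons a b) := by
  simp only [always, br, List.mem_flatMap, List.mem_map]
  constructor
  · intro h b hb c hc
    exact h _ ⟨b, hb, c, hc, rfl⟩
  · rintro h _ ⟨b, hb, c, hc, rfl⟩
    exact h b hb c hc

@[simp] theorem always_seq : (seq p q).always v Q ↔ p.always v fun a => q.always a Q := by
  simp only [always, br, List.mem_flatMap, List.mem_map]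
  constructor
  · intro h b hb c hc
    exact h ((step v (1 + v.size)).comp (b.comp c)) ⟨b, hb, c, hc, rfl⟩
  · rintro h _ ⟨b, hb, c, hc, rfl⟩
    exact h b hb c hc

@[simp] theorem always_ite : (ite p q r).always v Q ↔
    p.always v fun a => Val.select a (q.always v Q) (r.always v Q) := by
  simp only [always, br, List.mem_flatMap, List.mem_map]
  constructor
  · intro h b hb
    by_cases hv : b.val = Val.nil
    · rw [hv, Val.select_nil]
      exact fun c hc => h ((step v (1 + v.size)).comp (b.comp c))
        ⟨b, hb, c, by rwa [if_pos hv], rfl⟩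
    · rw [Val.select_of_ne _ _ hv]
      exact fun c hc => h ((step v (1 + v.size)).comp (b.comp c))
        ⟨b, hb, c, by rwa [if_neg hv], rfl⟩
  · rintro h _ ⟨b, hb, c, hc, rfl⟩
    have := h b hb
    by_cases hv : b.val = Val.nil
    · rw [hv, Val.select_nil] at this
      rw [if_pos hv] at hc
      exact this c hc
    · rw [Val.select_of_ne _ _ hv] at this
      rw [if_neg hv] at hc
      exact this c hc

theorem always_loop : (loop p).always v Q ↔ p.alwaysIter v.hd.len v.tl Q := by
  have key : ∀ m w, (∀ b ∈ p.brIter m w, Q b.val) ↔ p.alwaysIter m w Q := by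
    intro m
    induction m with
    | zero => simp [brIter, alwaysIter, step]
    | succ m ih =>
      intro w
      simp only [brIter, alwaysIter, always, List.mem_flatMap, List.mem_map, ← ih]
      constructor
      · intro h b hb c hc
        exact h (b.comp c) ⟨b, hb, c, hc, rfl⟩
      · rintro h _ ⟨b, hb, c, hc, rfl⟩
        exact h b hb c hc
  rw [← key, always, br_loop]
  simp [comp]

@[simp] theorem always_scoped : (Prog.scoped p).always v Q ↔ p.always v.tl Q := by
  simp [always, br]

end always

theorem always_mono {p : Prog} {v : Val} {Q R : Val → Prop} (h : p.always v Q)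
    (hQR : ∀ w, Q w → R w) : p.always v R := fun b hb => hQR _ (h b hb)

theorem br_ne_nil (p : Prog) : ∀ v, p.br v ≠ [] := by
  suffices h : ∀ v, ¬ p.always v fun _ => False from fun v hv => h v (by simp [always, hv])
  induction p with
  | id | nil | hd | tl => simp
  | had | tee | cnot => simp [always, br]
  | meas | flip => exact fun v h => h _ List.mem_cons_self
  | pair p q hp hq | seq p q hp hq =>
    intro v h
    simp only [always_pair, always_seq] at h
    exact hp v (always_mono h fun w hw => hq _ hw)
  | ite p q r hp hq hr =>
    intro v h
    simp only [always_ite] at h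
    refine hp v (always_mono h fun w hw => ?_)
    cases w
    exacts [hr _ hw, hq _ hw]
  | loop p hp =>
    intro v
    rw [always_loop]
    generalize v.hd.len = m
    generalize v.tl = w
    induction m generalizing w with
    | zero => simp [alwaysIter]
    | succ m ih => exact fun h => hp w (always_mono h fun x hx => ih x hx)
  | _ p hp => exact fun v h => hp _ ((always_scoped _ _ _).1 h)

/-- For a program with a known output, `always` is evaluation at the output. -/
theorem always_iff_of_eq {p : Prog} {v w : Val} (h : p.always v (· = w)) (Q : Val → Prop) :
    p.always v Q ↔ Q w := by
  refine ⟨fun hQ => ?_, fun hw => always_mono h fun x hx => hx ▸ hw⟩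
  obtain ⟨b, hb⟩ := List.exists_mem_of_ne_nil _ (br_ne_nil p v)
  exact h b hb ▸ hQ b hb

theorem forall_run_iff (p : Prog) (v : Val) (ψ : QReg) (Q : Val → Prop) :
    (∀ c ∈ p.run (Conf.start v ψ), Q c.val) ↔ p.always v Q := by
  simp [run_eq, always, Conf.start, app]

theorem outputs_iff (p : Prog) (v w : Val) : p.Outputs v w ↔ p.always v (· = w) :=
  forall_run_iff p v QReg.zeroState (· = w)

/-! ### Expectations -/

/-- The expectation of `g`, a function of the output and of the unnormalised final register. -/
noncomputable def expect (ρ : Val → Val) (p : Prog) (v : Val) (ψ : QReg) (g : Val → QReg → ℝ) : ℝ :=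
  ((p.br v).map fun b => b.wt * g b.val (b.op ρ ψ)).sum

/-- The analogue of `expect` for `m` iterations. -/
noncomputable def expectIter (ρ : Val → Val) (p : Prog) :
    ℕ → Val → QReg → (Val → QReg → ℝ) → ℝ
  | 0, v, ψ, g => g v ψ
  | m + 1, v, ψ, g => p.expect ρ v ψ fun w φ => expectIter ρ p m w φ g

/-- A sum over the branches of a run, each weighted with its coin flips, is an expectation. This
turns the games into nested expectations. -/
theorem total_eq (p : Prog) (c : Conf) (φ : Conf → ℝ) (g : Val → QReg → ℝ)
    (h : ∀ c, φ c = c.wt * g c.val c.reg) :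
    p.total c φ = c.wt * p.expect (fun q => q) c.val c.reg g := by
  simp only [total, run_eq, expect, ← List.sum_map_mul_left, List.map_map]
  congr 1
  refine List.map_congr_left fun b _ => ?_
  simp [h, app, mul_assoc]

section expect
variable (ρ : Val → Val) (p q r : Prog) (v : Val) (ψ : QReg) (g : Val → QReg → ℝ)

@[simp] theorem expect_id : expect ρ id v ψ g = g v ψ := by simp [expect, br, step]
@[simp] theorem expect_nil : expect ρ nil v ψ g = g Val.nil ψ := by simp [expect, br, step]
@[simp] theorem expect_hd : expect ρ hd v ψ g = g v.hd ψ := by simp [expect, br, step]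
@[simp] theorem expect_tl : expect ρ tl v ψ g = g v.tl ψ := by simp [expect, br, step]

@[simp] theorem expect_seq :
    expect ρ (seq p q) v ψ g = expect ρ p v ψ fun w φ => expect ρ q w φ g := by
  simp only [expect, br, sum_map_flatMap, List.map_map, ← List.sum_map_mul_left]
  simp [Function.comp_def, comp, step, mul_assoc]

@[simp] theorem expect_pair : expect ρ (pair p q) v ψ g =
    expect ρ p v ψ fun a φ => expect ρ q v φ fun b χ => g (Val.cons a b) χ := by
  simp only [expect, br, sum_map_flatMap, List.map_map, ← List.sum_map_mul_left]
  simp [Function.comp_def, comp, step, mul_assoc]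

@[simp] theorem expect_ite : expect ρ (ite p q r) v ψ g =
    expect ρ p v ψ fun a φ => Val.select a (expect ρ q v φ g) (expect ρ r v φ g) := by
  simp only [expect, br, sum_map_flatMap, List.map_map]
  congr 1
  refine List.map_congr_left fun b _ => ?_
  by_cases hv : b.val = Val.nil
  · rw [hv, Val.select_nil, if_pos rfl]
    simp [Function.comp_def, comp, step, mul_assoc, List.sum_map_mul_left]
  · rw [if_neg hv, Val.select_of_ne _ _ hv]
    simp [Function.comp_def, comp, step, mul_assoc, List.sum_map_mul_left]

theorem expect_loop :
    expect ρ (loop p) v ψ g = expectIter ρ p v.hd.len v.tl ψ g := by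
  have key : ∀ m w φ, ((p.brIter m w).map fun b => b.wt * g b.val (b.op ρ φ)).sum =
      expectIter ρ p m w φ g := by
    intro m
    induction m with
    | zero => simp [brIter, expectIter, step]
    | succ m ih =>
      intro w φ
      simp only [brIter, expectIter, expect, sum_map_flatMap, List.map_map, ← ih,
        ← List.sum_map_mul_left]
      simp [Function.comp_def, comp, mul_assoc]
  rw [← key, expect, br_loop, List.map_map]
  simp [Function.comp_def, comp, step]

@[simp] theorem expect_scoped : expect ρ (Prog.scoped p) v ψ g =
    expect (fun x => ρ (Val.cons v.hd x)) p v.tl ψ g := by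
  simp [expect, br, Function.comp_def]

end expect

theorem wt_nonneg (p : Prog) : ∀ v, ∀ b ∈ p.br v, 0 ≤ b.wt := by
  induction p with
  | id | nil | hd | tl | had | tee | cnot | meas | flip => simp [br, step]
  | pair p q hp hq | seq p q hp hq =>
    intro v b hb
    simp only [br, List.mem_flatMap, List.mem_map] at hb
    obtain ⟨b, hb, c, hc, rfl⟩ := hb
    simpa [comp, step] using mul_nonneg (hp _ b hb) (hq _ c hc)
  | ite p q r hp hq hr =>
    intro v b hb
    simp only [br, List.mem_flatMap, List.mem_map] at hb
    obtain ⟨b, hb, c, hc, rfl⟩ := hb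
    have : 0 ≤ c.wt := by
      split_ifs at hc
      exacts [hr _ c hc, hq _ c hc]
    simpa [comp, step] using mul_nonneg (hp _ b hb) this
  | loop p hp =>
    intro v b hb
    rw [br_loop] at hb
    obtain ⟨c, hc, rfl⟩ := List.mem_map.1 hb
    suffices h : ∀ m w, ∀ c ∈ p.brIter m w, 0 ≤ c.wt by
      simpa [comp, step] using h _ _ c hc
    intro m
    induction m with
    | zero => simp [brIter, step]
    | succ m ih =>
      intro w c hc
      simp only [brIter, List.mem_flatMap, List.mem_map] at hc
      obtain ⟨b, hb, c, hc, rfl⟩ := hc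
      exact mul_nonneg (hp _ b hb) (ih _ c hc)
  | _ p hp =>
    intro v b hb
    simp only [br, List.mem_map] at hb
    obtain ⟨b, hb, rfl⟩ := hb
    exact hp _ b hb

/-- Only the values of the integrand at actual outputs matter. -/
theorem expect_congr {ρ : Val → Val} {p : Prog} {v : Val} {ψ : QReg} {g g' : Val → QReg → ℝ}
    (h : p.always v fun w => ∀ φ, g w φ = g' w φ) : p.expect ρ v ψ g = p.expect ρ v ψ g' := by
  unfold expect
  congr 1
  exact List.map_congr_left fun b hb => by rw [h b hb]

theorem expect_mono {ρ : Val → Val} {p : Prog} {v : Val} {ψ : QReg} {g g' : Val → QReg → ℝ}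
    (h : ∀ w φ, g w φ ≤ g' w φ) : p.expect ρ v ψ g ≤ p.expect ρ v ψ g' :=
  List.sum_le_sum fun b hb => mul_le_mul_of_nonneg_left (h _ _) (wt_nonneg p v b hb)

theorem expect_add (ρ : Val → Val) (p : Prog) (v : Val) (ψ : QReg) (g g' : Val → QReg → ℝ) :
    p.expect ρ v ψ (fun w φ => g w φ + g' w φ) = p.expect ρ v ψ g + p.expect ρ v ψ g' := by
  simp only [expect, mul_add, List.sum_map_add]

theorem expect_mul_left (ρ : Val → Val) (p : Prog) (v : Val) (ψ : QReg) (a : ℝ)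
    (g : Val → QReg → ℝ) :
    p.expect ρ v ψ (fun w φ => a * g w φ) = a * p.expect ρ v ψ g := by
  simp only [expect, ← List.sum_map_mul_left]
  congr 1
  exact List.map_congr_left fun b _ => by ring

theorem expect_sum {ι : Type*} (ρ : Val → Val) (p : Prog) (v : Val) (ψ : QReg) (I : Finset ι)
    (g : ι → Val → QReg → ℝ) :
    p.expect ρ v ψ (fun w φ => ∑ i ∈ I, g i w φ) = ∑ i ∈ I, p.expect ρ v ψ (g i) := by
  induction I using Finset.induction_on with
  | empty => simp [expect]
  | insert i I hi ih => simp only [Finset.sum_insert hi, expect_add, ih]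

/-- The total probability is conserved: the gates are unitary, and a measurement splits the
register into orthogonal parts. -/
theorem expect_normSq (p : Prog) : ∀ (ρ : Val → Val) (v : Val) (ψ : QReg),
    p.expect ρ v ψ (fun _ => QReg.normSq) = QReg.normSq ψ := by
  induction p with
  | id | nil | hd | tl => simp
  | had => simp [expect, br, QReg.normSq_hadamard]
  | tee => simp [expect, br, QReg.normSq_tGate]
  | cnot => simp [expect, br, QReg.normSq_cnot]
  | meas => simp [expect, br, QReg.normSq_proj]
  | flip =>
    intro ρ v ψ
    simp only [expect, br, List.map_cons, List.map_nil, List.sum_cons, List.sum_nil,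
      LinearMap.id_apply]
    ring
  | pair p q hp hq | seq p q hp hq => simp [hp, hq]
  | ite p q r hp hq hr =>
    intro ρ v ψ
    rw [expect_ite, ← hp ρ v ψ]
    congr 1
    ext w φ
    cases w <;> simp [hq, hr]
  | loop p hp =>
    intro ρ v ψ
    rw [expect_loop]
    generalize v.hd.len = m
    generalize v.tl = w
    induction m generalizing w ψ with
    | zero => rfl
    | succ m ih => simp [expectIter, ih, hp]
  | _ p hp => exact fun ρ v ψ => (expect_scoped _ _ _ _ _).trans (hp _ _ _)

/-- The expectation of a function of the output of a classical program. -/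
noncomputable def mean (p : Prog) (v : Val) (φ : Val → ℝ) : ℝ :=
  ((p.br v).map fun b => b.wt * φ b.val).sum

theorem Classical.op_eq {p : Prog} (hp : p.Classical) :
    ∀ v, ∀ b ∈ p.br v, ∀ ρ, b.op ρ = LinearMap.id := by
  induction p with
  | id | nil | hd | tl | flip => simp [br, step]
  | pair p q ihp ihq | seq p q ihp ihq =>
    intro v b hb ρ
    simp only [br, List.mem_flatMap, List.mem_map] at hb
    obtain ⟨b, hb, c, hc, rfl⟩ := hb
    simp [comp, step, ihp hp.1 _ b hb, ihq hp.2 _ c hc]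
  | ite p q r ihp ihq ihr =>
    intro v b hb ρ
    simp only [br, List.mem_flatMap, List.mem_map] at hb
    obtain ⟨b, hb, c, hc, rfl⟩ := hb
    have : c.op ρ = LinearMap.id := by
      split_ifs at hc
      exacts [ihr hp.2.2 _ c hc ρ, ihq hp.2.1 _ c hc ρ]
    simp [comp, step, ihp hp.1 _ b hb, this]
  | loop p ihp =>
    intro v b hb ρ
    rw [br_loop] at hb
    obtain ⟨c, hc, rfl⟩ := List.mem_map.1 hb
    suffices h : ∀ m w, ∀ c ∈ p.brIter m w, c.op ρ = LinearMap.id by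
      simp [comp, step, h _ _ c hc]
    intro m
    induction m with
    | zero => simp [brIter, step]
    | succ m ih =>
      intro w c hc
      simp only [brIter, List.mem_flatMap, List.mem_map] at hc
      obtain ⟨b, hb, c, hc, rfl⟩ := hc
      simp [comp, ihp hp _ b hb, ih _ c hc]
  | had | tee | cnot | meas => exact hp.elim
  | _ p ihp => exact False.elim hp

/-- A classical program leaves the register alone. -/
theorem Classical.expect_eq {p : Prog} (hp : p.Classical) (ρ : Val → Val) (v : Val) (ψ : QReg)
    (g : Val → QReg → ℝ) : p.expect ρ v ψ g = p.mean v fun w => g w ψ := by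
  unfold expect mean
  congr 1
  exact List.map_congr_left fun b hb => by rw [hp.op_eq v b hb ρ, LinearMap.id_apply]

theorem Classical.mean_const {p : Prog} (hp : p.Classical) (v : Val) (a : ℝ) :
    p.mean v (fun _ => a) = a := by
  have h := expect_normSq p (fun q => q) v QReg.zeroState
  rw [hp.expect_eq, QReg.normSq_zeroState] at h
  have h2 : p.mean v (fun _ => a) = p.mean v (fun _ => 1) * a := by
    simp [mean, List.sum_map_mul_right]
  rw [h2, h, one_mul]

/-- For a classical program with a known output, the expectation is evaluation at the output. -/
theorem Classical.expect_of_always {p : Prog} (hp : p.Classical) {v w : Val}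
    (h : p.always v (· = w)) (ρ : Val → Val) (ψ : QReg) (g : Val → QReg → ℝ) :
    p.expect ρ v ψ g = g w ψ := by
  rw [hp.expect_eq, ← hp.mean_const v (g w ψ)]
  unfold mean
  congr 1
  exact List.map_congr_left fun b hb => by rw [h b hb]

/-- Independent runs may be interchanged. -/
theorem mean_comm (p q : Prog) (v w : Val) (φ : Val → Val → ℝ) :
    p.mean v (fun a => q.mean w fun b => φ a b) = q.mean w fun b => p.mean v fun a => φ a b := by
  simp only [mean, ← List.sum_map_mul_left]
  rw [sum_map_comm]
  congr 1
  refine List.map_congr_left fun b _ => ?_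
  congr 1
  exact List.map_congr_left fun a _ => by ring

theorem mean_mul_left (p : Prog) (v : Val) (a : ℝ) (φ : Val → ℝ) :
    p.mean v (fun w => a * φ w) = a * p.mean v φ := by
  simp only [mean, ← List.sum_map_mul_left]
  congr 1
  exact List.map_congr_left fun b _ => by ring

theorem mean_mono {p : Prog} {v : Val} {φ φ' : Val → ℝ} (h : ∀ w, φ w ≤ φ' w) :
    p.mean v φ ≤ p.mean v φ' :=
  List.sum_le_sum fun b hb => mul_le_mul_of_nonneg_left (h _) (wt_nonneg p v b hb)

theorem Classical.prob_eq {p : Prog} (hp : p.Classical) (v : Val) (S : Val → Prop) :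
    p.prob v S = p.mean v fun w => if S w then 1 else 0 := by
  rw [prob, total_eq p _ _ fun w ψ => if S w then QReg.normSq ψ else 0]
  · simp [Conf.start, hp.expect_eq, QReg.normSq_zeroState]
  · intro c
    simp [Conf.weight]

/-! ### Independent samples -/

/-- The expectation of a function of the independent outputs of a classical program on the inputs
`x 0`, …, `x (n - 1)`; the later entries of the sequence of outputs are `nil`. -/
noncomputable def meanPi (p : Prog) (x : ℕ → Val) : ℕ → ((ℕ → Val) → ℝ) → ℝ
  | 0, φ => φ fun _ => Val.nil
  | n + 1, φ => p.mean (x n) fun w => meanPi p x n fun ws => φ (Function.update ws n w)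

theorem meanPi_congr (p : Prog) {x x' : ℕ → Val} {n : ℕ} (h : ∀ i < n, x i = x' i)
    (φ : (ℕ → Val) → ℝ) : p.meanPi x n φ = p.meanPi x' n φ := by
  induction n generalizing φ with
  | zero => rfl
  | succ n ih =>
    simp only [meanPi, h n (by omega)]
    congr 1
    ext w
    exact ih (fun i hi => h i (by omega)) _

theorem Classical.meanPi_const {p : Prog} (hp : p.Classical) (x : ℕ → Val) (n : ℕ) (a : ℝ) :
    p.meanPi x n (fun _ => a) = a := by
  induction n with
  | zero => rfl
  | succ n ih => simp [meanPi, ih, hp.mean_const]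

theorem meanPi_mul_left (p : Prog) (x : ℕ → Val) (n : ℕ) (a : ℝ) (φ : (ℕ → Val) → ℝ) :
    p.meanPi x n (fun ws => a * φ ws) = a * p.meanPi x n φ := by
  induction n generalizing φ with
  | zero => rfl
  | succ n ih => simp only [meanPi, ih, mean_mul_left]

theorem meanPi_mean_comm (p q : Prog) (x : ℕ → Val) (n : ℕ) (v : Val) (φ : (ℕ → Val) → Val → ℝ) :
    p.meanPi x n (fun ws => q.mean v fun w => φ ws w) =
      q.mean v fun w => p.meanPi x n fun ws => φ ws w := by
  induction n generalizing φ with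
  | zero => rfl
  | succ n ih => simp only [meanPi, ih, mean_comm p q]

theorem meanPi_add (p : Prog) (x : ℕ → Val) (n : ℕ) (φ φ' : (ℕ → Val) → ℝ) :
    p.meanPi x n (fun ws => φ ws + φ' ws) = p.meanPi x n φ + p.meanPi x n φ' := by
  induction n generalizing φ φ' with
  | zero => rfl
  | succ n ih => simp only [meanPi, ih, mean, mul_add, List.sum_map_add]

/-- The expectation of a product over independent samples factorizes. -/
theorem meanPi_prod (p : Prog) (x : ℕ → Val) (n : ℕ) (φ : ℕ → Val → ℝ) :
    p.meanPi x n (fun ws => ∏ i ∈ Finset.range n, φ i (ws i)) =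
      ∏ i ∈ Finset.range n, p.mean (x i) (φ i) := by
  induction n with
  | zero => rfl
  | succ n ih =>
    simp only [meanPi, Finset.prod_range_succ, Function.update_self]
    rw [← ih, ← mean_mul_left]
    congr 1
    ext w
    rw [mul_comm, ← meanPi_mul_left]
    congr 1
    ext ws
    rw [mul_comm]
    congr 1
    exact Finset.prod_congr rfl fun i hi => by
      rw [Function.update_of_ne (Finset.mem_range.1 hi).ne]

/-- Replacing the `j`-th sample by a fresh one amounts to changing the `j`-th input. -/
theorem Classical.meanPi_update {p : Prog} (hp : p.Classical) (x : ℕ → Val) {n j : ℕ} (hj : j < n)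
    (v : Val) (φ : (ℕ → Val) → ℝ) :
    p.meanPi x n (fun ws => p.mean v fun w => φ (Function.update ws j w)) =
      p.meanPi (Function.update x j v) n φ := by
  induction n generalizing φ with
  | zero => omega
  | succ n ih =>
    rcases Nat.lt_succ_iff_lt_or_eq.1 hj with h | rfl
    · simp only [meanPi, Function.update_of_ne h.ne']
      congr 1
      ext w
      rw [← ih h]
      congr 1
      ext ws
      congr 1
      ext w'
      rw [Function.update_comm h.ne]
    · simp only [meanPi, Function.update_self, Function.update_idem, hp.mean_const]
      rw [meanPi_mean_comm]
      congr 1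
      ext w
      exact meanPi_congr p (fun i hi => by rw [Function.update_of_ne hi.ne]) _

/-- A function that ignores the `j`-th sample does not depend on the `j`-th input. -/
theorem Classical.meanPi_update_of_ignores {p : Prog} (hp : p.Classical) (x : ℕ → Val) {n j : ℕ}
    (hj : j < n) (v : Val) (φ : (ℕ → Val) → ℝ) (h : ∀ ws w, φ (Function.update ws j w) = φ ws) :
    p.meanPi (Function.update x j v) n φ = p.meanPi x n φ := by
  rw [← hp.meanPi_update x hj]
  simp only [h, hp.mean_const]

end Prog

/-! ### Trees as lists and numerals -/

namespace Val

@[simp] theorem hd_cons (a b : Val) : (cons a b).hd = a := rfl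
@[simp] theorem tl_cons (a b : Val) : (cons a b).tl = b := rfl
@[simp] theorem hd_nil : nil.hd = nil := rfl
@[simp] theorem tl_nil : nil.tl = nil := rfl
@[simp] theorem len_nil : nil.len = 0 := rfl
@[simp] theorem len_cons (a b : Val) : (cons a b).len = b.len + 1 := rfl
@[simp] theorem size_cons (a b : Val) : (cons a b).size = 1 + a.size + b.size := rfl
@[simp] theorem size_nil : nil.size = 1 := rfl
@[simp] theorem toList_cons (a b : Val) : (cons a b).toList = a :: b.toList := rfl
@[simp] theorem toList_nil : nil.toList = [] := rfl
@[simp] theorem ofList_cons (a : Val) (l : List Val) : ofList (a :: l) = cons a (ofList l) := rfl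
@[simp] theorem ofList_nil : ofList [] = nil := rfl

@[simp] theorem toList_ofList (l : List Val) : (ofList l).toList = l := by
  induction l with
  | nil => rfl
  | cons a l ih => simp [ih]

@[simp] theorem ofList_toList (v : Val) : ofList v.toList = v := by
  induction v with
  | nil => rfl
  | cons a b _ ih => simp [ih]

theorem ofList_injective : Function.Injective ofList := fun a b h => by
  rw [← toList_ofList a, h, toList_ofList]

@[simp] theorem len_ofList (l : List Val) : (ofList l).len = l.length := by simp [len]

theorem nth_ofList (l : List Val) (i : ℕ) : (ofList l).nth i = l.getD i nil := by simp [nth]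

theorem one_le_size (v : Val) : 1 ≤ v.size := by cases v <;> (simp; try omega)
theorem size_hd_le (v : Val) : v.hd.size ≤ v.size := by cases v <;> (simp; try omega)
theorem size_tl_le (v : Val) : v.tl.size ≤ v.size := by cases v <;> simp
theorem size_le (v : Val) : v.size ≤ 1 + v.hd.size + v.tl.size := by cases v <;> simp
theorem size_hd_add_tl (v : Val) : v.hd.size + v.tl.size ≤ v.size + 1 := by
  cases v <;> (simp; try omega)
theorem len_lt_size (v : Val) : v.len < v.size := by
  induction v with
  | nil => simp
  | cons a b _ ih => simp; have := one_le_size a; omega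

theorem num_zero : num 0 = nil := rfl
theorem num_succ (m : ℕ) : num (m + 1) = cons nil (num m) := by
  simp [num, List.replicate_succ]
@[simp] theorem len_num (m : ℕ) : (num m).len = m := by simp [num]
theorem size_num (m : ℕ) : (num m).size = 2 * m + 1 := by
  induction m with
  | zero => rfl
  | succ m ih => simp [num_succ, ih]; omega

end Val

/-! ### Running time -/

theorem eval_mono (P : Polynomial ℕ) {a b : ℕ} (h : a ≤ b) : P.eval a ≤ P.eval b := by
  rw [Polynomial.eval_eq_sum_range, Polynomial.eval_eq_sum_range]
  gcongr

namespace Prog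

open Branch

theorem qpt_iff (p : Prog) : p.QPT ↔
    ∃ P : Polynomial ℕ, ∀ v, ∀ b ∈ p.br v, b.time ≤ P.eval v.size := by
  refine exists_congr fun P => forall_congr' fun v => ?_
  simp only [run_eq, List.mem_map, Conf.start]
  constructor
  · intro h b hb
    simpa [app] using h 0 _ ⟨b, hb, rfl⟩
  · rintro h ψ _ ⟨b, hb, rfl⟩
    simpa [app] using h b hb

/-- Outputs are written at unit cost, so time bounds output size. -/
theorem size_le_time (p : Prog) : ∀ v, ∀ b ∈ p.br v, b.val.size ≤ b.time + 1 := by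
  induction p with
  | id | nil | had | tee | cnot => intro v; simp [br, step]; try omega
  | hd =>
    intro v b hb
    simp only [br, step, List.mem_singleton] at hb
    subst hb
    have := v.size_hd_le
    simp; omega
  | tl =>
    intro v b hb
    simp only [br, step, List.mem_singleton] at hb
    subst hb
    have := v.size_tl_le
    simp; omega
  | flip | meas =>
    intro v b hb
    have := v.one_le_size
    simp only [br, List.mem_cons, List.not_mem_nil, or_false] at hb
    rcases hb with rfl | rfl <;> (simp [Val.bit]; try omega)
  | pair p q hp hq =>
    intro v b hb
    simp only [br, List.mem_flatMap, List.mem_map] at hb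
    obtain ⟨b, hb, c, hc, rfl⟩ := hb
    simp [comp, step]; omega
  | seq p q hp hq =>
    intro v b hb
    simp only [br, List.mem_flatMap, List.mem_map] at hb
    obtain ⟨b, hb, c, hc, rfl⟩ := hb
    have := hq _ c hc
    simp [comp, step]; omega
  | ite p q r hp hq hr =>
    intro v b hb
    simp only [br, List.mem_flatMap, List.mem_map] at hb
    obtain ⟨b, hb, c, hc, rfl⟩ := hb
    have : c.val.size ≤ c.time + 1 := by
      split_ifs at hc
      exacts [hr _ c hc, hq _ c hc]
    simp [comp, step]; omega
  | loop p hp =>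
    intro v b hb
    rw [br_loop] at hb
    obtain ⟨c, hc, rfl⟩ := List.mem_map.1 hb
    suffices h : ∀ m w, ∀ c ∈ p.brIter m w, c.val.size ≤ c.time + w.size by
      have h1 := h _ _ c hc
      have := v.size_tl_le
      simp [comp, step]; omega
    intro m
    induction m with
    | zero => simp [brIter, step]
    | succ m ih =>
      intro w c hc
      simp only [brIter, List.mem_flatMap, List.mem_map] at hc
      obtain ⟨b, hb, c, hc, rfl⟩ := hc
      have h1 := hp _ b hb
      have h2 := ih _ c hc
      have := w.one_le_size
      simp [comp]; omega
  | _ p hp =>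
    intro v b hb
    simp only [br, List.mem_map] at hb
    obtain ⟨b, hb, rfl⟩ := hb
    have := hp _ b hb
    simp; omega

/-- The outputs of a polynomial-time program have polynomial size. -/
theorem QPT.size_le {p : Prog} (hp : p.QPT) :
    ∃ P : Polynomial ℕ, ∀ v, p.always v fun w => w.size ≤ P.eval v.size := by
  obtain ⟨P, hP⟩ := (qpt_iff p).1 hp
  refine ⟨P + 1, fun v b hb => ?_⟩
  have := size_le_time p v b hb
  have := hP v b hb
  simp; omega

theorem qpt_of_step {p : Prog} (h : ∀ v, ∀ b ∈ p.br v, b.time ≤ 1 + v.size) : p.QPT :=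
  (qpt_iff p).2 ⟨1 + Polynomial.X, fun v b hb => by simpa using h v b hb⟩

theorem qpt_id : id.QPT := qpt_of_step (by simp [br, step])
theorem qpt_nil : nil.QPT := qpt_of_step (by simp [br, step])
theorem qpt_hd : hd.QPT := qpt_of_step (by simp [br, step])
theorem qpt_tl : tl.QPT := qpt_of_step (by simp [br, step])

theorem qpt_pair {p q : Prog} (hp : p.QPT) (hq : q.QPT) : (pair p q).QPT := by
  obtain ⟨P, hP⟩ := (qpt_iff p).1 hp
  obtain ⟨Q, hQ⟩ := (qpt_iff q).1 hq
  refine (qpt_iff _).2 ⟨1 + Polynomial.X + P + Q + 2 + P + 1 + Q + 1, fun v b hb => ?_⟩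
  simp only [br, List.mem_flatMap, List.mem_map] at hb
  obtain ⟨b, hb, c, hc, rfl⟩ := hb
  have := size_le_time p v b hb
  have := size_le_time q v c hc
  have := hP v b hb
  have := hQ v c hc
  simp [comp, step]
  omega

theorem qpt_seq {p q : Prog} (hp : p.QPT) (hq : q.QPT) : (seq p q).QPT := by
  obtain ⟨P, hP⟩ := (qpt_iff p).1 hp
  obtain ⟨Q, hQ⟩ := (qpt_iff q).1 hq
  refine (qpt_iff _).2 ⟨1 + Polynomial.X + P + Q.comp (P + 1), fun v b hb => ?_⟩
  simp only [br, List.mem_flatMap, List.mem_map] at hb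
  obtain ⟨b, hb, c, hc, rfl⟩ := hb
  have h1 := size_le_time p v b hb
  have h2 := hP v b hb
  have h3 := hQ _ c hc
  have h4 := eval_mono Q (h1.trans (Nat.add_le_add_right h2 1))
  simp [comp, step, Polynomial.eval_comp]
  omega

theorem qpt_ite {p q r : Prog} (hp : p.QPT) (hq : q.QPT) (hr : r.QPT) : (ite p q r).QPT := by
  obtain ⟨P, hP⟩ := (qpt_iff p).1 hp
  obtain ⟨Q, hQ⟩ := (qpt_iff q).1 hq
  obtain ⟨R, hR⟩ := (qpt_iff r).1 hr
  refine (qpt_iff _).2 ⟨1 + Polynomial.X + P + Q + R, fun v b hb => ?_⟩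
  simp only [br, List.mem_flatMap, List.mem_map] at hb
  obtain ⟨b, hb, c, hc, rfl⟩ := hb
  have h2 := hP v b hb
  have h3 : c.time ≤ Q.eval v.size + R.eval v.size := by
    split_ifs at hc
    · exact (hR v c hc).trans (by omega)
    · exact (hQ v c hc).trans (by omega)
  simp [comp, step]
  omega

theorem qpt_scoped {p : Prog} (hp : p.QPT) : (Prog.scoped p).QPT := by
  obtain ⟨P, hP⟩ := (qpt_iff p).1 hp
  refine (qpt_iff _).2 ⟨1 + Polynomial.X + P, fun v b hb => ?_⟩
  simp only [br, List.mem_map] at hb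
  obtain ⟨b, hb, rfl⟩ := hb
  have h2 := hP _ b hb
  have h4 := eval_mono P v.size_tl_le
  simp
  omega

/-! ### Loops over a list with an accumulator -/

/-- The body of `fold`. -/
def foldBody (g : Prog) : Prog :=
  seq (pair hd (pair (seq tl (seq hd tl)) (seq tl tl))) (pair hd (pair (seq tl hd) g))

/-- On input `(x, N, a)`, replace `a` by `g (x, N', a)` for each proper tail `N'` of the list `N`,
in the order of decreasing length; the output is the last `a`. -/
def fold (g : Prog) : Prog :=
  seq (pair (seq tl hd) id) (seq (loop (foldBody g)) (seq tl tl))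

section
variable (g : Prog) (x a N acc : Val)

@[simp] theorem always_fold_nil (Q : Val → Prop) :
    (fold g).always (Val.cons x (Val.cons Val.nil acc)) Q ↔ Q acc := by
  simp [fold, always_loop, alwaysIter]

@[simp] theorem always_fold_cons (Q : Val → Prop) :
    (fold g).always (Val.cons x (Val.cons (Val.cons a N) acc)) Q ↔
      g.always (Val.cons x (Val.cons N acc)) fun acc' =>
        (fold g).always (Val.cons x (Val.cons N acc')) Q := by
  simp [fold, always_loop, alwaysIter, foldBody]

variable (ρ : Val → Val) (ψ : QReg) (φ : Val → QReg → ℝ)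

@[simp] theorem expect_fold_nil :
    (fold g).expect ρ (Val.cons x (Val.cons Val.nil acc)) ψ φ = φ acc ψ := by
  simp [fold, expect_loop, expectIter]

@[simp] theorem expect_fold_cons :
    (fold g).expect ρ (Val.cons x (Val.cons (Val.cons a N) acc)) ψ φ =
      g.expect ρ (Val.cons x (Val.cons N acc)) ψ fun acc' ψ' =>
        (fold g).expect ρ (Val.cons x (Val.cons N acc')) ψ' φ := by
  simp [fold, expect_loop, expectIter, foldBody]

end

/-- On input `(x, i, a)`, the output of the program exceeds `a` by at most a polynomial in the
sizes of `x` and `i`. Iterating such a program in `fold` takes polynomial time. -/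
def Grows (g : Prog) : Prop :=
  ∃ G : Polynomial ℕ, ∀ v, g.always v fun w =>
    w.size ≤ v.tl.tl.size + G.eval (v.hd.size + v.tl.hd.size)

/-- An invariant of the body of a loop bounds the time of each iteration, and so the time of the
whole loop. -/
theorem brIter_induction {p : Prog} {I : ℕ → Val → Prop} {T M : ℕ}
    (hI : ∀ j < M, ∀ x, I j x → ∀ b ∈ p.br x, I (j + 1) b.val ∧ b.time ≤ T) :
    ∀ m j x, j + m ≤ M → I j x → ∀ b ∈ p.brIter m x, I (j + m) b.val ∧ b.time ≤ m * T := by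
  intro m
  induction m with
  | zero =>
    intro j x _ hx b hb
    simp only [brIter, List.mem_singleton] at hb
    subst hb
    exact ⟨hx, by simp [step]⟩
  | succ m ih =>
    intro j x hj hx b hb
    simp only [brIter, List.mem_flatMap, List.mem_map] at hb
    obtain ⟨b, hb, c, hc, rfl⟩ := hb
    obtain ⟨h1, h2⟩ := hI j (by omega) x hx b hb
    obtain ⟨h3, h4⟩ := ih (j + 1) _ (by omega) h1 c hc
    refine ⟨by rw [← add_assoc, add_right_comm]; exact h3, ?_⟩
    rw [add_mul, one_mul]
    simp only [comp]
    omega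

theorem qpt_foldBody {g : Prog} (hg : g.QPT) : (foldBody g).QPT :=
  qpt_seq (qpt_pair qpt_hd (qpt_pair (qpt_seq qpt_tl (qpt_seq qpt_hd qpt_tl))
    (qpt_seq qpt_tl qpt_tl))) (qpt_pair qpt_hd (qpt_pair (qpt_seq qpt_tl qpt_hd) hg))

/-- The state of the loop in `fold` after `j` iterations. -/
theorem foldBody_invariant {g : Prog} {G : Polynomial ℕ}
    (hG : ∀ v, g.always v fun w =>
      w.size ≤ v.tl.tl.size + G.eval (v.hd.size + v.tl.hd.size)) (v : Val) (j : ℕ) (y : Val)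
    (hy : y.hd = v.hd ∧ y.tl.hd.size ≤ v.tl.hd.size ∧
      y.tl.tl.size ≤ v.tl.tl.size + j * G.eval (v.hd.size + v.tl.hd.size)) :
    (foldBody g).always y fun w => w.hd = v.hd ∧ w.tl.hd.size ≤ v.tl.hd.size ∧
      w.tl.tl.size ≤ v.tl.tl.size + (j + 1) * G.eval (v.hd.size + v.tl.hd.size) := by
  obtain ⟨h1, h2, h3⟩ := hy
  simp only [foldBody, always_seq, always_pair, always_hd, always_tl, Val.hd_cons, Val.tl_cons]
  refine always_mono (hG _) fun w hw => ⟨h1, (Val.size_tl_le _).trans h2, ?_⟩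
  simp only [Val.hd_cons, Val.tl_cons, h1] at hw
  have h4 := eval_mono G (Nat.add_le_add_left ((Val.size_tl_le _).trans h2) v.hd.size)
  rw [add_mul, one_mul]
  omega

/-- If every iteration adds only polynomially many nodes to the accumulator, all iterations have
inputs of polynomial size. -/
theorem qpt_fold {g : Prog} (hg : g.QPT) (hgr : Grows g) : (fold g).QPT := by
  refine qpt_seq (qpt_pair (qpt_seq qpt_tl qpt_hd) qpt_id) (qpt_seq ?_ (qpt_seq qpt_tl qpt_tl))
  obtain ⟨G, hG⟩ := hgr
  obtain ⟨B, hB⟩ := (qpt_iff _).1 (qpt_foldBody hg)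
  refine (qpt_iff _).2 ⟨1 + Polynomial.X + Polynomial.X *
    B.comp (2 + 3 * Polynomial.X + Polynomial.X * G.comp (2 * Polynomial.X)), fun u b hb => ?_⟩
  rw [br_loop] at hb
  obtain ⟨c, hc, rfl⟩ := List.mem_map.1 hb
  have hs := u.size_tl_le
  have h1 := (Val.size_hd_le u.tl).trans hs
  have h2 := (Val.size_tl_le u.tl).trans hs
  have h3 := (Val.size_hd_le u.tl.tl).trans h2
  have h4 := (Val.size_tl_le u.tl.tl).trans h2
  have hlen : u.hd.len ≤ u.size := u.hd.len_lt_size.le.trans u.size_hd_le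
  have hG2 : G.eval (u.tl.hd.size + u.tl.tl.hd.size) ≤ G.eval (2 * u.size) :=
    eval_mono G (by omega)
  have key := (brIter_induction (p := foldBody g) (M := u.hd.len)
    (T := B.eval (2 + 3 * u.size + u.size * G.eval (2 * u.size)))
    (I := fun j y => y.hd = u.tl.hd ∧ y.tl.hd.size ≤ u.tl.tl.hd.size ∧
      y.tl.tl.size ≤ u.tl.tl.tl.size + j * G.eval (u.tl.hd.size + u.tl.tl.hd.size))
    (fun j hj y hy b hb => ⟨by exact_mod_cast foldBody_invariant hG u.tl j y hy b hb, ?_⟩)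
    u.hd.len 0 u.tl (by omega) ⟨rfl, le_rfl, by simp⟩ c hc).2
  · have : u.hd.len * B.eval (2 + 3 * u.size + u.size * G.eval (2 * u.size)) ≤
        u.size * B.eval (2 + 3 * u.size + u.size * G.eval (2 * u.size)) :=
      Nat.mul_le_mul_right _ hlen
    simp [comp, step, Polynomial.eval_comp]
    omega
  · refine (hB y b hb).trans (eval_mono B ?_)
    have e1 := y.size_le
    have e2 := y.tl.size_le
    have e3 : j * G.eval (u.tl.hd.size + u.tl.tl.hd.size) ≤ u.size * G.eval (2 * u.size) :=
      Nat.mul_le_mul (by omega) hG2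
    rw [hy.1] at e1
    omega

end Prog

/-! ### Programs that handle lists -/

namespace Val

theorem nth_cons_zero (a b : Val) : (cons a b).nth 0 = a := rfl
@[simp] theorem nth_cons_succ (a b : Val) (i : ℕ) : (cons a b).nth (i + 1) = b.nth i := rfl
@[simp] theorem nth_nil (i : ℕ) : nil.nth i = nil := by simp [nth]
theorem nth_zero (v : Val) : v.nth 0 = v.hd := by cases v <;> rfl
theorem nth_succ (v : Val) (i : ℕ) : v.nth (i + 1) = v.tl.nth i := by cases v <;> simp

theorem toList_eq_map_nth (v : Val) : v.toList = (List.range v.len).map v.nth := by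
  apply List.ext_getElem
  · simp [len]
  · intro i h1 h2
    simp [nth, h1]

theorem size_nth_le (v : Val) (i : ℕ) : (v.nth i).size ≤ v.size := by
  induction v generalizing i with
  | nil => simp
  | cons a b _ ih =>
    cases i with
    | zero => simp [nth_cons_zero]; omega
    | succ i => have := ih i; simp; omega

/-- The list `v` without its first `i` entries. -/
def drop (v : Val) (i : ℕ) : Val := ofList (v.toList.drop i)

theorem drop_zero (v : Val) : v.drop 0 = v := by simp [drop]
theorem drop_succ (v : Val) (i : ℕ) : v.drop (i + 1) = v.tl.drop i := by
  cases v <;> simp [drop]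
@[simp] theorem nil_drop (i : ℕ) : nil.drop i = nil := by simp [drop]
@[simp] theorem toList_drop (v : Val) (i : ℕ) : (v.drop i).toList = v.toList.drop i := by
  simp [drop]
@[simp] theorem len_drop (v : Val) (i : ℕ) : (v.drop i).len = v.len - i := by simp [len]
theorem size_drop_le (v : Val) (i : ℕ) : (v.drop i).size ≤ v.size := by
  induction i generalizing v with
  | zero => rw [drop_zero]
  | succ i ih => rw [drop_succ]; exact (ih _).trans v.size_tl_le
theorem hd_drop (v : Val) (i : ℕ) : (v.drop i).hd = v.nth i := by
  induction i generalizing v with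
  | zero => rw [drop_zero, nth_zero]
  | succ i ih => rw [drop_succ, ih, nth_succ]
theorem drop_num (m i : ℕ) : (num m).drop i = num (m - i) := by simp [drop, num]

theorem eq_nil_iff_len (v : Val) : v = nil ↔ v.len = 0 := by cases v <;> simp

@[simp] theorem num_eq_nil_iff (m : ℕ) : num m = nil ↔ m = 0 := by simp [eq_nil_iff_len]

theorem tuple_eq {m : ℕ} (f : ℕ → Val) :
    tuple (fun i : Fin m => f i) = ofList ((List.range m).map f) := by
  unfold tuple
  congr 1
  apply List.ext_getElem <;> simp

@[simp] theorem len_tuple {m : ℕ} (f : Fin m → Val) : (tuple f).len = m := by simp [tuple]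
@[simp] theorem nth_tuple {m : ℕ} (f : Fin m → Val) (i : Fin m) : (tuple f).nth i = f i := by
  simp [tuple, nth_ofList]
theorem tuple_injective {m : ℕ} : Function.Injective (tuple : (Fin m → Val) → Val) :=
    fun a b h => by
  ext i
  rw [← nth_tuple a i, h, nth_tuple]

@[simp] theorem truth_bit (b : Bool) : (bit b).truth = b := by cases b <;> simp [truth, bit]
@[simp] theorem truth_nil : nil.truth = false := by simp [truth]
@[simp] theorem truth_cons (a b : Val) : (cons a b).truth = true := by simp [truth]

@[simp] theorem ofBits_cons (b : Bool) (x : List Bool) :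
    ofBits (b :: x) = cons (bit b) (ofBits x) := rfl
@[simp] theorem ofBits_nil : ofBits [] = nil := rfl
@[simp] theorem len_ofBits (x : List Bool) : (ofBits x).len = x.length := by simp [ofBits]
@[simp] theorem toList_ofBits (x : List Bool) : (ofBits x).toList = x.map bit := by simp [ofBits]
theorem nth_ofBits (x : List Bool) (i : ℕ) : (ofBits x).nth i = bit (x.getD i false) := by
  simp only [nth, toList_ofBits]
  exact List.getD_map x false bit

end Val

open Val

namespace Prog

/-- The program computes the function `f`, on all inputs, without randomness in the output and in
polynomial time. -/
structure Computes (p : Prog) (f : Val → Val) : Prop where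
  ppt : p.PPT
  eq : ∀ v, p.always v (· = f v)

theorem Computes.always_iff {p : Prog} {f : Val → Val} (h : p.Computes f) (v : Val)
    (Q : Val → Prop) : p.always v Q ↔ Q (f v) := always_iff_of_eq (h.eq v) Q

theorem Computes.expect_eq {p : Prog} {f : Val → Val} (h : p.Computes f) (ρ : Val → Val) (v : Val)
    (ψ : QReg) (g : Val → QReg → ℝ) : p.expect ρ v ψ g = g (f v) ψ :=
  h.ppt.1.expect_of_always (h.eq v) ρ ψ g

theorem Computes.congr {p : Prog} {f g : Val → Val} (h : p.Computes f) (e : ∀ v, f v = g v) :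
    p.Computes g := by
  rwa [show g = f from (funext e).symm]

theorem PPT.pair {p q : Prog} (hp : p.PPT) (hq : q.PPT) : (pair p q).PPT :=
  ⟨⟨hp.1, hq.1⟩, qpt_pair hp.2 hq.2⟩
theorem PPT.seq {p q : Prog} (hp : p.PPT) (hq : q.PPT) : (seq p q).PPT :=
  ⟨⟨hp.1, hq.1⟩, qpt_seq hp.2 hq.2⟩
theorem PPT.ite {p q r : Prog} (hp : p.PPT) (hq : q.PPT) (hr : r.PPT) : (ite p q r).PPT :=
  ⟨⟨hp.1, hq.1, hr.1⟩, qpt_ite hp.2 hq.2 hr.2⟩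
theorem ppt_id : id.PPT := ⟨trivial, qpt_id⟩
theorem ppt_nil : nil.PPT := ⟨trivial, qpt_nil⟩
theorem ppt_hd : hd.PPT := ⟨trivial, qpt_hd⟩
theorem ppt_tl : tl.PPT := ⟨trivial, qpt_tl⟩

theorem classical_fold {g : Prog} (hg : g.Classical) : (fold g).Classical := by
  simp [fold, foldBody, Classical, hg]

theorem PPT.fold {g : Prog} (hg : g.PPT) (h : Grows g) : (fold g).PPT :=
  ⟨classical_fold hg.1, qpt_fold hg.2 h⟩

theorem computes_id : id.Computes fun v => v := ⟨ppt_id, by simp⟩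
theorem computes_nil : nil.Computes fun _ => Val.nil := ⟨ppt_nil, by simp⟩
theorem computes_hd : hd.Computes Val.hd := ⟨ppt_hd, by simp⟩
theorem computes_tl : tl.Computes Val.tl := ⟨ppt_tl, by simp⟩

section
variable {p q r : Prog} {f f' f'' : Val → Val}

theorem Computes.pair (hp : p.Computes f) (hq : q.Computes f') :
    (pair p q).Computes fun v => cons (f v) (f' v) :=
  ⟨hp.ppt.pair hq.ppt, fun v => by simp [hp.always_iff, hq.always_iff]⟩

theorem Computes.seq (hp : p.Computes f) (hq : q.Computes f') :
    (seq p q).Computes fun v => f' (f v) :=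
  ⟨hp.ppt.seq hq.ppt, fun v => by simp [hp.always_iff, hq.always_iff]⟩

theorem Computes.ite (hp : p.Computes f) (hq : q.Computes f') (hr : r.Computes f'') :
    (ite p q r).Computes fun v => select (f v) (f' v) (f'' v) :=
  ⟨hp.ppt.ite hq.ppt hr.ppt, fun v => by
    simp only [always_ite, hp.always_iff, hq.always_iff, hr.always_iff]
    cases f v <;> simp⟩

/-- The function computed by `fold`. -/
def foldFn (f : Val → Val) (x : Val) : Val → Val → Val
  | Val.nil, acc => acc
  | Val.cons _ N, acc => foldFn f x N (f (cons x (cons N acc)))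

/-- `fold` reads its input through the projections. -/
theorem always_fold_eta (g : Prog) (v : Val) (Q : Val → Prop) :
    (fold g).always v Q ↔ (fold g).always (cons v.hd (cons v.tl.hd v.tl.tl)) Q := by
  simp only [fold, always_seq, always_pair, always_id, always_tl, always_hd, always_loop,
    hd_cons, tl_cons]
  cases v.tl.hd.len <;>
    simp only [alwaysIter, foldBody, always_seq, always_pair, always_tl, always_hd, hd_cons,
      tl_cons]

theorem Computes.fold (hp : p.Computes f)
    (h : ∃ G : Polynomial ℕ, ∀ v, (f v).size ≤ v.tl.tl.size + G.eval (v.hd.size + v.tl.hd.size)) :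
    (fold p).Computes fun v => foldFn f v.hd v.tl.hd v.tl.tl := by
  refine ⟨hp.ppt.fold (h.imp fun G hG v => (hp.always_iff v _).2 (hG v)), fun v => ?_⟩
  rw [always_fold_eta]
  generalize v.tl.hd = N
  generalize v.tl.tl = acc
  induction N generalizing acc with
  | nil => simp [foldFn]
  | cons a N _ ih => simpa [foldFn, hp.always_iff] using ih _

end

/-- The number of entries of a list, in unary. -/
def length : Prog := seq (pair nil (pair id nil)) (fold (pair nil (seq tl tl)))

theorem computes_length : length.Computes fun v => num v.len := by
  refine ((computes_nil.pair (computes_id.pair computes_nil)).seq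
    ((computes_nil.pair (computes_tl.seq computes_tl)).fold ⟨2, fun v => ?_⟩)).congr fun v => ?_
  · simp; omega
  · simp only [hd_cons, tl_cons]
    suffices h : ∀ m N, foldFn (fun v => cons Val.nil v.tl.tl) Val.nil N (num m) =
        num (m + N.len) by simpa [num_zero] using h 0 v
    intro m N
    induction N generalizing m with
    | nil => rfl
    | cons a N _ ih => simp [foldFn, ← num_succ, ih, add_assoc, add_comm]

/-- On input `(I, L)`, the list `L` without as many entries as `I` has. -/
def drop : Prog := seq (pair nil id) (fold (seq (seq tl tl) tl))

theorem computes_drop : drop.Computes fun v => v.tl.drop v.hd.len := by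
  refine ((computes_nil.pair computes_id).seq
    (((computes_tl.seq computes_tl).seq computes_tl).fold ⟨0, fun v => ?_⟩)).congr fun v => ?_
  · simpa using Val.size_tl_le _
  · simp only [hd_cons, tl_cons]
    generalize v.tl = L
    generalize v.hd = N
    induction N generalizing L with
    | nil => simp [foldFn, Val.drop_zero]
    | cons a N _ ih => simp [foldFn, ih, Val.drop_succ]

/-- On input `(L, I)`, the entry of `L` whose index is the number of entries of `I`. -/
def nth : Prog := seq (pair tl hd) (seq drop hd)

theorem computes_nth : nth.Computes fun v => v.hd.nth v.tl.len :=
  ((computes_tl.pair computes_hd).seq (computes_drop.seq computes_hd)).congr fun v => by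
    simp [hd_drop]

/-- The program `p` applied to the first two components of a triple. -/
def onPair (p : Prog) : Prog := seq (pair hd (seq tl hd)) p

/-- On input `(x, N)`, the list `(p (x, 1^0), …, p (x, 1^(m - 1)))`, where `m` is the number of
entries of `N`. -/
def tab (p : Prog) : Prog :=
  seq (pair hd (pair (seq tl length) nil)) (fold (pair (onPair p) (seq tl tl)))

theorem grows_cons {p : Prog} (hp : p.QPT) : Grows (pair (onPair p) (seq tl tl)) := by
  obtain ⟨P, hP⟩ := hp.size_le
  refine ⟨1 + P.comp (1 + Polynomial.X), fun v => ?_⟩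
  simp only [onPair, always_pair, always_seq, always_hd, always_tl, size_cons]
  refine always_mono (hP _) fun w hw => ?_
  simp only [size_cons] at hw
  simp only [Polynomial.eval_add, Polynomial.eval_one, Polynomial.eval_comp, Polynomial.eval_X,
    ← add_assoc]
  omega

theorem qpt_tab {p : Prog} (hp : p.QPT) : (tab p).QPT :=
  qpt_seq (qpt_pair qpt_hd (qpt_pair (qpt_seq qpt_tl computes_length.ppt.2) qpt_nil))
    (qpt_fold (qpt_pair (qpt_seq (qpt_pair qpt_hd (qpt_seq qpt_tl qpt_hd)) hp)
      (qpt_seq qpt_tl qpt_tl)) (grows_cons hp))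

theorem PPT.tab {p : Prog} (hp : p.PPT) : (tab p).PPT := by
  refine ⟨?_, qpt_tab hp.2⟩
  have h := computes_length.ppt.1
  have h2 : (Prog.fold (Prog.pair (onPair p) (Prog.seq tl tl))).Classical :=
    classical_fold (by simp [onPair, Classical, hp.1])
  exact ⟨⟨trivial, ⟨trivial, h⟩, trivial⟩, h2⟩

/-- The entries of a table have the properties that the outputs of `p` have. -/
theorem always_tab {p : Prog} {v : Val} {R : ℕ → Val → Prop}
    (h : ∀ i < v.tl.len, p.always (cons v.hd (num i)) (R i)) :
    (tab p).always v fun w => ∃ ws : ℕ → Val, (∀ i < v.tl.len, R i (ws i)) ∧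
      w = ofList ((List.range v.tl.len).map ws) := by
  simp only [tab, always_seq, always_pair, always_hd, always_tl, always_nil,
    computes_length.always_iff]
  generalize v.hd = x at *
  generalize v.tl.len = m at *
  suffices key : ∀ acc, (fold (pair (onPair p) (seq tl tl))).always
      (cons x (cons (num m) acc)) fun w => ∃ ws : ℕ → Val, (∀ i < m, R i (ws i)) ∧
      w = ofList ((List.range m).map ws ++ acc.toList) by
    simpa using key Val.nil
  induction m with
  | zero =>
    intro acc
    simpa [num_zero] using ⟨Val.nil⟩
  | succ m ih =>
    intro acc
    simp only [num_succ, always_fold_cons, onPair, always_pair, always_seq, always_hd, always_tl,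
      hd_cons, tl_cons]
    refine always_mono (h m (by omega)) fun w hw => ?_
    refine always_mono (ih (fun i hi => h i (by omega)) (cons w acc)) ?_
    rintro _ ⟨ws, hws, rfl⟩
    refine ⟨Function.update ws m w, fun i hi => ?_, ?_⟩
    · rcases Nat.lt_succ_iff_lt_or_eq.1 hi with h' | rfl
      · rw [Function.update_of_ne h'.ne]
        exact hws i h'
      · rwa [Function.update_self]
    · congr 1
      rw [List.range_succ, List.map_append, List.append_assoc]
      congr 1
      · exact List.map_congr_left fun i hi => by
          rw [Function.update_of_ne (List.mem_range.1 hi).ne]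
      · simp

/-- `tab` runs its program independently on the indices. -/
theorem Classical.expect_tab {p : Prog} (hp : p.Classical) (ρ : Val → Val) (v : Val) (ψ : QReg)
    (g : Val → QReg → ℝ) : (tab p).expect ρ v ψ g =
      p.meanPi (fun i => cons v.hd (num i)) v.tl.len fun ws =>
        g (ofList ((List.range v.tl.len).map ws)) ψ := by
  simp only [tab, expect_seq, expect_pair, expect_hd, expect_tl, expect_nil,
    computes_length.expect_eq]
  generalize v.hd = x
  generalize v.tl.len = m
  suffices key : ∀ acc, (fold (Prog.pair (onPair p) (Prog.seq tl tl))).expect ρ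
      (cons x (cons (num m) acc)) ψ g = p.meanPi (fun i => cons x (num i)) m fun ws =>
        g (ofList ((List.range m).map ws ++ acc.toList)) ψ by
    simpa using key Val.nil
  induction m with
  | zero =>
    intro acc
    simp [num_zero, meanPi]
  | succ m ih =>
    intro acc
    simp only [num_succ, expect_fold_cons, onPair, expect_pair, expect_seq, expect_hd, expect_tl,
      hd_cons, tl_cons, hp.expect_eq, meanPi]
    congr 1
    ext w
    refine (ih _).trans ?_
    congr 1
    ext ws
    congr 2
    rw [List.range_succ, List.map_append, List.append_assoc]
    congr 1
    · exact List.map_congr_left fun i hi => by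
        rw [Function.update_of_ne (List.mem_range.1 hi).ne]
    · simp

theorem Computes.tab {p : Prog} {f : Val → Val} (hp : p.Computes f) : (tab p).Computes fun v =>
    ofList ((List.range v.tl.len).map fun i => f (cons v.hd (num i))) := by
  refine ⟨hp.ppt.tab, fun v => always_mono (always_tab (R := fun i w => w = f (cons v.hd (num i)))
    fun i _ => hp.eq _) ?_⟩
  rintro _ ⟨ws, hws, rfl⟩
  congr 1
  exact List.map_congr_left fun i hi => hws i (List.mem_range.1 hi)

/-- The list of the values of `p` at the entries of a list. -/
def map (p : Prog) : Prog := seq (pair id id) (tab (seq nth p))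

theorem Computes.map {p : Prog} {f : Val → Val} (hp : p.Computes f) :
    (map p).Computes fun v => ofList (v.toList.map f) :=
  ((computes_id.pair computes_id).seq (computes_nth.seq hp).tab).congr fun v => by
    simp [toList_eq_map_nth v, Function.comp_def]

/-- On input `(A, B)`, the concatenation of the lists `A` and `B`. -/
def append : Prog :=
  seq (pair hd (pair (seq hd length) tl)) (fold (pair (onPair nth) (seq tl tl)))

/-- A `fold` that prepends one entry in each iteration. -/
theorem foldFn_cons (f : Val → Val) (x acc : Val) (m : ℕ) :
    foldFn (fun v => cons (f (cons v.hd v.tl.hd)) v.tl.tl) x (num m) acc =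
      ofList ((List.range m).map (fun i => f (cons x (num i))) ++ acc.toList) := by
  induction m generalizing acc with
  | zero => simp [num_zero, foldFn]
  | succ m ih => simp [num_succ, foldFn, ih, List.range_succ]

theorem computes_append : append.Computes fun v => ofList (v.hd.toList ++ v.tl.toList) := by
  refine ((computes_hd.pair ((computes_hd.seq computes_length).pair computes_tl)).seq
    ((((computes_hd.pair (computes_tl.seq computes_hd)).seq computes_nth).pair
      (computes_tl.seq computes_tl)).fold ⟨1 + Polynomial.X, fun v => ?_⟩)).congr fun v => ?_
  · have := v.hd.size_nth_le v.tl.hd.len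
    simp; omega
  · simp only [hd_cons, tl_cons]
    have := foldFn_cons (fun v => v.hd.nth v.tl.len) v.hd v.tl v.hd.len
    simpa [toList_eq_map_nth v.hd] using this

theorem size_ofList_append (A B : Val) :
    (ofList (A.toList ++ B.toList)).size + 1 = A.size + B.size := by
  induction A with
  | nil => simp; omega
  | cons a A _ ih => simp; omega

/-- The concatenation of the entries of a list of lists. -/
def flatten : Prog :=
  seq (pair id (pair length nil)) (fold (seq (pair (onPair nth) (seq tl tl)) append))

theorem computes_flatten : flatten.Computes fun v => ofList (v.toList.map toList).flatten := by
  refine ((computes_id.pair (computes_length.pair computes_nil)).seq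
    (((((computes_hd.pair (computes_tl.seq computes_hd)).seq computes_nth).pair
      (computes_tl.seq computes_tl)).seq computes_append).fold
        ⟨Polynomial.X, fun v => ?_⟩)).congr fun v => ?_
  · have := v.hd.size_nth_le v.tl.hd.len
    have := size_ofList_append (v.hd.nth v.tl.hd.len) v.tl.tl
    simp; omega
  · simp only [hd_cons, tl_cons]
    suffices h : ∀ m acc, foldFn (fun w => ofList ((w.hd.nth w.tl.hd.len).toList ++ w.tl.tl.toList))
        v (num m) acc = ofList (((List.range m).map fun i => (v.nth i).toList).flatten ++
          acc.toList) by
      simp [h, toList_eq_map_nth v, Function.comp_def]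
    intro m
    induction m with
    | zero => simp [num_zero, foldFn]
    | succ m ih => simp [num_succ, foldFn, ih, List.range_succ]

/-- On input `(N, X)`, the length of `X` divided by the length of `N`, in unary. -/
def divide : Prog :=
  seq (seq (pair hd (pair tl (pair tl nil)))
    (fold (seq (pair hd (seq tl tl))
      (ite (seq tl hd) (pair (seq (pair hd (seq tl hd)) drop) (pair nil (seq tl tl))) tl)))) tl

/-- Division is only specified when it is exact and the divisor is not zero. -/
theorem computes_divide : ∃ f, divide.Computes f ∧
    ∀ N X : Val, ∀ m, N ≠ Val.nil → X.len = N.len * m → f (cons N X) = num m := by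
  refine ⟨_, ((computes_hd.pair (computes_tl.pair (computes_tl.pair computes_nil))).seq
    (Computes.fold ((computes_hd.pair (computes_tl.seq computes_tl)).seq
      ((computes_tl.seq computes_hd).ite
        (((computes_hd.pair (computes_tl.seq computes_hd)).seq computes_drop).pair
          (computes_nil.pair (computes_tl.seq computes_tl))) computes_tl))
        ⟨4, fun v => ?_⟩)).seq computes_tl, fun N X m hN hX => ?_⟩
  · simp only [hd_cons, tl_cons]
    have h1 := v.tl.tl.hd.size_drop_le v.hd.len
    have h2 := v.tl.tl.size_hd_add_tl
    cases h : v.tl.tl.hd <;> (simp [h] at h1 h2 ⊢; try omega)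
  · have hN' : 0 < N.len := Nat.pos_of_ne_zero fun h => hN (N.eq_nil_iff_len.2 h)
    simp only [hd_cons, tl_cons]
    suffices h : ∀ m (K X : Val) (j : ℕ), X.len = N.len * m → m ≤ K.len →
        (foldFn (fun v => select v.tl.tl.hd
          (cons (v.tl.tl.hd.drop v.hd.len) (cons Val.nil v.tl.tl.tl)) v.tl.tl)
            N K (cons X (num j))).tl =
          num (j + m) by
      have := h m X X 0 hX (by rw [hX]; exact Nat.le_mul_of_pos_left m hN')
      rwa [zero_add] at this
    intro m
    induction m with
    | zero =>
      intro K X j hX _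
      have : X = Val.nil := X.eq_nil_iff_len.2 (by simpa using hX)
      subst this
      induction K with
      | nil => simp [foldFn]
      | cons a K _ ih => simpa [foldFn] using ih (by omega)
    | succ m ih =>
      intro K X j hX hK
      have hX0 : X ≠ Val.nil := fun h => by
        have := X.eq_nil_iff_len.1 h
        rw [this] at hX
        exact absurd hX (Nat.mul_pos hN' (Nat.succ_pos m)).ne
      cases K with
      | nil => simp at hK
      | cons a K =>
        have := ih K (X.drop N.len) (j + 1)
          (by rw [len_drop, hX, Nat.mul_succ, Nat.add_sub_cancel]) (by simpa using hK)
        simp only [foldFn, hd_cons, tl_cons, select_of_ne _ _ hX0, ← num_succ]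
        rw [this, add_assoc, add_comm 1 m]

/-- On input `(M, (I, X))`, the block with the index `I` of the list `X`, which consists of blocks
of the length of `M`. -/
def block : Prog :=
  seq (pair (fold (seq (pair hd (seq tl tl)) drop)) hd) (tab nth)

theorem computes_block : block.Computes fun v => ofList ((List.range v.hd.len).map fun j =>
    v.tl.tl.nth (v.tl.hd.len * v.hd.len + j)) := by
  refine (((((computes_hd.pair (computes_tl.seq computes_tl)).seq computes_drop).fold
    ⟨0, fun v => ?_⟩).pair computes_hd).seq computes_nth.tab).congr fun v => ?_
  · simpa using Val.size_drop_le _ _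
  · simp only [hd_cons, tl_cons, len_num]
    congr 1
    refine List.map_congr_left fun j _ => ?_
    generalize v.tl.tl = X
    generalize v.tl.hd = I
    induction I generalizing X with
    | nil => simp [foldFn]
    | cons a I _ ih =>
      simp only [foldFn, hd_cons, tl_cons, ih, len_cons]
      rw [← hd_drop, ← hd_drop]
      congr 1
      apply ofList_injective.eq_iff.2
      simp only [toList_drop, List.drop_drop]
      congr 1
      ring

end Prog

/-! ### Strings that consist of blocks -/

/-- The `i`-th of the blocks of length `m` of a string. -/
def blockOf (m : ℕ) (y : List Bool) (i : ℕ) : List Bool := (y.drop (i * m)).take m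

theorem blockOf_succ (m : ℕ) (y : List Bool) (i : ℕ) :
    blockOf m y (i + 1) = blockOf m (y.drop m) i := by
  simp [blockOf, add_mul, add_comm]

theorem length_blockOf {m N : ℕ} {y : List Bool} (hy : y.length = N * m) {i : ℕ} (hi : i < N) :
    (blockOf m y i).length = m := by
  simp only [blockOf, List.length_take, List.length_drop, hy, ← Nat.sub_mul]
  exact min_eq_left (Nat.le_mul_of_pos_left m (by omega))

/-- The string with the blocks `z 0`, …, `z (N - 1)`. -/
def join (z : ℕ → List Bool) (N : ℕ) : List Bool := ((List.range N).map z).flatten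

theorem join_succ (z : ℕ → List Bool) (N : ℕ) :
    join z (N + 1) = z 0 ++ join (fun i => z (i + 1)) N := by
  simp [join, List.range_succ_eq_map, Function.comp_def]

theorem length_join {m : ℕ} {z : ℕ → List Bool} {N : ℕ} (hz : ∀ i < N, (z i).length = m) :
    (join z N).length = N * m := by
  induction N generalizing z with
  | zero => simp [join]
  | succ N ih =>
    rw [join_succ, List.length_append, hz 0 (by omega), ih fun i hi => hz (i + 1) (by omega)]
    ring

theorem join_blockOf {m N : ℕ} {y : List Bool} (hy : y.length = N * m) :
    join (blockOf m y) N = y := by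
  induction N generalizing y with
  | zero =>
    rw [zero_mul] at hy
    simp [join, List.eq_nil_of_length_eq_zero hy]
  | succ N ih =>
    have h := ih (y := y.drop m) (by rw [List.length_drop, hy, add_mul]; simp)
    rw [join_succ]
    simp only [blockOf_succ]
    rw [h]
    simp [blockOf]

theorem blockOf_join {m : ℕ} {z : ℕ → List Bool} {N : ℕ} (hz : ∀ i < N, (z i).length = m)
    {i : ℕ} (hi : i < N) : blockOf m (join z N) i = z i := by
  induction N generalizing z i with
  | zero => omega
  | succ N ih =>
    have h0 := hz 0 (by omega)
    rw [join_succ]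
    cases i with
    | zero => simp [blockOf, ← h0]
    | succ i =>
      rw [blockOf_succ, ← h0, List.drop_left, h0]
      exact ih (fun i hi => hz (i + 1) (by omega)) (by omega)

theorem join_congr {z z' : ℕ → List Bool} {N : ℕ} (h : ∀ i < N, z i = z' i) :
    join z N = join z' N := by
  unfold join
  congr 1
  exact List.map_congr_left fun i hi => h i (List.mem_range.1 hi)

/-- The strings whose `i`-th block of length `m` is in `G i`, for `i < N`. -/
def blockSet (m : ℕ) (G : ℕ → Set (List Bool)) (N : ℕ) : Set (List Bool) :=
  {y | y.length = N * m ∧ ∀ i < N, blockOf m y i ∈ G i}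

/-- The concatenations of a string in `A` and a string in `B`. -/
def catSet (A B : Set (List Bool)) : Set (List Bool) :=
  (fun p : List Bool × List Bool => p.1 ++ p.2) '' (A ×ˢ B)

theorem ncard_catSet {A B : Set (List Bool)} {m : ℕ} (hA : ∀ a ∈ A, a.length = m) :
    (catSet A B).ncard = A.ncard * B.ncard := by
  rw [catSet, Set.InjOn.ncard_image, Set.ncard_prod]
  rintro ⟨a, b⟩ ⟨ha, _⟩ ⟨a', b'⟩ ⟨ha', _⟩ h
  have := List.append_inj h ((hA _ ha).trans (hA _ ha').symm)
  exact Prod.ext this.1 this.2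

theorem blockSet_zero (m : ℕ) (G : ℕ → Set (List Bool)) : blockSet m G 0 = {[]} := by
  ext y
  simp [blockSet]

theorem blockSet_succ {m : ℕ} {G : ℕ → Set (List Bool)} (hG : ∀ a ∈ G 0, a.length = m) (N : ℕ) :
    blockSet m G (N + 1) = catSet (G 0) (blockSet m (fun i => G (i + 1)) N) := by
  ext y
  constructor
  · rintro ⟨h1, h2⟩
    refine ⟨(y.take m, y.drop m), ⟨?_, ?_, ?_⟩, List.take_append_drop _ _⟩
    · simpa [blockOf] using h2 0 (by omega)
    · rw [List.length_drop, h1, add_mul]; simp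
    · intro i hi
      simpa [blockOf_succ] using h2 (i + 1) (by omega)
  · rintro ⟨⟨a, b⟩, ⟨ha, hb1, hb2⟩, rfl⟩
    have hm := hG a ha
    refine ⟨?_, fun i hi => ?_⟩
    · simp only [List.length_append, hm, hb1]; ring
    · cases i with
      | zero => simpa [blockOf, ← hm] using ha
      | succ i =>
        rw [blockOf_succ, ← hm, List.drop_left, hm]
        exact hb2 i (by omega)

theorem ncard_blockSet {m : ℕ} {G : ℕ → Set (List Bool)} {N : ℕ}
    (hG : ∀ i < N, ∀ a ∈ G i, a.length = m) :
    (blockSet m G N).ncard = ∏ i ∈ Finset.range N, (G i).ncard := by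
  induction N generalizing G with
  | zero => simp [blockSet_zero]
  | succ N ih =>
    rw [blockSet_succ (hG 0 (by omega)), ncard_catSet (hG 0 (by omega)), Finset.prod_range_succ',
      ih fun i hi => hG (i + 1) (by omega), mul_comm]

theorem finite_of_length {A : Set (List Bool)} {m : ℕ} (hA : ∀ a ∈ A, a.length = m) : A.Finite :=
  (List.finite_length_eq Bool m).subset hA

/-! ### Twins of the concatenated family -/

namespace Family

section
variable {n : ℕ → ℕ} (F : Family n)

theorem X_finite (κ : ℕ) : (F.X κ).Finite := finite_of_length (F.X_length κ)

variable {F}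

theorem Twin.symm {κ : ℕ} {k y : Val} {x x' : List Bool} (h : F.Twin κ k y x x') :
    F.Twin κ k y x' x := ⟨h.1.symm, h.2.trans (Set.pair_comm _ _)⟩

theorem Twin.left {κ : ℕ} {k y : Val} {x x' : List Bool} (h : F.Twin κ k y x x') :
    x ∈ F.X κ ∧ F.f κ k x = y := by
  have : x ∈ ({x, x'} : Set (List Bool)) := by simp
  rwa [← h.2] at this

theorem Twin.right {κ : ℕ} {k y : Val} {x x' : List Bool} (h : F.Twin κ k y x x') :
    x' ∈ F.X κ ∧ F.f κ k x' = y := h.symm.left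

theorem Twin.mem {κ : ℕ} {k y : Val} {x x' z : List Bool} (h : F.Twin κ k y x x')
    (hz : z ∈ F.X κ) (hf : F.f κ k z = y) : z = x ∨ z = x' := by
  have : z ∈ {z | z ∈ F.X κ ∧ F.f κ k z = y} := ⟨hz, hf⟩
  rw [h.2] at this
  exact this

/-- The twins with given first bits are unique. -/
theorem Twin.unique {κ : ℕ} {k y : Val} {z z' w w' : List Bool}
    (h : F.Twin κ k y (false :: z) (true :: z')) (h' : F.Twin κ k y (false :: w) (true :: w')) :
    z = w ∧ z' = w' := by
  have h1 := h'.mem h.left.1 h.left.2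
  have h2 := h'.mem h.right.1 h.right.2
  constructor <;> simp_all

/-- Two different preimages are all preimages. -/
theorem LabelledTwins.twin_of_ne (hT : F.LabelledTwins) {κ : ℕ} {k : Val} (hk : k ∈ F.K κ)
    {x x' : List Bool} (hx : x ∈ F.X κ) (hx' : x' ∈ F.X κ) (h : F.f κ k x = F.f κ k x')
    (hne : x ≠ x') : F.Twin κ k (F.f κ k x) x x' := by
  refine ⟨hne, (Set.eq_of_subset_of_ncard_le ?_ ?_ ?_).symm⟩
  · rintro z (rfl | rfl)
    exacts [⟨hx, rfl⟩, ⟨hx', h.symm⟩]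
  · rw [Set.ncard_pair hne]
    exact hT.le_two κ k hk _
  · exact (F.X_finite κ).subset fun z hz => hz.1

/-- Twins can be sorted by their first bits. -/
theorem LabelledTwins.exists_sorted (hT : F.LabelledTwins) {κ : ℕ} {k y : Val} (hk : k ∈ F.K κ)
    {x x' : List Bool} (h : F.Twin κ k y x x') :
    ∃ z z', F.Twin κ k y (false :: z) (true :: z') ∧
      ((x = false :: z ∧ x' = true :: z') ∨ (x = true :: z' ∧ x' = false :: z)) := by
  obtain ⟨z, z', ⟨rfl, rfl⟩ | ⟨rfl, rfl⟩⟩ := hT.twin κ k hk y x x' h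
  · exact ⟨z, z', h, Or.inl ⟨rfl, rfl⟩⟩
  · exact ⟨z', z, h.symm, Or.inr ⟨rfl, rfl⟩⟩

/-- The second part says that `F.l κ - 1` is not a truncated subtraction. -/
theorem length_of_cons_mem {κ : ℕ} {c : Bool} {z : List Bool} (h : c :: z ∈ F.X κ) :
    z.length = F.l κ - 1 ∧ F.l κ = F.l κ - 1 + 1 := by
  have := F.X_length κ _ h
  simp at this
  omega

end

variable {n : ℕ → ℕ} {F : Family fun _ => 1}

theorem part_cons (κ : ℕ) (c : Bool) (y : List Bool) (i : ℕ) :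
    F.part κ (c :: y) i = c :: blockOf (F.l κ - 1) y i := rfl

theorem concat_f (κ : ℕ) (ks : Fin (n κ) → Val) (x : List Bool) :
    (F.concat n).f κ (Val.tuple ks) x = Val.tuple fun i => F.f κ (ks i) (F.part κ x i) := by
  simp [concat]

theorem exists_cons_of_mem_concat {κ : ℕ} {x : List Bool} (h : x ∈ (F.concat n).X κ) :
    ∃ c y, x = c :: y ∧ y.length = n κ * (F.l κ - 1) ∧
      ∀ i < n κ, c :: blockOf (F.l κ - 1) y i ∈ F.X κ := by
  obtain ⟨h1, h2⟩ := h
  cases x with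
  | nil =>
    simp at h1
    omega
  | cons c y =>
    refine ⟨c, y, rfl, ?_, fun i hi => h2 ⟨i, hi⟩⟩
    simp at h1
    omega

theorem cons_mem_concat_iff {κ : ℕ} {c : Bool} {y : List Bool} :
    c :: y ∈ (F.concat n).X κ ↔ y ∈ blockSet (F.l κ - 1) (fun _ => {z | c :: z ∈ F.X κ}) (n κ) := by
  constructor
  · intro h
    obtain ⟨c', y', e, h1, h2⟩ := exists_cons_of_mem_concat h
    cases e
    exact ⟨h1, h2⟩
  · rintro ⟨h1, h2⟩
    refine ⟨?_, fun i => h2 i i.2⟩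
    simp [h1, add_comm]

theorem join_mem_concat {κ : ℕ} {c : Bool} {z : ℕ → List Bool}
    (hz : ∀ i < n κ, c :: z i ∈ F.X κ) : c :: join z (n κ) ∈ (F.concat n).X κ := by
  have hl : ∀ i < n κ, (z i).length = F.l κ - 1 := fun i hi => (length_of_cons_mem (hz i hi)).1
  refine cons_mem_concat_iff.2 ⟨length_join hl, fun i hi => ?_⟩
  rw [blockOf_join hl hi]
  exact hz i hi

/-- Twins of all components combine to twins. -/
theorem twin_concat_of_twins {κ : ℕ} {ks ys : Fin (n κ) → Val} {z z' : ℕ → List Bool}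
    (h : ∀ i : Fin (n κ), F.Twin κ (ks i) (ys i) (false :: z i) (true :: z' i)) :
    (F.concat n).Twin κ (Val.tuple ks) (Val.tuple ys) (false :: join z (n κ))
      (true :: join z' (n κ)) := by
  have hz : ∀ i < n κ, false :: z i ∈ F.X κ := fun i hi => (h ⟨i, hi⟩).left.1
  have hz' : ∀ i < n κ, true :: z' i ∈ F.X κ := fun i hi => (h ⟨i, hi⟩).right.1
  refine ⟨by simp, Set.eq_of_subset_of_subset ?_ ?_⟩
  · rintro x ⟨hx, hf⟩
    obtain ⟨c, y, rfl, h1, h2⟩ := exists_cons_of_mem_concat hx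
    rw [concat_f] at hf
    have hf' := fun i => congrFun (Val.tuple_injective hf) i
    rw [← join_blockOf h1]
    have hm : ∀ i (hi : i < n κ), c :: blockOf (F.l κ - 1) y i = false :: z i ∨
        c :: blockOf (F.l κ - 1) y i = true :: z' i := fun i hi =>
      (h ⟨i, hi⟩).mem (h2 i hi) (hf' ⟨i, hi⟩)
    cases c
    · left
      congr 1
      exact join_congr fun i hi => by simpa using hm i hi
    · right
      rw [Set.mem_singleton_iff]
      congr 1
      exact join_congr fun i hi => by simpa using hm i hi
  · rintro x (rfl | rfl)
    · refine ⟨join_mem_concat hz, ?_⟩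
      rw [concat_f]
      congr 1
      ext i
      rw [part_cons, blockOf_join (fun i hi => (length_of_cons_mem (hz i hi)).1) i.2,
        (h i).left.2]
    · refine ⟨join_mem_concat hz', ?_⟩
      rw [concat_f]
      congr 1
      ext i
      rw [part_cons, blockOf_join (fun i hi => (length_of_cons_mem (hz' i hi)).1) i.2,
        (h i).right.2]

/-- Twins restrict to twins of all components: since a component has at most two preimages and its
twins differ in the first bit, two preimages with the same first bit would agree. -/
theorem LabelledTwins.twins_of_twin_concat (hT : F.LabelledTwins) {κ : ℕ} {ks : Fin (n κ) → Val}
    (hks : ∀ i, ks i ∈ F.K κ) {y : Val} {x x' : List Bool}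
    (h : (F.concat n).Twin κ (Val.tuple ks) y x x') :
    ∃ (ys : Fin (n κ) → Val) (z z' : ℕ → List Bool), y = Val.tuple ys ∧
      (∀ i : Fin (n κ), F.Twin κ (ks i) (ys i) (false :: z i) (true :: z' i)) ∧
      ((x = false :: join z (n κ) ∧ x' = true :: join z' (n κ)) ∨
        (x = true :: join z' (n κ) ∧ x' = false :: join z (n κ))) := by
  have key : ∀ c c' w w', (F.concat n).Twin κ (Val.tuple ks) y (c :: w) (c' :: w') →
      ∀ i : Fin (n κ), c :: blockOf (F.l κ - 1) w i ≠ c' :: blockOf (F.l κ - 1) w' i →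
      F.Twin κ (ks i) (F.f κ (ks i) (F.part κ (c :: w) i)) (c :: blockOf (F.l κ - 1) w i)
        (c' :: blockOf (F.l κ - 1) w' i) := by
    intro c c' w w' h i hne
    have h1 := h.left.2.trans h.right.2.symm
    rw [concat_f, concat_f] at h1
    exact hT.twin_of_ne (hks i) (h.left.1.2 i) (h.right.1.2 i)
      (congrFun (Val.tuple_injective h1) i) hne
  obtain ⟨c, w, rfl, hw, hw2⟩ := exists_cons_of_mem_concat h.left.1
  obtain ⟨c', w', rfl, hw', hw2'⟩ := exists_cons_of_mem_concat h.right.1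
  have hc : c ≠ c' := by
    rintro rfl
    apply h.1
    rw [← join_blockOf hw, ← join_blockOf hw']
    congr 1
    refine join_congr fun i hi => ?_
    by_contra hne
    obtain ⟨z, z', ⟨h1, h2⟩ | ⟨h1, h2⟩⟩ := hT.twin κ _ (hks ⟨i, hi⟩) _ _ _
      (key c c w w' h ⟨i, hi⟩ (by simpa using hne)) <;> simp_all
  have hy := h.left.2
  rw [concat_f] at hy
  have hy' := h.right.2
  rw [concat_f] at hy'
  cases c
  · obtain rfl : c' = true := by simpa using hc.symm
    exact ⟨_, blockOf (F.l κ - 1) w, blockOf (F.l κ - 1) w', hy.symm,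
      fun i => key _ _ _ _ h i (by simp),
      Or.inl ⟨by rw [join_blockOf hw], by rw [join_blockOf hw']⟩⟩
  · obtain rfl : c' = false := by simpa using hc.symm
    exact ⟨_, blockOf (F.l κ - 1) w', blockOf (F.l κ - 1) w, hy'.symm,
      fun i => key _ _ _ _ h.symm i (by simp),
      Or.inr ⟨by rw [join_blockOf hw], by rw [join_blockOf hw']⟩⟩

/-- An image under `f'_k` has two preimages iff all its components have two. -/
theorem LabelledTwins.exists_twin_concat_iff (hT : F.LabelledTwins) {κ : ℕ}
    {ks : Fin (n κ) → Val} (hks : ∀ i, ks i ∈ F.K κ) (ys : Fin (n κ) → Val) :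
    (∃ x x', (F.concat n).Twin κ (Val.tuple ks) (Val.tuple ys) x x') ↔
      ∀ i, ∃ z z', F.Twin κ (ks i) (ys i) (false :: z) (true :: z') := by
  constructor
  · rintro ⟨x, x', h⟩ i
    obtain ⟨ys', z, z', e, h', _⟩ := hT.twins_of_twin_concat hks h
    rw [Val.tuple_injective e]
    exact ⟨_, _, h' i⟩
  · intro h
    choose z z' h using h
    refine ⟨_, _, twin_concat_of_twins
      (z := fun i => if hi : i < n κ then z ⟨i, hi⟩ else [])
      (z' := fun i => if hi : i < n κ then z' ⟨i, hi⟩ else []) fun i => ?_⟩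
    simpa using h i

theorem partInfoLoc_of_twin {κ : ℕ} {k y : Val} {z z' : List Bool}
    (h : F.Twin κ k y (false :: z) (true :: z')) : F.partInfoLoc κ k y =
      if F.d₀ κ k 0 = false then Info.cross else Info.bit (F.h κ (false :: z) 0) := by
  have H : ∃ z : List Bool, ∃ z', F.Twin κ k y (false :: z) (true :: z') := ⟨z, z', h⟩
  rw [partInfoLoc, dif_pos H]
  obtain ⟨w', hw⟩ := H.choose_spec
  rw [← (h.unique hw).1]

theorem partInfoLoc_of_not {κ : ℕ} {k y : Val}
    (h : ¬ ∃ z z', F.Twin κ k y (false :: z) (true :: z')) : F.partInfoLoc κ k y = Info.bot :=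
  dif_neg h

theorem partAlphaLoc_of_twin {κ i : ℕ} {k y : Val} {z z' : List Bool}
    (h : F.Twin κ k y (false :: z) (true :: z')) (b : List Bool) :
    F.partAlphaLoc κ i k y b = Info.bit (if i = 0 then
      xor (b.headD false) (innerBits (F.block κ b i) (xorBits z z'))
      else innerBits (F.block κ b i) (xorBits z z')) := by
  have H : ∃ p : List Bool × List Bool, F.Twin κ k y (false :: p.1) (true :: p.2) := ⟨(z, z'), h⟩
  rw [partAlphaLoc, dif_pos H]
  have hw := h.unique H.choose_spec
  simp only [← hw.1, ← hw.2]

theorem partAlphaLoc_of_not {κ i : ℕ} {k y : Val}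
    (h : ¬ ∃ z z', F.Twin κ k y (false :: z) (true :: z')) (b : List Bool) :
    F.partAlphaLoc κ i k y b = Info.bot :=
  dif_neg fun ⟨p, hp⟩ => h ⟨p.1, p.2, hp⟩

/-! ### The proportion of images with two preimages -/

theorem ncard_eq_add (A : Set (List Bool)) (hA : A.Finite) (hne : ∀ x ∈ A, x ≠ []) :
    A.ncard = {z | false :: z ∈ A}.ncard + {z | true :: z ∈ A}.ncard := by
  have e : A =
      (List.cons false '' {z | false :: z ∈ A}) ∪ (List.cons true '' {z | true :: z ∈ A}) := by
    ext x
    constructor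
    · intro hx
      cases x with
      | nil => exact absurd rfl (hne _ hx)
      | cons c z =>
        cases c
        · exact Or.inl ⟨z, hx, rfl⟩
        · exact Or.inr ⟨z, hx, rfl⟩
    · rintro (⟨z, hz, rfl⟩ | ⟨z, hz, rfl⟩) <;> exact hz
  have hf : ∀ c : Bool, {z | c :: z ∈ A}.Finite := fun c =>
    hA.preimage (List.cons_injective.injOn)
  conv_lhs => rw [e]
  rw [Set.ncard_union_eq _ ((hf _).image _) ((hf _).image _),
    Set.ncard_image_of_injective _ List.cons_injective,
    Set.ncard_image_of_injective _ List.cons_injective]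
  rw [Set.disjoint_left]
  rintro _ ⟨z, _, rfl⟩ ⟨w, _, h⟩
  simp at h

/-- The `z` such that the image of `(c, z)` has two preimages. -/
def twinSet (F : Family fun _ => 1) (κ : ℕ) (k : Val) (c : Bool) : Set (List Bool) :=
  {z | c :: z ∈ F.X κ ∧ ∃ x x', F.Twin κ k (F.f κ k (c :: z)) x x'}

theorem LabelledTwins.mem_twinSet_false (hT : F.LabelledTwins) {κ : ℕ} {k : Val} (hk : k ∈ F.K κ)
    {z : List Bool} : z ∈ F.twinSet κ k false ↔
      ∃ y z', F.Twin κ k y (false :: z) (true :: z') := by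
  constructor
  · rintro ⟨hz, x, x', h⟩
    obtain ⟨w, w', h', _⟩ := hT.exists_sorted hk h
    rcases h'.mem hz rfl with e | e
    · cases e
      exact ⟨_, _, h'⟩
    · cases e
  · rintro ⟨y, z', h⟩
    exact ⟨h.left.1, _, _, by rw [h.left.2]; exact h⟩

theorem LabelledTwins.mem_twinSet_true (hT : F.LabelledTwins) {κ : ℕ} {k : Val} (hk : k ∈ F.K κ)
    {z' : List Bool} : z' ∈ F.twinSet κ k true ↔
      ∃ y z, F.Twin κ k y (false :: z) (true :: z') := by
  constructor
  · rintro ⟨hz, x, x', h⟩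
    obtain ⟨w, w', h', _⟩ := hT.exists_sorted hk h
    rcases h'.mem hz rfl with e | e
    · cases e
    · cases e
      exact ⟨_, _, h'⟩
  · rintro ⟨y, z', h⟩
    exact ⟨h.right.1, _, _, by rw [h.right.2]; exact h⟩

/-- Passing to the twin is a bijection. -/
theorem LabelledTwins.ncard_twinSet (hT : F.LabelledTwins) {κ : ℕ} {k : Val} (hk : k ∈ F.K κ) :
    (F.twinSet κ k false).ncard = (F.twinSet κ k true).ncard := by
  have H : ∀ z ∈ F.twinSet κ k false, ∃ z' y, F.Twin κ k y (false :: z) (true :: z') :=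
    fun z hz => by
      obtain ⟨y, z', h⟩ := (hT.mem_twinSet_false hk).1 hz
      exact ⟨z', y, h⟩
  choose p y hp using H
  refine Set.ncard_congr p (fun z hz => (hT.mem_twinSet_true hk).2 ⟨_, _, hp z hz⟩)
    (fun z w hz hw e => ?_) fun z' hz' => ?_
  · have h1 := hp z hz
    have h2 := hp w hw
    rw [← e] at h2
    have ey : y z hz = y w hw := h1.right.2.symm.trans h2.right.2
    rw [ey] at h1
    exact (h1.unique h2).1
  · obtain ⟨y', z, h⟩ := (hT.mem_twinSet_true hk).1 hz'
    have hz := (hT.mem_twinSet_false hk).2 ⟨_, _, h⟩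
    refine ⟨z, hz, ?_⟩
    have h2 := hp z hz
    have ey : y z hz = y' := h2.left.2.symm.trans h.left.2
    rw [ey] at h2
    exact (h2.unique h).2

/-- Half of the domain has the first bit `c`. -/
theorem LabelledTwins.ncard_X (hT : F.LabelledTwins) (κ : ℕ) (c : Bool) :
    (F.X κ).ncard = 2 * {z | c :: z ∈ F.X κ}.ncard := by
  rw [ncard_eq_add _ (F.X_finite κ) (hT.ne_nil κ)]
  have h : ∀ c' : Bool, {z | c' :: z ∈ F.X κ} = {z | c :: z ∈ F.X κ} := fun c' => by
    ext z
    exact ⟨hT.label κ _ _ z, hT.label κ _ _ z⟩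
  rw [h false, h true]
  ring

/-- A lower bound for the proportion of images with two preimages holds for each value of the first
bit separately. -/
theorem LabelledTwins.le_ncard_twinSet (hT : F.LabelledTwins) {κ : ℕ} {k : Val} (hk : k ∈ F.K κ)
    {ε : ℝ} (h : ε * ((F.X κ).ncard : ℝ) ≤
      ({x | x ∈ F.X κ ∧ ∃ z z', F.Twin κ k (F.f κ k x) z z'}.ncard : ℝ)) (c : Bool) :
    ε * ({z | c :: z ∈ F.X κ}.ncard : ℝ) ≤ ((F.twinSet κ k c).ncard : ℝ) := by
  rw [ncard_eq_add {x | x ∈ F.X κ ∧ _} ((F.X_finite κ).subset fun x hx => hx.1)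
    fun x hx => hT.ne_nil κ x hx.1, hT.ncard_X κ c] at h
  change _ ≤ (((F.twinSet κ k false).ncard + (F.twinSet κ k true).ncard : ℕ) : ℝ) at h
  have hc : (F.twinSet κ k false).ncard + (F.twinSet κ k true).ncard =
      2 * (F.twinSet κ k c).ncard := by
    cases c <;> have := hT.ncard_twinSet hk <;> omega
  rw [hc] at h
  push_cast at h
  linarith

/-- For either value of the first bit, the strings whose image has two preimages form a product of
`n κ` sets `twinSet`, so their proportion is a product as well. -/
theorem LabelledTwins.concat_two_to_one (hT : F.LabelledTwins) {κ : ℕ} {ks : Fin (n κ) → Val}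
    (hks : ∀ i, ks i ∈ F.K κ) {ε : ℝ} (hε : 0 ≤ ε)
    (h : ∀ i, ε * ((F.X κ).ncard : ℝ) ≤
      ({x | x ∈ F.X κ ∧ ∃ z z', F.Twin κ (ks i) (F.f κ (ks i) x) z z'}.ncard : ℝ)) :
    ε ^ n κ * (((F.concat n).X κ).ncard : ℝ) ≤ ({x | x ∈ (F.concat n).X κ ∧ ∃ z z',
      (F.concat n).Twin κ (Val.tuple ks) ((F.concat n).f κ (Val.tuple ks) x) z z'}.ncard : ℝ) := by
  have hne : ∀ x ∈ (F.concat n).X κ, x ≠ [] := fun x hx => by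
    obtain ⟨c, y, rfl, _⟩ := exists_cons_of_mem_concat hx
    simp
  rw [ncard_eq_add _ ((F.concat n).X_finite κ) hne, ncard_eq_add {x | x ∈ (F.concat n).X κ ∧ _}
    (((F.concat n).X_finite κ).subset fun x hx => hx.1) fun x hx => hne x hx.1]
  push_cast
  rw [mul_add]
  suffices H : ∀ c : Bool, ε ^ n κ * ({z | c :: z ∈ (F.concat n).X κ}.ncard : ℝ) ≤
      ({y | c :: y ∈ (F.concat n).X κ ∧ ∃ z z', (F.concat n).Twin κ (Val.tuple ks)
        ((F.concat n).f κ (Val.tuple ks) (c :: y)) z z'}.ncard : ℝ) from add_le_add (H _) (H _)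
  intro c
  have e1 : {z | c :: z ∈ (F.concat n).X κ} =
      blockSet (F.l κ - 1) (fun _ => {z | c :: z ∈ F.X κ}) (n κ) := by
    ext y
    exact cons_mem_concat_iff
  have e2 : {y | c :: y ∈ (F.concat n).X κ ∧ ∃ z z', (F.concat n).Twin κ (Val.tuple ks)
        ((F.concat n).f κ (Val.tuple ks) (c :: y)) z z'} =
      blockSet (F.l κ - 1)
        (fun i => if hi : i < n κ then F.twinSet κ (ks ⟨i, hi⟩) c else ∅) (n κ) := by
    ext y
    simp only [Set.mem_ofPred_eq, cons_mem_concat_iff, concat_f,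
      hT.exists_twin_concat_iff hks, blockSet]
    constructor
    · rintro ⟨⟨h1, h2⟩, h3⟩
      refine ⟨h1, fun i hi => ?_⟩
      obtain ⟨z, z', h4⟩ := h3 ⟨i, hi⟩
      simp only [hi, dif_pos]
      exact ⟨h2 i hi, _, _, h4⟩
    · rintro ⟨h1, h2⟩
      refine ⟨⟨h1, fun i hi => ?_⟩, fun i => ?_⟩
      · have := h2 i hi
        simp only [hi, dif_pos] at this
        exact this.1
      · have := h2 i i.2
        simp only [i.2, dif_pos] at this
        obtain ⟨_, x, x', h4⟩ := this
        obtain ⟨z, z', h5, _⟩ := hT.exists_sorted (hks i) h4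
        exact ⟨z, z', h5⟩
  rw [e1, e2, ncard_blockSet (G := fun _ => {z | c :: z ∈ F.X κ})
    fun i _ a ha => (length_of_cons_mem ha).1, ncard_blockSet]
  · push_cast
    rw [Finset.prod_const, Finset.card_range, ← mul_pow]
    calc (ε * ({z | c :: z ∈ F.X κ}.ncard : ℝ)) ^ n κ
        = ∏ _i ∈ Finset.range (n κ), ε * ({z | c :: z ∈ F.X κ}.ncard : ℝ) := by simp
      _ ≤ _ := Finset.prod_le_prod (fun i _ => by positivity) fun i hi => by
        simp only [Finset.mem_range.1 hi, dif_pos]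
        exact hT.le_ncard_twinSet (hks _) (h _) c
  · intro i hi a ha
    simp only [hi, dif_pos] at ha
    exact (length_of_cons_mem ha.1).1

end Family

open Val

local infixr:80 " ⨟ " => Prog.seq

/-! ### Bits, blocks and inner products -/

namespace Prog

@[simp] theorem always_nth (l i : Val) (Q : Val → Prop) :
    nth.always (cons l i) Q ↔ Q (l.nth i.len) := computes_nth.always_iff _ _

/-- The exclusive or of two bits. -/
def xorBit : Prog := ite hd (ite tl nil (pair nil nil)) (ite tl (pair nil nil) nil)

theorem computes_xorBit : xorBit.Computes fun v => bit (xor v.hd.truth v.tl.truth) :=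
  (computes_hd.ite (computes_tl.ite computes_nil (computes_nil.pair computes_nil))
    (computes_tl.ite (computes_nil.pair computes_nil) computes_nil)).congr fun v => by
      cases v.hd <;> cases v.tl <;> simp [bit]

/-- The conjunction of two bits. -/
def andBit : Prog := ite hd (ite tl (pair nil nil) nil) nil

theorem computes_andBit : andBit.Computes fun v => bit (v.hd.truth && v.tl.truth) :=
  (computes_hd.ite (computes_tl.ite (computes_nil.pair computes_nil) computes_nil)
    computes_nil).congr fun v => by cases v.hd <;> cases v.tl <;> simp [bit]

/-- On input `(b, (x, x'))`, the inner product of `b` and `x ⊕ x'`. -/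
def innerProd : Prog :=
  pair id (pair (hd ⨟ length) nil) ⨟ fold (pair (pair (pair (hd ⨟ hd) (tl ⨟ hd) ⨟ nth)
    (pair (pair (hd ⨟ tl ⨟ hd) (tl ⨟ hd) ⨟ nth) (pair (hd ⨟ tl ⨟ tl) (tl ⨟ hd) ⨟ nth) ⨟ xorBit)
      ⨟ andBit) (tl ⨟ tl) ⨟ xorBit)

theorem size_bit_le (b : Bool) : (bit b).size ≤ 3 := by cases b <;> simp [bit]

theorem zipWith_eq_map_range {α β γ : Type*} (f : α → β → γ) (x : List α) (y : List β) (a : α)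
    (b : β) (h : x.length = y.length) :
    List.zipWith f x y = (List.range x.length).map fun i => f (x.getD i a) (y.getD i b) := by
  apply List.ext_getElem
  · simp [h]
  · intro i h1 h2
    simp at h1
    simp [h1]

theorem computes_innerProd : ∃ f, innerProd.Computes f ∧ ∀ b x x' : List Bool,
    x.length = b.length → x'.length = b.length →
      f (cons (ofBits b) (cons (ofBits x) (ofBits x'))) = bit (innerBits b (xorBits x x')) := by
  refine ⟨_, (computes_id.pair ((computes_hd.seq computes_length).pair computes_nil)).seq
    ((((((computes_hd.seq computes_hd).pair (computes_tl.seq computes_hd)).seq computes_nth).pair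
    (((((computes_hd.seq (computes_tl.seq computes_hd)).pair (computes_tl.seq computes_hd)).seq
      computes_nth).pair (((computes_hd.seq (computes_tl.seq computes_tl)).pair
        (computes_tl.seq computes_hd)).seq computes_nth)).seq computes_xorBit)).seq
          computes_andBit).pair (computes_tl.seq computes_tl) |>.seq computes_xorBit |>.fold
            ⟨3, fun v => ?_⟩), fun b x x' hx hx' => ?_⟩
  · exact (size_bit_le _).trans (by simp)
  · have e : List.zipWith xor x x' = (List.range b.length).map fun i =>
        xor (x.getD i false) (x'.getD i false) := by
      rw [zipWith_eq_map_range _ _ _ false false (by omega), hx]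
    have e2 : List.zipWith and b (xorBits x x') = (List.range b.length).map fun i =>
        (b.getD i false && xor (x.getD i false) (x'.getD i false)) := by
      rw [xorBits, e, zipWith_eq_map_range _ _ _ false false (by simp)]
      refine List.map_congr_left fun i hi => ?_
      simp [List.mem_range.1 hi]
    rw [innerBits, e2]
    simp only [hd_cons, tl_cons, len_ofBits, truth_bit]
    suffices h : ∀ m a, foldFn (fun v => bit (xor ((v.hd.hd.nth v.tl.hd.len).truth &&
        xor (v.hd.tl.hd.nth v.tl.hd.len).truth (v.hd.tl.tl.nth v.tl.hd.len).truth)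
          v.tl.tl.truth)) (cons (ofBits b) (cons (ofBits x) (ofBits x'))) (num m) (bit a) =
        bit (((List.range m).map fun i =>
          (b.getD i false && xor (x.getD i false) (x'.getD i false))).foldr xor a) from
      h b.length false
    intro m
    induction m with
    | zero => intro a; simp [num_zero, foldFn]
    | succ m ih =>
      intro a
      simp only [num_succ, foldFn, hd_cons, tl_cons, len_num, nth_ofBits, truth_bit, ih,
        List.range_succ, List.map_append, List.map_cons, List.map_nil, List.foldr_append,
        List.foldr_cons, List.foldr_nil]

theorem always_innerProd {b x x' : List Bool} (hx : x.length = b.length)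
    (hx' : x'.length = b.length) (Q : Val → Prop) :
    innerProd.always (cons (ofBits b) (cons (ofBits x) (ofBits x'))) Q ↔
      Q (bit (innerBits b (xorBits x x'))) := by
  obtain ⟨f, hf, h⟩ := computes_innerProd
  rw [hf.always_iff, h b x x' hx hx']

theorem always_divide {N X : Val} {m : ℕ} (hN : N.len ≠ 0) (hX : X.len = N.len * m)
    (Q : Val → Prop) : divide.always (cons N X) Q ↔ Q (num m) := by
  obtain ⟨f, hf, h⟩ := computes_divide
  rw [hf.always_iff, h N X m (fun e => hN (by rw [e]; rfl)) hX]

theorem always_block {m N : ℕ} {y : List Bool} (hy : y.length = N * m) {i : ℕ} (hi : i < N)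
    (Q : Val → Prop) : block.always (cons (num m) (cons (num i) (ofBits y))) Q ↔
      Q (ofBits (blockOf m y i)) := by
  rw [computes_block.always_iff]
  suffices h : ofList ((List.range m).map fun j => (ofBits y).nth (i * m + j)) =
      ofBits (blockOf m y i) by simp only [hd_cons, tl_cons, len_num, h]
  rw [show ofBits (blockOf m y i) = ofList ((blockOf m y i).map bit) from rfl]
  congr 1
  have hl := length_blockOf hy hi
  apply List.ext_getElem
  · simp [hl]
  · intro j h1 h2
    simp only [List.length_map, List.length_range] at h1
    have h3 : i * m + j < y.length := by
      rw [hy]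
      calc i * m + j < i * m + m := by omega
        _ = (i + 1) * m := by ring
        _ ≤ N * m := Nat.mul_le_mul_right _ hi
    simp [nth_ofBits, blockOf, h3]

theorem ppt_divide : divide.PPT := computes_divide.choose_spec.1.ppt
theorem ppt_innerProd : innerProd.PPT := computes_innerProd.choose_spec.1.ppt

/-- On input `(M, (i, x))`, the string `(c, x̄⁽ⁱ⁾)` for `x = (c, x̄⁽⁰⁾, …)` with blocks of the
length of `M`. -/
def part : Prog :=
  pair (tl ⨟ tl ⨟ hd) (pair hd (pair (tl ⨟ hd) (tl ⨟ tl ⨟ tl)) ⨟ block)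

theorem ppt_part : part.PPT :=
  (ppt_tl.seq (ppt_tl.seq ppt_hd)).pair ((ppt_hd.pair ((ppt_tl.seq ppt_hd).pair
    (ppt_tl.seq (ppt_tl.seq ppt_tl)))).seq computes_block.ppt)

theorem always_part {m N : ℕ} {c : Bool} {y : List Bool} (hy : y.length = N * m) {i : ℕ}
    (hi : i < N) (Q : Val → Prop) :
    part.always (cons (num m) (cons (num i) (ofBits (c :: y)))) Q ↔
      Q (ofBits (c :: blockOf m y i)) := by
  simp [part, always_block hy hi]

theorem always_tab_tuple {p : Prog} {v : Val} {N : ℕ} (hN : v.tl.len = N) {R : Fin N → Val → Prop}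
    (h : ∀ i : Fin N, p.always (cons v.hd (num i)) (R i)) :
    (tab p).always v fun w => ∃ ws : Fin N → Val, (∀ i, R i (ws i)) ∧ w = tuple ws := by
  subst hN
  refine always_mono (always_tab (R := fun i w => ∀ hi : i < v.tl.len, R ⟨i, hi⟩ w)
    fun i hi => always_mono (h ⟨i, hi⟩) fun w hw _ => hw) ?_
  rintro _ ⟨ws, hws, rfl⟩
  exact ⟨fun i => ws i, fun i => hws i i.2 i.2, (tuple_eq ws).symm⟩

theorem always_tab_eq {p : Prog} {v : Val} {N : ℕ} (hN : v.tl.len = N) {ws : Fin N → Val}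
    (h : ∀ i : Fin N, p.always (cons v.hd (num i)) (· = ws i)) :
    (tab p).always v (· = tuple ws) := by
  refine always_mono (always_tab_tuple hN (R := fun i w => w = ws i) h) ?_
  rintro _ ⟨ws', h', rfl⟩
  rw [show ws' = ws from funext h']

theorem ofBits_ofFn {m : ℕ} (b : Fin m → Bool) :
    ofBits (List.ofFn b) = tuple fun i => bit (b i) := by
  simp [ofBits, tuple, List.map_ofFn, Function.comp_def]

/-! ### The algorithms of the concatenated family -/

/-- On input `((1^κ, d), i)`, a local key for the `i`-th bit of `d`. -/
def genAt (gen : Prog) : Prog :=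
  pair (hd ⨟ hd) (pair (pair (hd ⨟ tl) tl ⨟ nth) nil) ⨟ gen

/-- Key generation: independent local keys, sorted into keys and trapdoors. -/
def concatGen (gen : Prog) : Prog :=
  pair id tl ⨟ tab (genAt gen) ⨟ pair (map hd) (map tl)

/-- On input `((M, (1^κ, (k, x))), i)`, the `i`-th component of `f'_k(x)`. -/
def evaluateAt (evaluate : Prog) : Prog :=
  pair (hd ⨟ tl ⨟ hd) (pair (pair (hd ⨟ tl ⨟ tl ⨟ hd) tl ⨟ nth)
    (pair (hd ⨟ hd) (pair tl (hd ⨟ tl ⨟ tl ⨟ tl)) ⨟ part)) ⨟ evaluate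

/-- On input `(1^κ, (k, x))`, the tuple `f'_k(x)`. The block length `M` is the length of the string
behind the first bit, divided by the number of local keys. -/
def concatEvaluate (evaluate : Prog) : Prog :=
  pair (pair (pair (tl ⨟ hd) (tl ⨟ tl ⨟ tl) ⨟ divide) id) (tl ⨟ hd) ⨟ tab (evaluateAt evaluate)

/-- On input `((M, (1^κ, x)), i)`, the `i`-th bit of `h'(x)`. -/
def hashAt (hash : Prog) : Prog :=
  pair (hd ⨟ tl ⨟ hd) (pair (hd ⨟ hd) (pair tl (hd ⨟ tl ⨟ tl)) ⨟ part) ⨟ hash ⨟ hd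

/-- On input `(1^κ, x)`, the string `h'(x)`. The program `N` computes the number of components from
`1^κ`. -/
def concatHash (N hash : Prog) : Prog :=
  pair (pair (pair (hd ⨟ N) (tl ⨟ tl) ⨟ divide) id) (hd ⨟ N) ⨟ tab (hashAt hash)

/-- On input `((1^κ, t), i)`, the bit of the local key with the trapdoor `t⁽ⁱ⁾`. -/
def supportAt (support : Prog) : Prog :=
  pair (hd ⨟ hd) (pair (hd ⨟ tl) tl ⨟ nth) ⨟ support ⨟ hd

/-- On input `(1^κ, t)`, the string `d₀'(k)` of the key `k` with the trapdoor `t`. -/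
def concatSupport (support : Prog) : Prog := pair id tl ⨟ tab (supportAt support)

/-- The inversion algorithm, with the preimages sorted by their first bits. -/
def sortedInvert (invert : Prog) : Prog :=
  invert ⨟ ite id (ite (hd ⨟ hd) (pair tl hd) id) nil

/-- On input `((1^κ, (t, y)), i)`, the preimages of the `i`-th component of `y`. -/
def invertAt (invert : Prog) : Prog :=
  pair (hd ⨟ hd) (pair (pair (hd ⨟ tl ⨟ hd) tl ⨟ nth) (pair (hd ⨟ tl ⨟ tl) tl ⨟ nth)) ⨟
    sortedInvert invert

/-- `nil` iff some entry of the list is `nil`. -/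
def allNonNil : Prog :=
  pair id (pair length (pair nil nil)) ⨟ fold (ite (onPair nth) (tl ⨟ tl) nil)

/-- From the strings `(c, x̄⁽⁰⁾)`, `(c, x̄⁽¹⁾)`, …, the string `(c, x̄⁽⁰⁾, x̄⁽¹⁾, …)`. -/
def joinParts : Prog := pair (hd ⨟ hd) (map tl ⨟ flatten)

/-- On input `(1^κ, (t, y))`, the two preimages of `y`, provided that all components of `y` have
two: the preimages of the components with the first bit `0` are joined, and so are those with
`1`. -/
def concatInvert (invert : Prog) : Prog :=
  pair id (tl ⨟ hd) ⨟ tab (invertAt invert) ⨟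
    ite allNonNil (pair (map hd ⨟ joinParts) (map tl ⨟ joinParts)) nil

/-- On input `(r, (1^κ, (t, y)))`, where `r` is the output of the sorted inversion, the partial
information: `⊥` if `r` is `nil`, `✗` if the bit of the key is `0`, and otherwise the hash of the
preimage with the first bit `0`. -/
def infoOfPreimages (support hash : Prog) : Prog :=
  ite hd (ite (pair (tl ⨟ hd) (tl ⨟ tl ⨟ hd) ⨟ support ⨟ hd)
    (pair (pair nil nil) (pair (tl ⨟ hd) (hd ⨟ hd) ⨟ hash ⨟ hd)) (pair nil nil)) nil

/-- `PartInfo_Loc`: on input `(1^κ, (i, (t, y)))`, the partial information for the `i`-th component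
of `y`, where `t` is the `i`-th local trapdoor. -/
def localInfo (H : Algorithms) : Prog :=
  pair hd (pair (tl ⨟ tl ⨟ hd) (pair (tl ⨟ tl ⨟ tl) (tl ⨟ hd) ⨟ nth)) ⨟
    pair (sortedInvert H.invert) id ⨟ infoOfPreimages H.support H.hash

/-- On input `((1^κ, (t, y)), i)`, the `i`-th component of the partial information. -/
def infoAt (H : Algorithms) : Prog :=
  pair (hd ⨟ hd) (pair tl (pair (pair (hd ⨟ tl ⨟ hd) tl ⨟ nth) (hd ⨟ tl ⨟ tl))) ⨟ localInfo H

/-- `PartInfo`: on input `(1^κ, (t, y))`, the tuple of the local partial information. The program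
`N` computes the number of components from `1^κ`. -/
def concatInfo (N : Prog) (H : Algorithms) : Prog := pair id (hd ⨟ N) ⨟ tab (infoAt H)

/-- On input `(r, (1^κ, (i, (t, (y, b)))))`, where `r` is the pair of the sorted preimages, the
inner product of the `i`-th block of `b` with their sum, plus the first bit of `b` if `i = 0`. The
block length is obtained by dividing the length of `b` without its first bit by that of `y`. -/
def alphaOfPreimages : Prog :=
  pair (pair nil nil) (pair (ite (tl ⨟ tl ⨟ hd) nil (tl ⨟ tl ⨟ tl ⨟ tl ⨟ tl ⨟ hd))
    (pair (pair (pair (tl ⨟ tl ⨟ tl ⨟ tl ⨟ hd) (tl ⨟ tl ⨟ tl ⨟ tl ⨟ tl ⨟ tl) ⨟ divide)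
      (pair (tl ⨟ tl ⨟ hd) (tl ⨟ tl ⨟ tl ⨟ tl ⨟ tl ⨟ tl)) ⨟ block)
        (pair (hd ⨟ hd ⨟ tl) (hd ⨟ tl ⨟ tl)) ⨟ innerProd) ⨟ xorBit)

/-- `PartAlpha_Loc`: on input `(1^κ, (i, (t, (y, b))))`, the contribution of the `i`-th component to
the inner product of `b` with the sum of the twins of `y`. -/
def localAlpha (invert : Prog) : Prog :=
  pair (pair hd (pair (tl ⨟ tl ⨟ hd) (pair (tl ⨟ tl ⨟ tl ⨟ hd) (tl ⨟ hd) ⨟ nth)) ⨟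
    sortedInvert invert) id ⨟ ite hd alphaOfPreimages nil

theorem computes_allNonNil : ∃ f, allNonNil.Computes f ∧
    ∀ v, f v ≠ Val.nil ↔ ∀ i < v.len, v.nth i ≠ Val.nil := by
  refine ⟨_, (computes_id.pair (computes_length.pair (computes_nil.pair computes_nil))).seq
    ((((computes_hd.pair (computes_tl.seq computes_hd)).seq computes_nth).ite
      (computes_tl.seq computes_tl) computes_nil).fold ⟨1, fun v => ?_⟩), fun v => ?_⟩
  · cases h : v.hd.nth v.tl.hd.len <;> simp [h]
  · simp only [hd_cons, tl_cons]
    generalize v.len = m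
    suffices h : ∀ acc, foldFn (fun u => select (u.hd.nth u.tl.hd.len) u.tl.tl Val.nil) v (num m)
        acc ≠ Val.nil ↔ acc ≠ Val.nil ∧ ∀ i < m, v.nth i ≠ Val.nil by
      simpa using h (cons Val.nil Val.nil)
    induction m with
    | zero => simp [num_zero, foldFn]
    | succ m ih =>
      intro acc
      simp only [num_succ, foldFn, hd_cons, tl_cons, len_num, ih, Nat.lt_succ_iff_lt_or_eq]
      by_cases h : v.nth m = Val.nil
      · simp only [h, select_nil, ne_eq, not_true_eq_false, false_and, false_iff, not_and,
          not_forall]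
        exact fun _ => ⟨m, Or.inr rfl, by simp [h]⟩
      · rw [select_of_ne _ _ h]
        constructor
        · rintro ⟨h1, h2⟩
          exact ⟨h1, fun i hi => hi.elim (h2 i) fun e => e ▸ h⟩
        · rintro ⟨h1, h2⟩
          exact ⟨h1, fun i hi => h2 i (Or.inl hi)⟩

theorem computes_joinParts : joinParts.Computes fun v =>
    cons v.hd.hd (ofList ((v.toList.map Val.tl).map toList).flatten) :=
  ((computes_hd.seq computes_hd).pair (computes_tl.map.seq computes_flatten)).congr fun v => by
    simp

/-- The string with given first bit and blocks. -/
theorem joinParts_tuple {m : ℕ} (hm : 1 ≤ m) (c : Bool) (z : ℕ → List Bool) :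
    (cons (tuple fun i : Fin m => ofBits (c :: z i)).hd.hd (ofList
      (((tuple fun i : Fin m => ofBits (c :: z i)).toList.map Val.tl).map toList).flatten)) =
        ofBits (c :: join z m) := by
  have h0 : (tuple fun i : Fin m => ofBits (c :: z i)).hd = ofBits (c :: z 0) := by
    rw [← nth_zero]
    exact nth_tuple _ ⟨0, hm⟩
  rw [h0, tuple_eq fun i => ofBits (c :: z i)]
  simp only [ofBits_cons, hd_cons, toList_ofList, List.map_map, Function.comp_def, tl_cons,
    toList_ofBits]
  rw [ofBits, join, List.map_flatten, List.map_map]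
  rfl

section ppt
variable {N : Prog} {H : Algorithms}

theorem ppt_concatGen {gen : Prog} (h : gen.PPT) : (concatGen gen).PPT :=
  (ppt_id.pair ppt_tl).seq ((PPT.tab (((ppt_hd.seq ppt_hd).pair
    ((((ppt_hd.seq ppt_tl).pair ppt_tl).seq computes_nth.ppt).pair ppt_nil)).seq h)).seq
      (computes_hd.map.ppt.pair computes_tl.map.ppt))

theorem ppt_concatEvaluate {evaluate : Prog} (h : evaluate.PPT) : (concatEvaluate evaluate).PPT :=
  (((((ppt_tl.seq ppt_hd).pair (ppt_tl.seq (ppt_tl.seq ppt_tl))).seq ppt_divide).pair ppt_id).pair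
    (ppt_tl.seq ppt_hd)).seq (PPT.tab (((ppt_hd.seq (ppt_tl.seq ppt_hd)).pair
      ((((ppt_hd.seq (ppt_tl.seq (ppt_tl.seq ppt_hd))).pair ppt_tl).seq computes_nth.ppt).pair
        (((ppt_hd.seq ppt_hd).pair (ppt_tl.pair (ppt_hd.seq (ppt_tl.seq
          (ppt_tl.seq ppt_tl))))).seq ppt_part))).seq h))

theorem ppt_concatHash {hash : Prog} (hN : N.PPT) (h : hash.PPT) : (concatHash N hash).PPT :=
  (((((ppt_hd.seq hN).pair (ppt_tl.seq ppt_tl)).seq ppt_divide).pair ppt_id).pair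
    (ppt_hd.seq hN)).seq (PPT.tab (((ppt_hd.seq (ppt_tl.seq ppt_hd)).pair
      (((ppt_hd.seq ppt_hd).pair (ppt_tl.pair (ppt_hd.seq (ppt_tl.seq ppt_tl)))).seq
        ppt_part)).seq (h.seq ppt_hd)))

theorem ppt_concatSupport {support : Prog} (h : support.PPT) : (concatSupport support).PPT :=
  (ppt_id.pair ppt_tl).seq (PPT.tab (((ppt_hd.seq ppt_hd).pair (((ppt_hd.seq ppt_tl).pair
    ppt_tl).seq computes_nth.ppt)).seq (h.seq ppt_hd)))

theorem ppt_sortedInvert {invert : Prog} (h : invert.PPT) : (sortedInvert invert).PPT :=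
  h.seq (ppt_id.ite ((ppt_hd.seq ppt_hd).ite (ppt_tl.pair ppt_hd) ppt_id) ppt_nil)

theorem ppt_concatInvert {invert : Prog} (h : invert.PPT) : (concatInvert invert).PPT :=
  (ppt_id.pair (ppt_tl.seq ppt_hd)).seq ((PPT.tab (((ppt_hd.seq ppt_hd).pair
    ((((ppt_hd.seq (ppt_tl.seq ppt_hd)).pair ppt_tl).seq computes_nth.ppt).pair
      (((ppt_hd.seq (ppt_tl.seq ppt_tl)).pair ppt_tl).seq computes_nth.ppt))).seq
        (ppt_sortedInvert h))).seq (computes_allNonNil.choose_spec.1.ppt.ite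
          ((computes_hd.map.ppt.seq computes_joinParts.ppt).pair
            (computes_tl.map.ppt.seq computes_joinParts.ppt)) ppt_nil))

theorem ppt_localInfo (h1 : H.invert.PPT) (h2 : H.support.PPT) (h3 : H.hash.PPT) :
    (localInfo H).PPT :=
  (ppt_hd.pair ((ppt_tl.seq (ppt_tl.seq ppt_hd)).pair (((ppt_tl.seq (ppt_tl.seq ppt_tl)).pair
    (ppt_tl.seq ppt_hd)).seq computes_nth.ppt))).seq (((ppt_sortedInvert h1).pair ppt_id).seq
      (ppt_hd.ite ((((ppt_tl.seq ppt_hd).pair (ppt_tl.seq (ppt_tl.seq ppt_hd))).seq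
        (h2.seq ppt_hd)).ite ((ppt_nil.pair ppt_nil).pair (((ppt_tl.seq ppt_hd).pair
          (ppt_hd.seq ppt_hd)).seq (h3.seq ppt_hd))) (ppt_nil.pair ppt_nil)) ppt_nil))

theorem ppt_concatInfo (hN : N.PPT) (h : (localInfo H).PPT) : (concatInfo N H).PPT :=
  (ppt_id.pair (ppt_hd.seq hN)).seq (PPT.tab (((ppt_hd.seq ppt_hd).pair (ppt_tl.pair
    ((((ppt_hd.seq (ppt_tl.seq ppt_hd)).pair ppt_tl).seq computes_nth.ppt).pair
      (ppt_hd.seq (ppt_tl.seq ppt_tl))))).seq h))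

theorem ppt_alphaOfPreimages : alphaOfPreimages.PPT :=
  have h4 : (tl ⨟ tl ⨟ tl ⨟ tl ⨟ tl ⨟ tl).PPT :=
    ppt_tl.seq (ppt_tl.seq (ppt_tl.seq (ppt_tl.seq (ppt_tl.seq ppt_tl))))
  (ppt_nil.pair ppt_nil).pair ((((ppt_tl.seq (ppt_tl.seq ppt_hd)).ite ppt_nil (ppt_tl.seq
    (ppt_tl.seq (ppt_tl.seq (ppt_tl.seq (ppt_tl.seq ppt_hd)))))).pair
      (((((((ppt_tl.seq (ppt_tl.seq (ppt_tl.seq (ppt_tl.seq ppt_hd)))).pair h4).seq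
        ppt_divide).pair ((ppt_tl.seq (ppt_tl.seq ppt_hd)).pair h4)).seq computes_block.ppt).pair
          ((ppt_hd.seq (ppt_hd.seq ppt_tl)).pair (ppt_hd.seq (ppt_tl.seq ppt_tl)))).seq
            ppt_innerProd)).seq computes_xorBit.ppt)

theorem ppt_localAlpha {invert : Prog} (h : invert.PPT) : (localAlpha invert).PPT :=
  (((ppt_hd.pair ((ppt_tl.seq (ppt_tl.seq ppt_hd)).pair (((ppt_tl.seq (ppt_tl.seq (ppt_tl.seq
    ppt_hd))).pair (ppt_tl.seq ppt_hd)).seq computes_nth.ppt))).seq (ppt_sortedInvert h)).pair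
      ppt_id).seq (ppt_hd.ite ppt_alphaOfPreimages ppt_nil)

end ppt
end Prog

/-! ### Correctness of the classical algorithms -/

section correctness
open Prog

variable {n : ℕ → ℕ} {F : Family fun _ => 1} {H : Algorithms} {δ : ℕ → ℝ} {N : Prog}

theorem IsHGHZCapable.always_invert (hF : IsHGHZCapable F H δ) {κ : ℕ}
    {k t y : Val} (hk : k ∈ F.K κ) (ht : F.IsTrapdoor κ k t) (hy : y ∈ F.Y κ) :
    H.invert.always (cons (num κ) (cons t y)) fun w =>
      (∃ x x', F.Twin κ k y x x' ∧ w = cons (ofBits x) (ofBits x')) ∨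
        ((¬ ∃ x x', F.Twin κ k y x x') ∧ w = Val.nil) :=
  (forall_run_iff _ _ QReg.zeroState fun w =>
    (∃ x x', F.Twin κ k y x x' ∧ w = cons (ofBits x) (ofBits x')) ∨
      ((¬ ∃ x x', F.Twin κ k y x x') ∧ w = Val.nil)).1 (hF.invert_correct κ k hk t ht y hy)

theorem IsHGHZCapable.always_sortedInvert (hF : IsHGHZCapable F H δ) {κ : ℕ}
    {k t y : Val} (hk : k ∈ F.K κ) (ht : F.IsTrapdoor κ k t) (hy : y ∈ F.Y κ) {z z' : List Bool}
    (h : F.Twin κ k y (false :: z) (true :: z')) :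
    (sortedInvert H.invert).always (cons (num κ) (cons t y))
      (· = cons (ofBits (false :: z)) (ofBits (true :: z'))) := by
  simp only [sortedInvert, always_seq]
  refine always_mono (hF.always_invert hk ht hy) ?_
  rintro w (⟨x, x', hx, rfl⟩ | ⟨hn, _⟩)
  · rcases h.mem hx.left.1 hx.left.2 with rfl | rfl <;>
      rcases h.mem hx.right.1 hx.right.2 with rfl | rfl
    · exact absurd rfl hx.1
    · simp [bit]
    · simp [bit]
    · exact absurd rfl hx.1
  · exact absurd ⟨_, _, h⟩ hn

theorem IsHGHZCapable.always_sortedInvert_nil (hF : IsHGHZCapable F H δ) (hT : F.LabelledTwins)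
    {κ : ℕ} {k t y : Val} (hk : k ∈ F.K κ) (ht : F.IsTrapdoor κ k t) (hy : y ∈ F.Y κ)
    (h : ¬ ∃ z z', F.Twin κ k y (false :: z) (true :: z')) :
    (sortedInvert H.invert).always (cons (num κ) (cons t y)) (· = Val.nil) := by
  simp only [sortedInvert, always_seq]
  refine always_mono (hF.always_invert hk ht hy) ?_
  rintro w (⟨x, x', hx, rfl⟩ | ⟨_, rfl⟩)
  · obtain ⟨z, z', h', _⟩ := hT.exists_sorted hk hx
    exact absurd ⟨z, z', h'⟩ h
  · simp

theorem IsHGHZCapable.always_support (hF : IsHGHZCapable F H δ) {κ : ℕ} {k t : Val}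
    (hk : k ∈ F.K κ) (ht : F.IsTrapdoor κ k t) :
    (H.support ⨟ hd).always (cons (num κ) t) (· = bit (F.d₀ κ k 0)) := by
  rw [always_seq]
  refine always_mono ((outputs_iff _ _ _).1 (hF.support_correct κ k hk t ht)) ?_
  rintro w rfl
  simp

theorem IsHGHZCapable.always_hash (hF : IsHGHZCapable F H δ) {κ : ℕ} {x : List Bool}
    (hx : x ∈ F.X κ) :
    (H.hash ⨟ hd).always (cons (num κ) (ofBits x)) (· = bit (F.h κ x 0)) := by
  rw [always_seq]
  refine always_mono ((outputs_iff _ _ _).1 (hF.hash_correct κ x hx)) ?_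
  rintro w rfl
  simp

theorem IsHGHZCapable.always_concatHash
    (hN : ∀ κ, N.always (num κ) (· = num (n κ))) (hF : IsHGHZCapable F H δ) {κ : ℕ} (hn : 1 ≤ n κ)
    {x : List Bool} (hx : x ∈ (F.concat n).X κ) :
    (concatHash N H.hash).always (cons (num κ) (ofBits x))
      (· = ofBits (List.ofFn ((F.concat n).h κ x))) := by
  obtain ⟨c, y, rfl, hy, hp⟩ := Family.exists_cons_of_mem_concat hx
  simp only [concatHash, always_seq, always_pair, always_hd, always_tl, always_id, hd_cons,
    tl_cons, always_iff_of_eq (hN κ), ofBits_cons]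
  rw [always_divide (by simp; omega) (m := F.l κ - 1) (by simpa using hy), ofBits_ofFn]
  refine always_tab_eq (by simp) fun i => ?_
  simp only [hashAt, always_seq (hd), always_seq (pair _ _), always_seq tl,
    always_pair, always_hd, always_tl, hd_cons,
    tl_cons, ← ofBits_cons, always_part hy i.2]
  exact hF.always_hash (hp i i.2)

theorem IsHGHZCapable.always_concatEvaluate (hF : IsHGHZCapable F H δ) {κ : ℕ} (hn : 1 ≤ n κ)
    {ks : Fin (n κ) → Val} (hks : ∀ i, ks i ∈ F.K κ) {x : List Bool}
    (hx : x ∈ (F.concat n).X κ) :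
    (concatEvaluate H.evaluate).always (cons (num κ) (cons (tuple ks) (ofBits x)))
      (· = (F.concat n).f κ (tuple ks) x) := by
  obtain ⟨c, y, rfl, hy, hp⟩ := Family.exists_cons_of_mem_concat hx
  rw [Family.concat_f]
  simp only [concatEvaluate, always_seq, always_pair, always_hd, always_tl, always_id, hd_cons,
    tl_cons, ofBits_cons]
  rw [always_divide (by simp; omega) (m := F.l κ - 1) (by simpa using hy)]
  refine always_tab_eq (by simp) fun i => ?_
  simp only [evaluateAt, always_seq, always_pair, always_hd, always_tl, hd_cons,
    tl_cons, ← ofBits_cons, always_part hy i.2, always_nth, len_num, nth_tuple]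
  exact (outputs_iff _ _ _).1 (hF.eval_correct κ _ (hks i) _ (hp i i.2))

theorem IsHGHZCapable.always_concatSupport (hF : IsHGHZCapable F H δ) {κ : ℕ}
    {ks ts : Fin (n κ) → Val} (hks : ∀ i, ks i ∈ F.K κ)
    (hts : ∀ i, F.IsTrapdoor κ (ks i) (ts i)) :
    (concatSupport H.support).always (cons (num κ) (tuple ts))
      (· = ofBits (List.ofFn ((F.concat n).d₀ κ (tuple ks)))) := by
  simp only [concatSupport, always_seq, always_pair, always_tl, always_id, tl_cons]
  rw [ofBits_ofFn]
  refine always_tab_eq (by simp) fun i => ?_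
  simp only [supportAt, always_seq hd, always_seq (pair _ _), always_pair, always_hd, always_tl,
    hd_cons, tl_cons, always_nth, len_num, nth_tuple]
  refine always_mono (hF.always_support (hks i) (hts i)) ?_
  rintro w rfl
  simp [Family.concat]

theorem IsHGHZCapable.always_concatInvert (hF : IsHGHZCapable F H δ) (hT : F.LabelledTwins)
    {κ : ℕ} (hn : 1 ≤ n κ) {ks ts ys : Fin (n κ) → Val} (hks : ∀ i, ks i ∈ F.K κ)
    (hts : ∀ i, F.IsTrapdoor κ (ks i) (ts i)) (hys : ∀ i, ys i ∈ F.Y κ) :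
    (concatInvert H.invert).always (cons (num κ) (cons (tuple ts) (tuple ys))) fun w =>
      (∃ x x', (F.concat n).Twin κ (tuple ks) (tuple ys) x x' ∧
        w = cons (ofBits x) (ofBits x')) ∨
      ((¬ ∃ x x', (F.concat n).Twin κ (tuple ks) (tuple ys) x x') ∧ w = Val.nil) := by
  obtain ⟨f, hf, hf2⟩ := computes_allNonNil
  simp only [concatInvert, always_seq, always_pair, always_id, always_hd, always_tl, hd_cons,
    tl_cons, always_ite, always_nil, hf.always_iff]
  by_cases h : ∀ i, ∃ z z', F.Twin κ (ks i) (ys i) (false :: z) (true :: z')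
  · have hex : ∃ z z' : ℕ → List Bool, ∀ i : Fin (n κ),
        F.Twin κ (ks i) (ys i) (false :: z i) (true :: z' i) := by
      choose z z' h using h
      exact ⟨fun i => if hi : i < n κ then z ⟨i, hi⟩ else [],
        fun i => if hi : i < n κ then z' ⟨i, hi⟩ else [], fun i => by simpa using h i⟩
    obtain ⟨z, z', hz⟩ := hex
    refine always_mono (always_tab_eq (N := n κ) (by simp) (ws := fun i : Fin (n κ) =>
      cons (ofBits (false :: z i)) (ofBits (true :: z' i))) fun i => ?_) ?_
    · simp only [invertAt, always_seq, always_pair, always_hd, always_tl, hd_cons, tl_cons,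
        always_nth, len_num, nth_tuple]
      exact hF.always_sortedInvert (hks i) (hts i) (hys i) (hz i)
    · rintro w rfl
      rw [select_of_ne]
      · simp only [computes_hd.map.always_iff, computes_tl.map.always_iff,
          computes_joinParts.always_iff]
        left
        refine ⟨_, _, Family.twin_concat_of_twins hz, ?_⟩
        have e : ∀ g : Val → Val, ofList ((tuple fun i : Fin (n κ) => cons (ofBits (false :: z i))
            (ofBits (true :: z' i))).toList.map g) = tuple fun i : Fin (n κ) =>
              g (cons (ofBits (false :: z i)) (ofBits (true :: z' i))) := fun g => by
          simp [tuple, List.map_ofFn, Function.comp_def]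
        rw [e, e]
        congr 1
        · exact joinParts_tuple hn false z
        · exact joinParts_tuple hn true z'
      · refine (hf2 _).2 fun i hi => ?_
        rw [len_tuple] at hi
        rw [nth_tuple _ (⟨i, hi⟩ : Fin (n κ))]
        simp
  · refine always_mono (always_tab_tuple (N := n κ) (by simp) (R := fun i w =>
      (¬ ∃ z z', F.Twin κ (ks i) (ys i) (false :: z) (true :: z')) → w = Val.nil) fun i => ?_) ?_
    · simp only [invertAt, always_seq, always_pair, always_hd, always_tl, hd_cons, tl_cons,
        always_nth, len_num, nth_tuple]
      by_cases hi : ∃ z z', F.Twin κ (ks i) (ys i) (false :: z) (true :: z')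
      · exact fun b _ hi' => absurd hi hi'
      · exact always_mono (hF.always_sortedInvert_nil hT (hks i) (hts i) (hys i) hi)
          fun w hw _ => hw
    · rintro _ ⟨ws, hws, rfl⟩
      push Not at h
      obtain ⟨i, hi⟩ := h
      have hnil := hws i (by push Not; exact hi)
      have hnil' : f (tuple ws) = Val.nil := by
        by_contra hne
        exact (hf2 _).1 hne i (by simp) (by rw [nth_tuple, hnil])
      rw [hnil', select_nil]
      · refine Or.inr ⟨fun hx => ?_, trivial⟩
        obtain ⟨z, z', h'⟩ := (hT.exists_twin_concat_iff hks ys).1 hx i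
        exact hi z z' h'

theorem IsHGHZCapable.always_localInfo (hF : IsHGHZCapable F H δ) (hT : F.LabelledTwins) {κ i : ℕ}
    {k t y : Val} (hk : k ∈ F.K κ) (ht : F.IsTrapdoor κ k t) (hy : y.nth i ∈ F.Y κ) :
    (localInfo H).always (locInput κ i t y) (· = (F.partInfoLoc κ k (y.nth i)).enc) := by
  simp only [localInfo, locInput, always_seq, always_pair, always_hd, always_tl, always_id, hd_cons,
    tl_cons, always_nth, len_num, infoOfPreimages, always_ite]
  by_cases h : ∃ z z', F.Twin κ k (y.nth i) (false :: z) (true :: z')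
  · obtain ⟨z, z', h⟩ := h
    rw [always_iff_of_eq (hF.always_sortedInvert hk ht hy h), select_cons,
      Family.partInfoLoc_of_twin h]
    have hs := always_iff_of_eq (hF.always_support hk ht)
    have hh := always_iff_of_eq (hF.always_hash h.left.1)
    simp only [always_seq, always_hd] at hs hh
    rw [hs fun w => Val.select w _ _]
    cases hd : F.d₀ κ k 0
    · simp [Info.enc]
    · simp only [select_bit, if_true, always_nil, hd_cons]
      rw [hh fun w => cons (cons Val.nil Val.nil) w = _]
      simp [Info.enc, bit]
  · rw [always_iff_of_eq (hF.always_sortedInvert_nil hT hk ht hy h), select_nil,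
      Family.partInfoLoc_of_not h]
    simp [Info.enc]

theorem IsHGHZCapable.always_localAlpha (hF : IsHGHZCapable F H δ) (hT : F.LabelledTwins) {κ : ℕ}
    {ys : Fin (n κ) → Val} (i : Fin (n κ)) {k t : Val} (hk : k ∈ F.K κ) (ht : F.IsTrapdoor κ k t)
    (hy : ys i ∈ F.Y κ) {b : List Bool} (hb : b.length = (F.concat n).l κ) :
    (localAlpha H.invert).always (alphaInput κ i t (tuple ys) b)
      (· = (F.partAlphaLoc κ i k (ys i) b).enc) := by
  simp only [localAlpha, alphaInput, locInput, always_seq, always_pair, always_hd, always_tl,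
    always_id, hd_cons, tl_cons, always_nth, len_num, nth_tuple, always_ite]
  by_cases h : ∃ z z', F.Twin κ k (ys i) (false :: z) (true :: z')
  · obtain ⟨z, z', h⟩ := h
    rw [always_iff_of_eq (hF.always_sortedInvert hk ht hy h), select_cons,
      Family.partAlphaLoc_of_twin h]
    cases b with
    | nil => simp [Family.concat] at hb; omega
    | cons c y =>
      have hy' : y.length = n κ * (F.l κ - 1) := by
        simp [Family.concat] at hb; omega
      have hl := length_blockOf hy' i.2
      simp only [alphaOfPreimages, always_seq, always_pair, always_hd, always_tl, always_nil,
        always_ite, hd_cons, tl_cons, ofBits_cons]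
      have key : ∀ w : Val, w = bit (if (i : ℕ) = 0 then c else false) →
          (divide.always (cons (tuple ys) (ofBits y)) fun a =>
            block.always (cons a (cons (num i) (ofBits y))) fun a =>
              innerProd.always (cons a (cons (ofBits z) (ofBits z'))) fun a =>
                xorBit.always (cons w a) fun a => cons (cons Val.nil Val.nil) a =
          (Info.bit (if (i : ℕ) = 0 then
            xor ((c :: y).headD false) (innerBits (F.block κ (c :: y) i) (xorBits z z'))
            else innerBits (F.block κ (c :: y) i) (xorBits z z'))).enc) := by
        rintro w rfl
        have hz := (Family.length_of_cons_mem h.left.1).1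
        have hz' := (Family.length_of_cons_mem h.right.1).1
        have hne : n κ ≠ 0 := by have := i.2; omega
        rw [always_divide (by simpa using hne) (m := F.l κ - 1) (by simpa using hy'),
          always_block hy' i.2, always_innerProd (by rw [hz, hl]) (by rw [hz', hl]),
          computes_xorBit.always_iff]
        have eb : F.block κ (c :: y) i = blockOf (F.l κ - 1) y i := rfl
        rw [eb]
        simp only [hd_cons, tl_cons, truth_bit, Info.enc, List.headD_cons]
        split_ifs <;> simp [show bit true = cons Val.nil Val.nil from rfl]
      by_cases h0 : (i : ℕ) = 0
      · rw [h0] at key ⊢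
        exact key _ rfl
      · rw [select_of_ne _ _ (by simpa using h0)]
        exact key _ (by simp [h0, bit])
  · rw [always_iff_of_eq (hF.always_sortedInvert_nil hT hk ht hy h), select_nil,
      Family.partAlphaLoc_of_not h]
    simp [Info.enc]

theorem IsHGHZCapable.always_concatInfo
    (hN : ∀ κ, N.always (num κ) (· = num (n κ))) (hF : IsHGHZCapable F H δ)
    (hT : F.LabelledTwins) {κ : ℕ}
    {ks ts ys : Fin (n κ) → Val} (hks : ∀ i, ks i ∈ F.K κ)
    (hts : ∀ i, F.IsTrapdoor κ (ks i) (ts i)) (hys : ∀ i, ys i ∈ F.Y κ) :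
    (concatInfo N H).always (cons (num κ) (cons (tuple ts) (tuple ys)))
      (· = tuple fun i => (F.partInfoLoc κ (ks i) (ys i)).enc) := by
  simp only [concatInfo, always_seq, always_pair, always_id, always_hd, hd_cons,
    always_iff_of_eq (hN κ)]
  refine always_tab_eq (by simp) fun i => ?_
  simp only [infoAt, always_seq, always_pair, always_hd, always_tl, hd_cons, tl_cons, always_nth,
    len_num, nth_tuple]
  have := hF.always_localInfo hT (y := tuple ys) (i := i) (hks i) (hts i) (by simpa using hys i)
  simpa only [nth_tuple, locInput] using this

end correctness

/-! ### Product states -/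

namespace QReg

/-- `QReg.uniformPart` as a linear map. -/
noncomputable def uniformL (names : List Val) (X : Set (List Bool)) : QReg →ₗ[ℂ] QReg :=
  Finsupp.linearCombination ℂ fun s : Finset Val =>
    if (names.map fun q => decide (q ∈ s)) ∈ X then
      (Finsupp.single (s \ names.toFinset) (1 / ((Real.sqrt (X.ncard : ℝ) : ℝ) : ℂ)) : QReg)
    else 0

theorem uniformPart_eq (names : List Val) (X : Set (List Bool)) (ψ : QReg) :
    uniformPart names X ψ = uniformL names X ψ := by
  rw [uniformPart, uniformL, Finsupp.linearCombination_apply]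
  refine Finsupp.sum_congr fun s _ => ?_
  split_ifs
  · rw [Finsupp.smul_single, smul_eq_mul, mul_one_div]
  · rw [smul_zero]

theorem uniformL_single (names : List Val) (X : Set (List Bool)) (s : Finset Val) (a : ℂ) :
    uniformL names X (Finsupp.single s a) =
      if (names.map fun q => decide (q ∈ s)) ∈ X then
        (Finsupp.single (s \ names.toFinset) (a / ((Real.sqrt (X.ncard : ℝ) : ℝ) : ℂ)) : QReg)
      else 0 := by
  rw [uniformL, Finsupp.linearCombination_single]
  split_ifs
  · rw [Finsupp.smul_single, smul_eq_mul, mul_one_div]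
  · rw [smul_zero]

/-- The qubits in `s` are none of the `ρ q`. -/
def Outside (ρ : Val → Val) (s : Finset Val) : Prop := ∀ q, ρ q ∉ s

/-- The register `χ`, with its qubits renamed by `ρ`, next to the basis state `s`. -/
noncomputable def place (ρ : Val → Val) (s : Finset Val) : QReg →ₗ[ℂ] QReg :=
  Finsupp.lmapDomain ℂ ℂ fun t => s ∪ t.image ρ

theorem place_single (ρ : Val → Val) (s t : Finset Val) (a : ℂ) :
    place ρ s (Finsupp.single t a) = Finsupp.single (s ∪ t.image ρ) a := by
  simp [place, Finsupp.lmapDomain_apply, Finsupp.mapDomain_single]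

theorem mem_place_iff {ρ : Val → Val} (hρ : Function.Injective ρ) {s : Finset Val}
    (hs : Outside ρ s) (q : Val) (t : Finset Val) : ρ q ∈ s ∪ t.image ρ ↔ q ∈ t := by
  simp only [Finset.mem_union, hs q, false_or, Finset.mem_image]
  exact ⟨fun ⟨x, hx, e⟩ => hρ e ▸ hx, fun h => ⟨q, h, rfl⟩⟩

theorem place_erase {ρ : Val → Val} (hρ : Function.Injective ρ) {s : Finset Val}
    (hs : Outside ρ s) (q : Val) (t : Finset Val) :
    (s ∪ t.image ρ).erase (ρ q) = s ∪ (t.erase q).image ρ := by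
  rw [Finset.erase_union_distrib, Finset.erase_eq_of_notMem (hs q), Finset.image_erase hρ]

theorem place_insert (ρ : Val → Val) (s : Finset Val) (q : Val) (t : Finset Val) :
    insert (ρ q) (s ∪ t.image ρ) = s ∪ (insert q t).image ρ := by
  rw [Finset.image_insert, Finset.union_insert]

/-- The product of `Ψ` and of the register `χ` with its qubits renamed by `ρ`. -/
noncomputable def tens (ρ : Val → Val) (χ : QReg) : QReg →ₗ[ℂ] QReg :=
  Finsupp.linearCombination ℂ fun s => place ρ s χ

theorem tens_apply (ρ : Val → Val) (χ Ψ : QReg) :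
    tens ρ χ Ψ = ∑ s ∈ Ψ.support, Ψ s • place ρ s χ := by
  rw [tens, Finsupp.linearCombination_apply, Finsupp.sum]

/-- A linear map is a product with `χ` if it is one on the basis states. -/
theorem map_eq_tens {L : QReg →ₗ[ℂ] QReg} {ρ : Val → Val} {χ Ψ : QReg}
    (h : ∀ s ∈ Ψ.support, L (Finsupp.single s 1) = place ρ s χ) : L Ψ = tens ρ χ Ψ := by
  conv_lhs => rw [← Finsupp.sum_single Ψ]
  rw [Finsupp.sum, map_sum, tens_apply]
  refine Finset.sum_congr rfl fun s hs => ?_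
  rw [← h s hs, ← map_smul, Finsupp.smul_single, smul_eq_mul, mul_one]

theorem tens_eq_sum (ρ : Val → Val) (χ Ψ : QReg) : tens ρ χ Ψ =
    ∑ p ∈ Ψ.support ×ˢ χ.support, Finsupp.single (p.1 ∪ p.2.image ρ) (Ψ p.1 * χ p.2) := by
  rw [tens_apply, Finset.sum_product]
  refine Finset.sum_congr rfl fun s _ => ?_
  conv_lhs => rw [← Finsupp.sum_single χ]
  rw [Finsupp.sum, map_sum, Finset.smul_sum]
  refine Finset.sum_congr rfl fun t _ => ?_
  rw [place_single, Finsupp.smul_single, smul_eq_mul]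

theorem normSq_tens {ρ : Val → Val} (hρ : Function.Injective ρ) (χ : QReg) {Ψ : QReg}
    (hΨ : ∀ s ∈ Ψ.support, Outside ρ s) : normSq (tens ρ χ Ψ) = normSq Ψ * normSq χ := by
  rw [tens_eq_sum, normSq_sum_single, normSq_eq_sum (Finset.Subset.refl Ψ.support),
    normSq_eq_sum (Finset.Subset.refl χ.support), Finset.sum_product, Finset.sum_mul_sum]
  · simp only [norm_mul, mul_pow]
  · rintro ⟨s, t⟩ hst ⟨s', t'⟩ hst' e
    simp only [Finset.coe_product, Set.mem_prod, Finset.mem_coe] at hst hst'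
    have hs := hΨ s hst.1
    have hs' := hΨ s' hst'.1
    simp only at e
    have ht : t = t' := by
      ext q
      rw [← mem_place_iff hρ hs q t, e, mem_place_iff hρ hs' q t']
    subst ht
    have hss : s = s' := by
      have hd : ∀ u, Outside ρ u → u = (u ∪ t.image ρ) \ t.image ρ := fun u hu => by
        rw [Finset.union_sdiff_right, Finset.sdiff_eq_self_of_disjoint]
        rw [Finset.disjoint_right]
        intro x hx
        obtain ⟨q, _, rfl⟩ := Finset.mem_image.1 hx
        exact hu q
      rw [hd s hs, e, ← hd s' hs']
    rw [hss]

theorem support_tens (ρ : Val → Val) (χ Ψ : QReg) : ∀ u ∈ (tens ρ χ Ψ).support,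
    ∃ s ∈ Ψ.support, ∃ t : Finset Val, u = s ∪ t.image ρ := by
  intro u hu
  rw [tens_eq_sum] at hu
  obtain ⟨p, hp, h⟩ := Finset.mem_biUnion.1 (Finsupp.support_finsetSum hu)
  exact ⟨p.1, (Finset.mem_product.1 hp).1, p.2,
    Finset.mem_singleton.1 (Finsupp.support_single_subset h)⟩

theorem append_mem_catSet {A B : Set (List Bool)} {m : ℕ} (hA : ∀ a ∈ A, a.length = m)
    {a b : List Bool} (ha : a.length = m) : a ++ b ∈ catSet A B ↔ a ∈ A ∧ b ∈ B := by
  constructor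
  · rintro ⟨⟨a', b'⟩, ⟨ha', hb'⟩, e⟩
    obtain ⟨rfl, rfl⟩ := List.append_inj e ((hA _ ha').trans ha.symm)
    exact ⟨ha', hb'⟩
  · exact fun ⟨h1, h2⟩ => ⟨(a, b), ⟨h1, h2⟩, rfl⟩

/-- The overlap of a product state with a uniform superposition over a product set factorizes. -/
theorem uniformL_tens {ρ : Val → Val} (hρ : Function.Injective ρ) (χ : QReg) {Ψ : QReg}
    (hΨ : ∀ s ∈ Ψ.support, Outside ρ s) {v w : List Val} (hw : ∀ q, ρ q ∉ w)
    {X Z : Set (List Bool)} (hX : ∀ x ∈ X, x.length = v.length) :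
    uniformL (v.map ρ ++ w) (catSet X Z) (tens ρ χ Ψ) =
      tens ρ (uniformL v X χ) (uniformL w Z Ψ) := by
  have key : ∀ s, Outside ρ s → uniformL (v.map ρ ++ w) (catSet X Z) (place ρ s χ) =
      tens ρ (uniformL v X χ) (uniformL w Z (Finsupp.single s 1)) := by
    intro s hs
    induction χ using Finsupp.induction_linear with
    | zero => simp [tens_apply]
    | add f g hf hg =>
      simp only [map_add, hf, hg]
      simp only [tens_apply, map_add, smul_add, Finset.sum_add_distrib]
    | single t a =>
      have hbits : ((v.map ρ ++ w).map fun q => decide (q ∈ s ∪ t.image ρ)) =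
          (v.map fun q => decide (q ∈ t)) ++ (w.map fun q => decide (q ∈ s)) := by
        rw [List.map_append, List.map_map]
        congr 1
        · exact List.map_congr_left fun q _ => by simp only [Function.comp, mem_place_iff hρ hs]
        · refine List.map_congr_left fun q hq => ?_
          have : q ∉ t.image ρ := fun h => by
            obtain ⟨x, _, rfl⟩ := Finset.mem_image.1 h
            exact hw x hq
          simp [this]
      have hset : (s ∪ t.image ρ) \ (v.map ρ ++ w).toFinset =
          (s \ w.toFinset) ∪ (t \ v.toFinset).image ρ := by
        ext x
        simp only [Finset.mem_sdiff, Finset.mem_union, List.mem_toFinset, List.mem_append,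
          List.mem_map, Finset.mem_image, not_or, not_exists, not_and]
        constructor
        · rintro ⟨h1 | ⟨q, hq, rfl⟩, h2, h3⟩
          · exact Or.inl ⟨h1, h3⟩
          · exact Or.inr ⟨q, ⟨hq, fun hv => h2 q hv rfl⟩, rfl⟩
        · rintro (⟨h1, h2⟩ | ⟨q, ⟨hq, hv⟩, rfl⟩)
          · exact ⟨Or.inl h1, fun q _ e => hs q (e ▸ h1), h2⟩
          · exact ⟨Or.inr ⟨q, hq, rfl⟩, fun q' hq' e => hv (hρ e ▸ hq'), hw q⟩
      rw [place_single, uniformL_single, uniformL_single, uniformL_single, hbits, hset,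
        append_mem_catSet hX (by simp), ncard_catSet hX]
      by_cases h1 : (v.map fun q => decide (q ∈ t)) ∈ X
      · by_cases h2 : (w.map fun q => decide (q ∈ s)) ∈ Z
        · rw [if_pos ⟨h1, h2⟩, if_pos h1, if_pos h2, tens, Finsupp.linearCombination_single,
            place_single, Finsupp.smul_single, smul_eq_mul]
          congr 1
          push_cast
          rw [Real.sqrt_mul (by positivity)]
          push_cast
          rw [div_mul_div_comm, one_mul, mul_comm ((√(Z.ncard : ℝ) : ℝ) : ℂ)]
        · rw [if_neg fun h => h2 h.2, if_neg h2, map_zero]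
      · rw [if_neg fun h => h1 h.1, if_neg h1]
        simp [tens_apply]
  conv_lhs => rw [tens_apply]
  rw [map_sum]
  conv_rhs => rw [← Finsupp.sum_single Ψ]
  rw [Finsupp.sum, map_sum, map_sum]
  refine Finset.sum_congr rfl fun s hs => ?_
  rw [map_smul, key s (hΨ s hs), ← map_smul, ← map_smul, Finsupp.smul_single, smul_eq_mul, mul_one]

/-- For a set of strings whose first bit is arbitrary, the overlap with the uniform superposition
arises by projecting the qubit of the first bit to `H |0⟩`. -/
theorem uniformL_cons (q : Val) (v : List Val) {X : Set (List Bool)}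
    (hX : ∀ b b' x, b :: x ∈ X → b' :: x ∈ X)
    (hc : X.ncard = 2 * {z | false :: z ∈ X}.ncard) (χ : QReg) :
    uniformL (q :: v) X χ =
      proj q false (hadamard q (uniformL v {z | false :: z ∈ X} χ)) := by
  rw [← projL_apply]
  induction χ using Finsupp.induction_linear with
  | zero => rw [map_zero, map_zero, map_zero, map_zero]
  | add f g hf hg => simp only [map_add, hf, hg]
  | single s a =>
    rw [uniformL_single, uniformL_single]
    have hm : (((q :: v).map fun q => decide (q ∈ s)) ∈ X) ↔
        (v.map fun q => decide (q ∈ s)) ∈ {z | false :: z ∈ X} :=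
      ⟨hX _ _ _, hX _ _ _⟩
    by_cases h : (v.map fun q => decide (q ∈ s)) ∈ {z | false :: z ∈ X}
    · rw [if_pos (hm.2 h), if_pos h, hadamard, Finsupp.linearCombination_single, map_smul, map_smul,
        map_add]
      have e1 : ∀ b : ℂ, projL q false (Finsupp.single ((s \ v.toFinset).erase q) b) =
          Finsupp.single ((s \ v.toFinset).erase q) b := fun b => by
        rw [projL_apply, proj, Finsupp.filter_single_of_pos]
        simp
      have e2 : ∀ b : ℂ, projL q false (Finsupp.single (insert q (s \ v.toFinset)) b) = 0 :=
        fun b => by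
          rw [projL_apply, proj, Finsupp.filter_single_of_neg]
          simp
      rw [e1, e2, add_zero, Finsupp.smul_single, Finsupp.smul_single]
      have e3 : s \ (q :: v).toFinset = (s \ v.toFinset).erase q := by
        rw [List.toFinset_cons]
        ext x
        simp only [Finset.mem_sdiff, Finset.mem_insert, Finset.mem_erase]
        tauto
      rw [e3, hc]
      congr 1
      push_cast
      rw [Real.sqrt_mul (by norm_num)]
      push_cast
      simp only [smul_eq_mul, mul_one, one_div]
      rw [div_mul_eq_div_div, div_right_comm, div_eq_mul_inv (a / _)]
    · rw [if_neg fun h' => h (hm.1 h'), if_neg h, map_zero, map_zero]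

/-- Dropping the qubit of the first bit does not decrease the overlap. -/
theorem normSq_uniformL_cons_le (q : Val) (v : List Val) {X : Set (List Bool)}
    (hX : ∀ b b' x, b :: x ∈ X → b' :: x ∈ X)
    (hc : X.ncard = 2 * {z | false :: z ∈ X}.ncard) (χ : QReg) :
    normSq (uniformL (q :: v) X χ) ≤ normSq (uniformL v {z | false :: z ∈ X} χ) := by
  rw [uniformL_cons q v hX hc]
  calc _ ≤ normSq (hadamard q (uniformL v {z | false :: z ∈ X} χ)) := by
        rw [← normSq_proj q (hadamard q _)]
        exact le_add_of_nonneg_right (normSq_nonneg _)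
    _ = _ := normSq_hadamard _ _

end QReg

namespace Prog
open QReg Branch

/-- A program acts on its own qubits only. -/
theorem op_place {ρ : Val → Val} (hρ : Function.Injective ρ) {s : Finset Val} (hs : Outside ρ s)
    (p : Prog) : ∀ v, ∀ b ∈ p.br v, ∀ (σ : Val → Val) (χ : QReg),
      b.op (fun q => ρ (σ q)) (place ρ s χ) = place ρ s (b.op σ χ) := by
  have ext : ∀ {L M : QReg →ₗ[ℂ] QReg}, (∀ t, L (Finsupp.single t 1) = M (Finsupp.single t 1)) →
      L = M := fun h => Finsupp.lhom_ext' fun t => LinearMap.ext_ring (h t)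
  have lift : ∀ {L M : QReg →ₗ[ℂ] QReg}, (∀ t, L (place ρ s (Finsupp.single t 1)) =
      place ρ s (M (Finsupp.single t 1))) → ∀ χ, L (place ρ s χ) = place ρ s (M χ) := by
    intro L M h χ
    exact LinearMap.congr_fun (ext (L := L.comp (place ρ s)) (M := (place ρ s).comp M) h) χ
  induction p with
  | id | nil | hd | tl | flip => simp [br, step]
  | had =>
    intro v b hb σ
    simp only [br, List.mem_singleton] at hb
    subst hb
    refine lift fun t => ?_
    simp only [place_single, hadamard, Finsupp.linearCombination_single, map_smul, map_add,
      mem_place_iff hρ hs, place_erase hρ hs, place_insert]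
  | tee =>
    intro v b hb σ
    simp only [br, List.mem_singleton] at hb
    subst hb
    refine lift fun t => ?_
    simp only [place_single, tGate, Finsupp.linearCombination_single, map_smul,
      mem_place_iff hρ hs]
  | cnot =>
    intro v b hb σ
    simp only [br, List.mem_singleton] at hb
    subst hb
    refine lift fun t => ?_
    simp only [place_single, QReg.cnot, Finsupp.linearCombination_single, map_smul,
      mem_place_iff hρ hs, place_erase hρ hs, place_insert, hρ.ne_iff]
    congr 2
    split_ifs <;> rfl
  | meas =>
    intro v b hb σ
    simp only [br, List.mem_cons, List.not_mem_nil, or_false] at hb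
    have key : ∀ c : Bool, ∀ χ, projL (ρ (σ v)) c (place ρ s χ) = place ρ s (projL (σ v) c χ) := by
      intro c
      refine lift fun t => ?_
      simp only [place_single, projL_apply, proj]
      by_cases h : (σ v ∈ t ↔ c = true)
      · rw [Finsupp.filter_single_of_pos (p := fun s => σ v ∈ s ↔ c = true) h,
          Finsupp.filter_single_of_pos, place_single]
        rwa [mem_place_iff hρ hs]
      · rw [Finsupp.filter_single_of_neg (p := fun s => σ v ∈ s ↔ c = true) h,
          Finsupp.filter_single_of_neg, map_zero]
        rwa [mem_place_iff hρ hs]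
    rcases hb with rfl | rfl <;> exact key _
  | pair p q hp hq | seq p q hp hq =>
    intro v b hb σ χ
    simp only [br, List.mem_flatMap, List.mem_map] at hb
    obtain ⟨b, hb, c, hc, rfl⟩ := hb
    simp [comp, step, hp _ b hb, hq _ c hc]
  | ite p q r hp hq hr =>
    intro v b hb σ χ
    simp only [br, List.mem_flatMap, List.mem_map] at hb
    obtain ⟨b, hb, c, hc, rfl⟩ := hb
    split_ifs at hc
    · simp [comp, step, hp _ b hb, hr _ c hc]
    · simp [comp, step, hp _ b hb, hq _ c hc]
  | loop p hp =>
    intro v b hb σ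
    rw [br_loop] at hb
    obtain ⟨c, hc, rfl⟩ := List.mem_map.1 hb
    suffices h : ∀ m w, ∀ c ∈ p.brIter m w, ∀ χ,
        c.op (fun q => ρ (σ q)) (place ρ s χ) = place ρ s (c.op σ χ) by
      simpa [comp, step] using h _ _ c hc
    intro m
    induction m with
    | zero => simp [brIter, step]
    | succ m ih =>
      intro w c hc χ
      simp only [brIter, List.mem_flatMap, List.mem_map] at hc
      obtain ⟨b, hb, c, hc, rfl⟩ := hc
      simp [comp, hp _ b hb, ih _ c hc]
  | _ p hp =>
    intro v b hb σ χ
    simp only [br, List.mem_map] at hb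
    obtain ⟨b, hb, rfl⟩ := hb
    exact hp _ b hb _ χ

/-- A program that runs in a scope which is still in the zero state produces a product state. -/
theorem expect_scope {ρ : Val → Val} (hρ : Function.Injective ρ) (p : Prog) (v : Val) {Ψ : QReg}
    (hΨ : ∀ s ∈ Ψ.support, Outside ρ s) (g : Val → QReg → ℝ) :
    p.expect ρ v Ψ g = p.expect (fun q => q) v zeroState fun w χ => g w (tens ρ χ Ψ) := by
  unfold expect
  congr 1
  refine List.map_congr_left fun b hb => ?_
  congr 2
  refine map_eq_tens fun s hs => ?_
  have h := op_place hρ (hΨ s hs) p v b hb (fun q => q) zeroState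
  rwa [zeroState, place_single, Finset.image_empty, Finset.union_empty] at h

end Prog

/-! ### Preparing the uniform superposition over the concatenated domain -/

section
open QReg

/-- A partial inner product introduces no qubits. -/
theorem QReg.support_uniformL (v : List Val) (X : Set (List Bool)) (ψ : QReg) :
    ∀ u ∈ (uniformL v X ψ).support, ∃ s ∈ ψ.support, u ⊆ s := by
  intro u hu
  rw [uniformL, Finsupp.linearCombination_apply] at hu
  obtain ⟨s, hs, h⟩ := Finset.mem_biUnion.1 (Finsupp.support_finsetSum hu)
  refine ⟨s, hs, ?_⟩
  have h' := Finsupp.support_smul h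
  split_ifs at h'
  · rw [Finset.mem_singleton.1 (Finsupp.support_single_subset h')]
    exact Finset.sdiff_subset
  · simp at h'

theorem QReg.uniformL_empty (v : List Val) (ψ : QReg) : uniformL v ∅ ψ = 0 := by
  simp [uniformL, Finsupp.linearCombination_apply]

/-- The qubits that belong to one of the scopes `m`, `m + 1`, …. -/
def InScopes (m : ℕ) (x : Val) : Prop := ∃ j, m ≤ j ∧ ∃ q, x = cons (num j) q

theorem num_injective : Function.Injective num := fun a b h => by
  rw [← len_num a, h, len_num]

theorem InScopes.ne {m : ℕ} {x : Val} (h : InScopes (m + 1) x) (q : Val) : cons (num m) q ≠ x := by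
  rintro rfl
  obtain ⟨j, hj, q', e⟩ := h
  have := num_injective (Val.cons.inj e).1
  omega

theorem InScopes.mono {m : ℕ} {x : Val} (h : InScopes (m + 1) x) : InScopes m x := by
  obtain ⟨j, hj, h⟩ := h
  exact ⟨j, by omega, h⟩

namespace Prog

theorem expect_nonneg {ρ : Val → Val} {p : Prog} {v : Val} {ψ : QReg} {g : Val → QReg → ℝ}
    (h : ∀ w φ, 0 ≤ g w φ) : 0 ≤ p.expect ρ v ψ g :=
  List.sum_nonneg fun x hx => by
    obtain ⟨b, hb, rfl⟩ := List.mem_map.1 hx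
    exact mul_nonneg (wt_nonneg p v b hb) (h _ _)

/-- On input `(a, v)`, the qubits of the list `v` moved to the scope `a`, without the first one
unless `a` is `nil`. -/
def scopeNames : Prog :=
  pair hd (pair id tl ⨟ tab (pair (hd ⨟ hd) (pair (hd ⨟ tl) tl ⨟ nth))) ⨟ ite hd (tl ⨟ tl) tl

theorem computes_scopeNames : scopeNames.Computes fun v =>
    select v.hd (ofList (v.tl.toList.map (cons v.hd))).tl (ofList (v.tl.toList.map (cons v.hd))) :=
  ((computes_hd.pair ((computes_id.pair computes_tl).seq (Computes.tab
    ((computes_hd.seq computes_hd).pair (((computes_hd.seq computes_tl).pair computes_tl).seq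
      computes_nth))))).seq (computes_hd.ite (computes_tl.seq computes_tl) computes_tl)).congr
    fun v => by
      simp [toList_eq_map_nth v.tl, Function.comp_def]

/-- On input `(x, a)`, run `S` on `x` in the scope `a`. -/
def runInScope (S : Prog) : Prog := pair tl hd ⨟ pair hd (Prog.scoped S) ⨟ scopeNames

/-- On input `(x, (a, acc))`, prepend to `acc` the qubits obtained by running `S` on `x` in the
scope `a`, without the first one unless `a` is `nil`. -/
def concatSuperposeBody (S : Prog) : Prog := pair (onPair (runInScope S)) (tl ⨟ tl) ⨟ append

/-- Run `S` in the scopes `1^0`, …, `1^(n - 1)`; of the qubits that hold the first bit, only the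
one in the scope `1^0` is kept. -/
def concatSuperpose (N S : Prog) : Prog := pair id (pair N nil) ⨟ fold (concatSuperposeBody S)

theorem qpt_runInScope {S : Prog} (hS : S.QPT) : (runInScope S).QPT :=
  qpt_seq (qpt_pair qpt_tl qpt_hd) (qpt_seq (qpt_pair qpt_hd (qpt_scoped hS))
    computes_scopeNames.ppt.2)

theorem qpt_concatSuperpose {N S : Prog} (hN : N.QPT) (hS : S.QPT) : (concatSuperpose N S).QPT := by
  refine qpt_seq (qpt_pair qpt_id (qpt_pair hN qpt_nil)) (qpt_fold (qpt_seq (qpt_pair (qpt_seq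
    (qpt_pair qpt_hd (qpt_seq qpt_tl qpt_hd)) (qpt_runInScope hS)) (qpt_seq qpt_tl qpt_tl))
      computes_append.ppt.2) ?_)
  obtain ⟨P, hP⟩ := (qpt_runInScope hS).size_le
  refine ⟨P.comp (1 + Polynomial.X), fun v => ?_⟩
  simp only [concatSuperposeBody, onPair, always_pair, always_seq, always_hd, always_tl,
    computes_append.always_iff, hd_cons, tl_cons]
  refine always_mono (hP (cons v.hd v.tl.hd)) fun w hw => ?_
  have := size_ofList_append w v.tl.tl
  have h : 1 + v.hd.size + v.tl.hd.size = 1 + (v.hd.size + v.tl.hd.size) := by omega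
  rw [size_cons, h] at hw
  simp [Polynomial.eval_comp]
  omega

/-- A run in a scope that is not yet in use multiplies the state by the state that `S` prepares. -/
theorem expect_concatSuperposeBody (S : Prog) (x acc : Val) (i : ℕ) {ψ : QReg}
    (hψ : ∀ s ∈ ψ.support, Outside (cons (num i)) s) (g : Val → QReg → ℝ) :
    (concatSuperposeBody S).expect (fun q => q) (cons x (cons (num i) acc)) ψ g =
      S.expect (fun q => q) x zeroState fun v χ =>
        g (ofList ((if i = 0 then v.toList.map (cons (num i)) else
          (v.toList.map (cons (num i))).tail) ++ acc.toList)) (tens (cons (num i)) χ ψ) := by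
  have e : ∀ v : Val, (select (num i) (ofList (v.toList.map (cons (num i)))).tl
      (ofList (v.toList.map (cons (num i))))).toList =
      if i = 0 then v.toList.map (cons (num i)) else (v.toList.map (cons (num i))).tail := by
    intro v
    cases i with
    | zero => simp [num_zero]
    | succ i => cases v <;> simp [num_succ]
  simp only [concatSuperposeBody, onPair, runInScope, expect_seq, expect_pair, expect_hd, expect_tl,
    expect_scoped, computes_append.expect_eq, computes_scopeNames.expect_eq, hd_cons, tl_cons, e]
  rw [expect_scope (fun a b h => (Val.cons.inj h).2) S x hψ]

variable {F : Family fun _ => 1} {n : ℕ → ℕ}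

/-- The squared overlap of the register with the uniform superposition over `X κ`, provided that
`v` is a list of distinct qubits, as many as the strings have bits. -/
noncomputable def overlap {n : ℕ → ℕ} (F : Family n) (κ : ℕ) (v : Val) (φ : QReg) : ℝ :=
  if v.toList.Nodup ∧ v.len = F.l κ then normSq (uniformL v.toList (F.X κ) φ) else 0

theorem overlap_nonneg {n : ℕ → ℕ} (F : Family n) (κ : ℕ) (v : Val) (φ : QReg) :
    0 ≤ overlap F κ v φ := by
  unfold overlap
  split_ifs
  exacts [normSq_nonneg _, le_rfl]

/-- The concatenated domain is the product of `X` and `n κ - 1` copies of `X` without the first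
bit. -/
theorem concat_X_eq (hT : F.LabelledTwins) {κ : ℕ} (hX : (F.X κ).Nonempty) {r : ℕ}
    (hr : n κ = r + 1) : (F.concat n).X κ =
      catSet (F.X κ) (blockSet (F.l κ - 1) (fun _ => {z | false :: z ∈ F.X κ}) r) := by
  obtain ⟨x₀, hx₀⟩ := hX
  have hl : ∀ c, ∀ a ∈ {z | c :: z ∈ F.X κ}, a.length = F.l κ - 1 := fun c a ha =>
    (Family.length_of_cons_mem ha).1
  have hb : ∀ c : Bool, {z | c :: z ∈ F.X κ} = {z | false :: z ∈ F.X κ} := fun c => by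
    ext z
    exact ⟨hT.label κ _ _ z, hT.label κ _ _ z⟩
  ext x
  cases x with
  | nil =>
    constructor
    · intro h
      obtain ⟨c, y, e, _⟩ := Family.exists_cons_of_mem_concat h
      cases e
    · rintro ⟨⟨a, b⟩, ⟨ha, _⟩, e⟩
      exact absurd (List.append_eq_nil_iff.1 e).1 (hT.ne_nil κ a ha)
  | cons c y =>
    rw [Family.cons_mem_concat_iff, hr, blockSet_succ (hl c), hb c]
    constructor
    · rintro ⟨⟨a, b⟩, ⟨ha, hb⟩, rfl⟩
      exact ⟨(c :: a, b), ⟨hT.label κ _ _ a ha, hb⟩, rfl⟩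
    · rintro ⟨⟨a, b⟩, ⟨ha, hb⟩, e⟩
      cases a with
      | nil => exact absurd rfl (hT.ne_nil κ _ ha)
      | cons c' a =>
        cases e
        exact ⟨(a, b), ⟨hT.label κ _ _ a ha, hb⟩, rfl⟩

/-- Running `S` in the `m + 1` scopes that are left multiplies the overlap of the register at least
by the `m + 1`-st power of the overlap that `S` attains. The `r` runs that are done have left the
qubits `w`, without those of their first bits. -/
theorem pow_mul_le_expect_fold (hT : F.LabelledTwins) (S : Prog) {κ : ℕ} (hX : (F.X κ).Nonempty)
    (m : ℕ) : ∀ r, n κ = m + 1 + r → ∀ (w : List Val) (Ψ : QReg), w.Nodup →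
      w.length = r * (F.l κ - 1) → (∀ x ∈ w, InScopes (m + 1) x) →
      (∀ s ∈ Ψ.support, ∀ x ∈ s, InScopes (m + 1) x) →
      (S.expect (fun q => q) (num κ) zeroState (overlap F κ)) ^ (m + 1) *
        normSq (uniformL w (blockSet (F.l κ - 1) (fun _ => {z | false :: z ∈ F.X κ}) r) Ψ) ≤
      (fold (concatSuperposeBody S)).expect (fun q => q)
        (cons (num κ) (cons (num (m + 1)) (ofList w))) Ψ (overlap (F.concat n) κ) := by
  have hl : 1 ≤ F.l κ := by
    obtain ⟨x, hx⟩ := hX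
    have := hT.ne_nil κ x hx
    rw [← F.X_length κ x hx]
    exact List.length_pos_of_ne_nil this
  have inj : ∀ i, Function.Injective (cons (num i)) := fun i a b h => (Val.cons.inj h).2
  have hlen : ∀ a ∈ {z | false :: z ∈ F.X κ}, a.length = F.l κ - 1 := fun a ha =>
    (Family.length_of_cons_mem ha).1
  induction m with
  | zero =>
    intro r hr w Ψ hw hwl hwS hΨ
    have hout : ∀ s ∈ Ψ.support, Outside (cons (num 0)) s := fun s hs q hq =>
      (hΨ s hs _ hq).ne q rfl
    have hwout : ∀ q, cons (num 0) q ∉ w := fun q hq => (hwS _ hq).ne q rfl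
    rw [zero_add, num_succ, expect_fold_cons, expect_concatSuperposeBody S _ _ _ hout, pow_one,
      mul_comm, ← expect_mul_left]
    refine expect_mono fun v χ => ?_
    simp only [num_zero, expect_fold_nil, if_true]
    rw [← num_zero, toList_ofList]
    by_cases hv : v.toList.Nodup ∧ v.len = F.l κ
    · have hlen' : ∀ x ∈ F.X κ, x.length = v.toList.length := fun x hx =>
        (F.X_length κ x hx).trans hv.2.symm
      rw [overlap, overlap, if_pos hv, if_pos, toList_ofList,
        concat_X_eq hT hX (by omega : n κ = r + 1),
        uniformL_tens (inj 0) χ hout hwout hlen', normSq_tens (inj 0)]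
      · intro u hu q hq
        obtain ⟨s, hs, hus⟩ := support_uniformL _ _ _ u hu
        exact hout s hs q (hus hq)
      · rw [toList_ofList]
        refine ⟨List.Nodup.append (hv.1.map (inj 0)) hw ?_, ?_⟩
        · intro x hx hx'
          obtain ⟨q, _, rfl⟩ := List.mem_map.1 hx
          exact hwout q hx'
        · have h1 : v.toList.length = F.l κ := hv.2
          have h2 : (F.concat n).l κ = 1 + n κ * (F.l κ - 1) := rfl
          rw [h2, hr]
          simp only [len_ofList, List.length_append, List.length_map, h1, hwl]
          have : (0 + 1 + r) * (F.l κ - 1) = (F.l κ - 1) + r * (F.l κ - 1) := by ring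
          omega
    · rw [overlap, if_neg hv, mul_zero]
      exact overlap_nonneg _ _ _ _
  | succ m ih =>
    intro r hr w Ψ hw hwl hwS hΨ
    have hout : ∀ s ∈ Ψ.support, Outside (cons (num (m + 1))) s := fun s hs q hq =>
      (hΨ s hs _ hq).ne q rfl
    have hwout : ∀ q, cons (num (m + 1)) q ∉ w := fun q hq => (hwS _ hq).ne q rfl
    rw [num_succ (m + 1), expect_fold_cons, expect_concatSuperposeBody S _ _ _ hout, pow_succ,
      mul_right_comm, ← expect_mul_left]
    refine expect_mono fun v χ => ?_
    rw [toList_ofList, if_neg (by omega)]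
    by_cases hv : v.toList.Nodup ∧ v.len = F.l κ
    · obtain ⟨q, u, hu⟩ : ∃ q u, v.toList = q :: u := by
        cases hv' : v.toList with
        | nil =>
          have h2 := hv.2
          simp only [len, hv', List.length_nil] at h2
          omega
        | cons q u => exact ⟨q, u, rfl⟩
      have hv1 := hv.1
      have hv2 : v.toList.length = F.l κ := hv.2
      rw [hu] at hv1 hv2
      have hul : u.length = F.l κ - 1 := by
        simp only [List.length_cons] at hv2
        omega
      have hstep := ih (r + 1) (by omega) (u.map (cons (num (m + 1))) ++ w)
        (tens (cons (num (m + 1))) χ Ψ) ?_ ?_ ?_ ?_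
      · rw [hu, List.map_cons, List.tail_cons]
        refine le_trans ?_ hstep
        rw [blockSet_succ hlen, uniformL_tens (inj _) χ hout hwout
          (fun x hx => (hlen x hx).trans hul.symm), normSq_tens (inj _), mul_assoc]
        · refine mul_le_mul_of_nonneg_left ?_ (pow_nonneg (expect_nonneg (overlap_nonneg F κ)) _)
          refine mul_le_mul_of_nonneg_left ?_ (normSq_nonneg _)
          rw [overlap, if_pos hv, hu]
          exact normSq_uniformL_cons_le q u (fun b b' x => hT.label κ b b' x) (hT.ncard_X κ false) χ
        · intro s hs q hq
          obtain ⟨s', hs', hss⟩ := support_uniformL _ _ _ s hs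
          exact hout s' hs' q (hss hq)
      · refine List.Nodup.append ((List.nodup_cons.1 hv1).2.map (inj _)) hw fun x hx hx' => ?_
        obtain ⟨q, _, rfl⟩ := List.mem_map.1 hx
        exact hwout q hx'
      · simp only [List.length_append, List.length_map, hul, hwl]
        ring
      · intro x hx
        rcases List.mem_append.1 hx with h | h
        · obtain ⟨q, _, rfl⟩ := List.mem_map.1 h
          exact ⟨m + 1, le_rfl, q, rfl⟩
        · exact (hwS x h).mono
      · intro s hs x hx
        obtain ⟨s', hs', t, rfl⟩ := support_tens _ _ _ s hs
        rcases Finset.mem_union.1 hx with h | h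
        · exact (hΨ s' hs' x h).mono
        · obtain ⟨q, _, rfl⟩ := Finset.mem_image.1 h
          exact ⟨m + 1, le_rfl, q, rfl⟩
    · rw [overlap, if_neg hv, mul_zero]
      exact expect_nonneg (overlap_nonneg _ _)

/-- `overlap` is the fidelity in the definition of a capable family. -/
theorem total_overlap {n : ℕ → ℕ} (F : Family n) (S : Prog) (κ : ℕ) :
    (S.total (Conf.start (num κ) zeroState) fun c =>
      if c.val.toList.Nodup ∧ c.val.len = F.l κ then
        c.wt * normSq (uniformPart c.val.toList (F.X κ) c.reg)
      else 0) = S.expect (fun q => q) (num κ) zeroState (overlap F κ) := by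
  rw [total_eq S _ _ (overlap F κ)]
  · simp [Conf.start]
  · intro c
    simp only [overlap, uniformPart_eq, mul_ite, mul_zero]

/-- The fidelity for the concatenated domain is at least the `n κ`-th power of the given one. -/
theorem overlap_le {N S : Prog} (hN : N.PPT) (hNn : ∀ κ, N.always (num κ) (· = num (n κ)))
    (hT : F.LabelledTwins) {κ : ℕ} (hn : 1 ≤ n κ) :
    (S.expect (fun q => q) (num κ) zeroState (overlap F κ)) ^ n κ ≤
      (concatSuperpose N S).expect (fun q => q) (num κ) zeroState (overlap (F.concat n) κ) := by
  by_cases hX : (F.X κ).Nonempty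
  · obtain ⟨m, hm⟩ : ∃ m, n κ = m + 1 := ⟨n κ - 1, by omega⟩
    have h := pow_mul_le_expect_fold hT S hX m 0 (by omega) [] zeroState List.nodup_nil (by simp)
      (by simp) (by
        intro s hs x hx
        rw [Finset.mem_singleton.1 (Finsupp.support_single_subset hs)] at hx
        simp at hx)
    simp only [concatSuperpose, expect_seq, expect_pair, expect_id, expect_nil,
      hN.1.expect_of_always (hNn κ), hm]
    refine le_trans (le_of_eq ?_) h
    simp [zeroState, uniformL_single, blockSet_zero]
  · have e : ∀ v φ, overlap F κ v φ = 0 := fun v φ => by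
      rw [overlap, Set.not_nonempty_iff_eq_empty.1 hX, uniformL_empty]
      simp
    have h0 : S.expect (fun q => q) (num κ) zeroState (overlap F κ) = 0 := by
      simp [expect, e]
    rw [h0, zero_pow (by omega)]
    exact expect_nonneg (overlap_nonneg _ _)

end Prog
end

/-! ### The distribution of the keys and of the partial information -/

theorem Negligible.mono {μ ν : ℕ → ℝ} (hμ : Negligible μ) (h : ∀ κ, |ν κ| ≤ |μ κ|) :
    Negligible ν :=
  Asymptotics.SuperpolynomialDecay.trans_abs_le hμ fun κ => h κ

/-- A negligible function stays negligible when multiplied by a polynomially bounded one. -/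
theorem Negligible.natCast_mul {μ : ℕ → ℝ} (hμ : Negligible μ) {n : ℕ → ℕ} {P : Polynomial ℕ}
    (hP : ∀ κ, n κ ≤ P.eval κ) : Negligible fun κ => (n κ : ℝ) * μ κ := by
  have h : Negligible fun κ => (P.map (Nat.castRingHom ℝ)).eval (κ : ℝ) * μ κ :=
    Asymptotics.SuperpolynomialDecay.polynomial_mul hμ _
  refine h.mono fun κ => ?_
  rw [abs_mul, abs_mul, Polynomial.eval_natCast_map]
  refine mul_le_mul_of_nonneg_right ?_ (abs_nonneg _)
  simp only [Nat.abs_cast, eq_natCast]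
  exact_mod_cast hP κ

/-- Bernoulli's inequality. It needs no upper bound on `μ`, since the left side is negative for
`μ > 1`. -/
theorem one_sub_mul_le_pow {μ f : ℝ} (hf : 0 ≤ f) (h : 1 - μ ≤ f) {n : ℕ} (hn : 1 ≤ n) :
    1 - n * μ ≤ f ^ n := by
  by_cases hμ : μ ≤ 1
  · calc 1 - n * μ = 1 + n * (-μ) := by ring
      _ ≤ (1 + -μ) ^ n := one_add_mul_le_pow (by linarith) n
      _ ≤ f ^ n := pow_le_pow_left₀ (by linarith) (by linarith) n
  · have : (1 : ℝ) ≤ n := by exact_mod_cast hn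
    have : 0 ≤ f ^ n := by positivity
    nlinarith

theorem PolyTimeComputable.exists_polynomial {n : ℕ → ℕ} (hn : PolyTimeComputable n) :
    ∃ P : Polynomial ℕ, ∀ κ, n κ ≤ P.eval κ := by
  obtain ⟨N, hN, hNn⟩ := hn
  obtain ⟨P, hP⟩ := hN.2.size_le
  refine ⟨P.comp (2 * Polynomial.X + 1), fun κ => ?_⟩
  have h := (Prog.always_iff_of_eq ((Prog.outputs_iff _ _ _).1 (hNn κ)) _).1 (hP (num κ))
  rw [size_num, size_num] at h
  simp [Polynomial.eval_comp]
  omega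

theorem ofList_range_eq_tuple_iff {m : ℕ} (f : ℕ → Val) (v : Fin m → Val) :
    ofList ((List.range m).map f) = tuple v ↔ ∀ i : Fin m, f i = v i := by
  rw [← tuple_eq, tuple_injective.eq_iff, funext_iff]

theorem genInput_one (κ : ℕ) (b : Bool) :
    genInput κ (fun _ : Fin 1 => b) = cons (num κ) (cons (bit b) Val.nil) := by
  simp [genInput]

theorem nth_ofBits_ofFn {m : ℕ} (d : Fin m → Bool) (i : Fin m) :
    (ofBits (List.ofFn d)).nth i = bit (d i) := by
  rw [Prog.ofBits_ofFn, nth_tuple]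

namespace Prog

theorem Computes.mean_seq {p q : Prog} {f : Val → Val} (hp : p.Computes f) (hq : q.Classical)
    (v : Val) (φ : Val → ℝ) : (p ⨟ q).mean v φ = q.mean (f v) φ := by
  have h : (p ⨟ q).Classical := ⟨hp.ppt.1, hq⟩
  rw [← h.expect_eq (fun q => q) v 0 fun w _ => φ w, expect_seq, hp.expect_eq, hq.expect_eq]

theorem Computes.meanPi_seq {p q : Prog} {f : Val → Val} (hp : p.Computes f) (hq : q.Classical)
    (x : ℕ → Val) (n : ℕ) (φ : (ℕ → Val) → ℝ) :
    (p ⨟ q).meanPi x n φ = q.meanPi (fun i => f (x i)) n φ := by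
  induction n generalizing φ with
  | zero => rfl
  | succ n ih => simp only [meanPi, hp.mean_seq hq, ih]

theorem meanPi_mono {p : Prog} {x : ℕ → Val} {n : ℕ} {φ φ' : (ℕ → Val) → ℝ}
    (h : ∀ ws, φ ws ≤ φ' ws) : p.meanPi x n φ ≤ p.meanPi x n φ' := by
  induction n generalizing φ φ' with
  | zero => exact h _
  | succ n ih => exact mean_mono fun w => ih fun ws => h _

/-- The probability that independent samples have given properties. -/
theorem meanPi_indicator (p : Prog) (x : ℕ → Val) {n : ℕ} (S : Fin n → Val → Prop) :
    p.meanPi x n (fun ws => if ∀ i : Fin n, S i (ws i) then 1 else 0) =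
      ∏ i : Fin n, p.mean (x i) fun w => if S i w then 1 else 0 := by
  have h := meanPi_prod p x n fun i w => if ∀ hi : i < n, S ⟨i, hi⟩ w then 1 else 0
  rw [Finset.prod_range] at h
  simp only [Finset.prod_ite_zero, Finset.prod_const_one, Fin.is_lt, forall_true_left] at h
  rw [← h]
  congr 1
  ext ws
  congr 1
  exact propext ⟨fun h i hi hin => h ⟨i, hin⟩, fun h i => h i (Finset.mem_range.2 i.2) i.2⟩

/-- The keys are generated by independent runs of the local generation. -/
theorem expect_concatGen {gen : Prog} (hg : gen.Classical) (ρ : Val → Val) (κ D : Val) (ψ : QReg)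
    (g : Val → QReg → ℝ) : (concatGen gen).expect ρ (cons κ D) ψ g =
      gen.meanPi (fun i => cons κ (cons (D.nth i) Val.nil)) D.len fun ws =>
        g (cons (ofList ((List.range D.len).map fun i => (ws i).hd))
          (ofList ((List.range D.len).map fun i => (ws i).tl))) ψ := by
  have hc := (computes_hd.seq computes_hd).pair
    ((((computes_hd.seq computes_tl).pair computes_tl).seq computes_nth).pair computes_nil)
  have hcl : (genAt gen).Classical := ⟨hc.ppt.1, hg⟩
  simp only [concatGen, expect_seq, expect_pair, expect_id, expect_tl, hcl.expect_tab,
    computes_hd.map.expect_eq, computes_tl.map.expect_eq]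
  rw [genAt, hc.meanPi_seq hg]
  simp [Function.comp_def]

theorem mean_concatGen {gen : Prog} (hg : gen.PPT) (κ : ℕ) {m : ℕ} (d : Fin m → Bool)
    (φ : Val → ℝ) : (concatGen gen).mean (genInput κ d) φ =
      gen.meanPi (fun i => cons (num κ) (cons ((ofBits (List.ofFn d)).nth i) Val.nil)) m fun ws =>
        φ (cons (ofList ((List.range m).map fun i => (ws i).hd))
          (ofList ((List.range m).map fun i => (ws i).tl))) := by
  rw [← (ppt_concatGen hg).1.expect_eq (fun q => q) _ 0 fun w _ => φ w, genInput,
    expect_concatGen hg.1]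
  simp

/-- `Gen` has the distribution of independent runs of `Gen_Loc`. -/
theorem prob_concatGen {gen : Prog} (hg : gen.PPT) (κ : ℕ) {m : ℕ} (d : Fin m → Bool)
    (ks ts : Fin m → Val) :
    (concatGen gen).prob (genInput κ d) (fun v => v.hd = tuple ks ∧ v.tl = tuple ts) =
      ∏ i : Fin m, gen.prob (genInput κ (fun _ : Fin 1 => d i)) fun v =>
        v.hd = ks i ∧ v.tl = ts i := by
  simp only [(ppt_concatGen hg).1.prob_eq, hg.1.prob_eq]
  rw [mean_concatGen hg]
  simp only [hd_cons, tl_cons, ofList_range_eq_tuple_iff, ← forall_and]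
  have h := meanPi_indicator gen
    (fun i => cons (num κ) (cons ((ofBits (List.ofFn d)).nth i) Val.nil))
    fun (i : Fin m) w => w.hd = ks i ∧ w.tl = ts i
  simp only [nth_ofBits_ofFn, ← genInput_one] at h
  convert h

/-- If local properties of keys and trapdoors imply a property of the tuples, the latter is at least
as likely as that all independent local runs succeed. -/
theorem prod_prob_le_prob_concatGen {gen : Prog} (hg : gen.PPT) (κ : ℕ) {m : ℕ} (d : Fin m → Bool)
    (S : Fin m → Val → Prop) (T : Val → Prop)
    (h : ∀ ws : Fin m → Val, (∀ i, S i (ws i)) →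
      T (cons (tuple fun i => (ws i).hd) (tuple fun i => (ws i).tl))) :
    ∏ i : Fin m, gen.prob (genInput κ (fun _ : Fin 1 => d i)) (S i) ≤
      (concatGen gen).prob (genInput κ d) T := by
  simp only [(ppt_concatGen hg).1.prob_eq, hg.1.prob_eq]
  rw [mean_concatGen hg]
  calc _ = gen.meanPi (fun i => cons (num κ) (cons ((ofBits (List.ofFn d)).nth i) Val.nil)) m
        fun ws => if ∀ i : Fin m, S i (ws i) then 1 else 0 := by
        rw [meanPi_indicator]
        simp only [nth_ofBits_ofFn, genInput_one]
    _ ≤ _ := by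
        refine meanPi_mono fun ws => ?_
        split_ifs with h1 h2 h2
        · exact le_rfl
        · refine absurd ?_ h2
          rw [← tuple_eq fun i => (ws i).hd, ← tuple_eq fun i => (ws i).tl]
          exact h _ h1
        · exact zero_le_one
        · exact le_rfl

theorem always_concatGen {gen : Prog} (κ : ℕ) {m : ℕ} (d : Fin m → Bool)
    {R : Fin m → Val → Prop}
    (h : ∀ i, gen.always (genInput κ (fun _ : Fin 1 => d i)) (R i)) :
    (concatGen gen).always (genInput κ d) fun v => ∃ ws : Fin m → Val, (∀ i, R i (ws i)) ∧
      v = cons (tuple fun i => (ws i).hd) (tuple fun i => (ws i).tl) := by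
  simp only [concatGen, genInput, always_seq, always_pair, always_id, always_tl,
    computes_hd.map.always_iff, computes_tl.map.always_iff]
  refine always_mono (always_tab_tuple (N := m) (R := R) (by simp) fun i => ?_) ?_
  · simp only [genAt, always_seq, always_pair, always_hd, always_tl, always_nil, always_nth,
      hd_cons, tl_cons, len_num, nth_ofBits_ofFn]
    rw [← genInput_one]
    exact h i
  · rintro _ ⟨ws, hws, rfl⟩
    refine ⟨ws, hws, ?_⟩
    simp [tuple, List.map_ofFn, Function.comp_def]

/-- `PartInfo` has the distribution of independent runs of `PartInfo_Loc`. -/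
theorem prob_concatInfo {N : Prog} {H : Algorithms} {n : ℕ → ℕ} (hN : N.PPT)
    (hNn : ∀ κ, N.always (num κ) (· = num (n κ))) (hL : (localInfo H).PPT) (κ : ℕ)
    (ts vs : Fin (n κ) → Val) (y : Val) :
    (concatInfo N H).prob (cons (num κ) (cons (tuple ts) y)) (fun w => w = tuple vs) =
      ∏ i : Fin (n κ), (localInfo H).prob (locInput κ i (ts i) y) fun w => w = vs i := by
  have hc := (computes_hd.seq computes_hd).pair (computes_tl.pair
    ((((computes_hd.seq (computes_tl.seq computes_hd)).pair computes_tl).seq computes_nth).pair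
      (computes_hd.seq (computes_tl.seq computes_tl))))
  have hcl : (infoAt H).Classical := ⟨hc.ppt.1, hL.1⟩
  have hP := ppt_concatInfo hN hL
  simp only [hP.1.prob_eq, hL.1.prob_eq]
  rw [← hP.1.expect_eq (fun q => q) _ 0 fun w _ => if w = tuple vs then 1 else 0]
  simp only [concatInfo, expect_seq, expect_pair, expect_id, expect_hd, hd_cons,
    hN.1.expect_of_always (hNn κ), hcl.expect_tab, tl_cons, len_num, ofList_range_eq_tuple_iff]
  rw [infoAt, hc.meanPi_seq hL.1, meanPi_indicator _ _ fun i w => w = vs i]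
  refine Finset.prod_congr rfl fun i _ => ?_
  simp [locInput]

end Prog

/-! ### The games as expectations -/

/-- The event that the guess `w` is the bit `b`, weighted with the norm of the final register. -/
noncomputable def hit (b : Bool) (w : Val) (ψ : QReg) : ℝ :=
  if w.truth = b then QReg.normSq ψ else 0

theorem hit_nonneg (b : Bool) (w : Val) (ψ : QReg) : 0 ≤ hit b w ψ := by
  unfold hit
  split_ifs
  exacts [QReg.normSq_nonneg _, le_rfl]

/-- The two guesses exhaust the final norm. -/
theorem hit_add (w : Val) (ψ : QReg) : hit false w ψ + hit true w ψ = QReg.normSq ψ := by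
  unfold hit
  cases w.truth <;> simp

/-- `GHZ.leak`, for a set given as a list of bits. -/
noncomputable def leakList (m : ℕ) (M v : Val) : Val :=
  ofList (((List.range m).filter fun i => (M.nth i).truth).map fun i => cons (num i) (v.nth i))

theorem leak_eq_leakList (m : ℕ) (M v : Val) :
    leak (fun i : Fin m => (M.nth i).truth) v = leakList m M v := by
  unfold leak leakList
  congr 1
  rw [← List.map_coe_finRange_eq_range, List.filter_map, List.map_map]
  simp [List.map_eq_flatMap, Function.comp_def, List.flatMap_assoc]

namespace Prog

/-- The value of the game `IND-D0` for the advice `s`, `ψ₀`. -/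
noncomputable def indD0Value (gen A₁ A₂ : Prog) (m κ : ℕ) (s : Val) (ψ₀ : QReg) : ℝ :=
  A₁.expect (fun q => q) (cons (num κ) s) ψ₀ fun u ψ =>
    ∑ b : Bool, 1 / 2 * gen.expect (fun q => q)
      (genInput κ fun i : Fin m => ((if b then u.hd.tl else u.hd.hd).nth i).truth) ψ fun kt φ =>
        A₂.expect (fun q => q) (cons u.tl kt.hd) φ (hit b)

theorem indD0_eq (n : ℕ → ℕ) (gen : Prog) (a : Advice) (A₁ A₂ : Prog) (κ : ℕ) :
    indD0 n gen a A₁ A₂ κ = indD0Value gen A₁ A₂ (n κ) κ (a.str κ) (a.reg κ) := by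
  rw [indD0, total_eq A₁ _ _ (fun u ψ => _)]
  · simp only [Conf.start, one_mul]
    rfl
  intro c₁
  rw [Finset.mul_sum]
  refine Finset.sum_congr rfl fun b _ => ?_
  rw [total_eq gen _ _ fun kt φ => A₂.expect (fun q => q) (cons c₁.val.tl kt.hd) φ (hit b)]
  · ring
  intro c₂
  rw [total_eq A₂ _ _ (hit b)]
  intro c₃
  simp only [hit, Conf.weight, mul_ite, mul_zero]

/-- The stages of the game `IND-PARTIAL` after the generation of the keys `ks` with the
trapdoors `ts`. -/
noncomputable def lastStages (partInfo A₂ A₃ : Prog) (m κ : ℕ) (M st : Val) (ψ : QReg)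
    (g : Val → QReg → ℝ) (ks ts : Val) : ℝ :=
  A₂.expect (fun q => q) (cons st ks) ψ fun y χ =>
    partInfo.expect (fun q => q) (cons (num κ) (cons ts y.hd)) χ fun v χ' =>
      A₃.expect (fun q => q) (cons y.tl (leakList m M v)) χ' g

theorem indPartial_eq (n : ℕ → ℕ) (gen partInfo : Prog) (a : Advice) (A₁ A₂ A₃ : Prog) (κ : ℕ) :
    indPartial n gen partInfo a A₁ A₂ A₃ κ =
      A₁.expect (fun q => q) (cons (num κ) (a.str κ)) (a.reg κ) fun u ψ =>
        if ∃ i : Fin (n κ), (u.hd.hd.nth i).truth = true ∧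
            (u.hd.tl.hd.nth i).truth ≠ (u.hd.tl.tl.nth i).truth then 0
        else ∑ b : Bool, 1 / 2 * gen.expect (fun q => q)
          (genInput κ fun i : Fin (n κ) =>
            ((if b then u.hd.tl.tl else u.hd.tl.hd).nth i).truth) ψ fun kt φ =>
              lastStages partInfo A₂ A₃ (n κ) κ u.hd.hd u.tl φ (hit b) kt.hd kt.tl := by
  rw [indPartial, total_eq A₁ _ _ (fun u ψ => _)]
  · simp only [Conf.start, one_mul]
    rfl
  intro c₁
  simp only [mul_ite, mul_zero]
  refine if_congr Iff.rfl rfl ?_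
  rw [Finset.mul_sum]
  refine Finset.sum_congr rfl fun b _ => ?_
  rw [total_eq gen _ _ fun kt φ =>
    lastStages partInfo A₂ A₃ (n κ) κ c₁.val.hd.hd c₁.val.tl φ (hit b) kt.hd kt.tl]
  · ring
  intro c₂
  rw [lastStages, total_eq A₂ _ _ (fun y χ => _)]
  intro c₃
  rw [total_eq partInfo _ _ (fun v χ => _)]
  intro c₄
  rw [leak_eq_leakList, total_eq A₃ _ _ (hit b)]
  intro c₅
  simp only [hit, Conf.weight, mul_ite, mul_zero]

theorem lastStages_nonneg (partInfo A₂ A₃ : Prog) (m κ : ℕ) (M st : Val) (ψ : QReg) (b : Bool)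
    (ks ts : Val) : 0 ≤ lastStages partInfo A₂ A₃ m κ M st ψ (hit b) ks ts :=
  expect_nonneg fun _ _ => expect_nonneg fun _ _ => expect_nonneg (hit_nonneg b)

/-- The probabilities of both guesses sum up to the norm before the last stages. -/
theorem lastStages_add (partInfo A₂ A₃ : Prog) (m κ : ℕ) (M st : Val) (ψ : QReg) (ks ts : Val) :
    lastStages partInfo A₂ A₃ m κ M st ψ (hit false) ks ts +
      lastStages partInfo A₂ A₃ m κ M st ψ (hit true) ks ts = QReg.normSq ψ := by
  simp only [lastStages, ← expect_add, hit_add, expect_normSq]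

/-! ### The hybrid adversary -/

/-- The input, read as a bit, in the standard encoding of bits. -/
def toBit : Prog := ite id (pair nil nil) nil

theorem computes_toBit : toBit.Computes fun v => bit v.truth :=
  (computes_id.ite (computes_nil.pair computes_nil) computes_nil).congr fun v => by
    cases v <;> simp [bit]

/-- The bits of the `j`-th hybrid: those of `d₁` at the positions before `j` outside `M`, and those
of `d₀` elsewhere. -/
noncomputable def hybrid (M d₀ d₁ : Val) (j i : ℕ) : Bool :=
  if i < j ∧ (M.nth i).truth = false then (d₁.nth i).truth else (d₀.nth i).truth

/-- On input `(((1^m, (1^κ, 1^j)), u), 1^i)`, for an output `u = ((M, (d₀, d₁)), state)` of `A₁`,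
the `i`-th bit of the `j`-th hybrid. -/
def hybridBit : Prog :=
  ite (ite (pair tl (hd ⨟ hd ⨟ tl ⨟ tl) ⨟ drop)
      (ite (pair (hd ⨟ tl ⨟ hd ⨟ hd) tl ⨟ nth) nil (pair nil nil)) nil)
    (pair (hd ⨟ tl ⨟ hd ⨟ tl ⨟ tl) tl ⨟ nth ⨟ toBit)
    (pair (hd ⨟ tl ⨟ hd ⨟ tl ⨟ hd) tl ⨟ nth ⨟ toBit)

/-- On input `((1^m, (1^κ, 1^j)), u)`, for an output `u` of `A₁`, the string of the bits of the
`j`-th hybrid. -/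
def hybridBits : Prog := pair id (hd ⨟ hd) ⨟ tab hybridBit

theorem computes_hybridBits : ∃ f, hybridBits.Computes f ∧ ∀ (m j : ℕ) (κ u : Val),
    f (cons (cons (num m) (cons κ (num j))) u) =
      ofList ((List.range m).map fun i => bit (hybrid u.hd.hd u.hd.tl.hd u.hd.tl.tl j i)) := by
  refine ⟨_, (computes_id.pair (computes_hd.seq computes_hd)).seq (Computes.tab
    ((((computes_tl.pair (computes_hd.seq (computes_hd.seq (computes_tl.seq computes_tl)))).seq
      computes_drop).ite ((((computes_hd.seq (computes_tl.seq (computes_hd.seq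
        computes_hd))).pair computes_tl).seq computes_nth).ite computes_nil
          (computes_nil.pair computes_nil)) computes_nil).ite
      (((computes_hd.seq (computes_tl.seq (computes_hd.seq (computes_tl.seq computes_tl)))).pair
        computes_tl).seq (computes_nth.seq computes_toBit))
      (((computes_hd.seq (computes_tl.seq (computes_hd.seq (computes_tl.seq computes_hd)))).pair
        computes_tl).seq (computes_nth.seq computes_toBit)))), fun m j κ u => ?_⟩
  simp only [hd_cons, tl_cons, len_num, drop_num]
  congr 1
  refine List.map_congr_left fun i _ => ?_
  unfold hybrid
  by_cases h : i < j
  · rw [select_of_ne (c := num (j - i)) _ _ (by simpa using by omega)]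
    cases u.hd.hd.nth i <;> simp [h]
  · rw [show j - i = 0 by omega]
    simp [h, num_zero]

/-- On input `((1^j, k), l)`, the list `l` with `k` in place of its `j`-th entry. -/
def replaceEntry : Prog :=
  pair id tl ⨟ tab (ite (pair tl (hd ⨟ hd ⨟ hd) ⨟ drop) (pair (hd ⨟ tl) tl ⨟ nth)
    (ite (pair (hd ⨟ hd ⨟ hd) tl ⨟ drop) (pair (hd ⨟ tl) tl ⨟ nth) (hd ⨟ hd ⨟ tl)))

theorem computes_replaceEntry : ∃ f, replaceEntry.Computes f ∧ ∀ (j : ℕ) (k l : Val),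
    f (cons (cons (num j) k) l) =
      ofList ((List.range l.len).map fun i => if i = j then k else l.nth i) := by
  refine ⟨_, (computes_id.pair computes_tl).seq (Computes.tab (((computes_tl.pair
    (computes_hd.seq (computes_hd.seq computes_hd))).seq computes_drop).ite
      (((computes_hd.seq computes_tl).pair computes_tl).seq computes_nth)
        ((((computes_hd.seq (computes_hd.seq computes_hd)).pair computes_tl).seq computes_drop).ite
          (((computes_hd.seq computes_tl).pair computes_tl).seq computes_nth)
            (computes_hd.seq (computes_hd.seq computes_tl))))), fun j k l => ?_⟩
  simp only [hd_cons, tl_cons, len_num, drop_num]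
  congr 1
  refine List.map_congr_left fun i _ => ?_
  rcases lt_trichotomy i j with h | rfl | h
  · rw [select_of_ne (c := num (j - i)) _ _ (by simpa using by omega), if_neg h.ne]
  · simp [num_zero]
  · rw [show j - i = 0 by omega, num_zero, select_nil,
      select_of_ne (c := num (i - j)) _ _ (by simpa using by omega), if_neg h.ne']

/-- On input `(1^m, (M, v))`, the entries `v[i]` for `i ∈ M`. -/
def leakEntries : Prog :=
  pair tl (pair hd nil) ⨟ fold (ite (pair (hd ⨟ hd) (tl ⨟ hd) ⨟ nth)
    (pair (pair (tl ⨟ hd) (pair (hd ⨟ tl) (tl ⨟ hd) ⨟ nth)) (tl ⨟ tl)) (tl ⨟ tl))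

theorem computes_leakEntries : ∃ f, leakEntries.Computes f ∧ ∀ (m : ℕ) (M v : Val),
    f (cons (num m) (cons M v)) = leakList m M v := by
  refine ⟨_, (computes_tl.pair (computes_hd.pair computes_nil)).seq
    (((((computes_hd.seq computes_hd).pair (computes_tl.seq computes_hd)).seq computes_nth).ite
      (((computes_tl.seq computes_hd).pair (((computes_hd.seq computes_tl).pair
        (computes_tl.seq computes_hd)).seq computes_nth)).pair (computes_tl.seq computes_tl))
          (computes_tl.seq computes_tl)).fold ⟨2 + 2 * Polynomial.X, fun v => ?_⟩),
      fun m M v => ?_⟩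
  · have h1 := v.hd.tl.size_nth_le v.tl.hd.len
    have h2 := v.hd.size_tl_le
    have h3 : ∀ c a b : Val, (select c a b).size ≤ a.size ∨ (select c a b).size ≤ b.size := by
      rintro (_ | _) a b <;> simp
    refine (h3 _ _ _).elim (fun h => h.trans ?_) fun h => h.trans ?_ <;> (simp; try omega)
  · simp only [hd_cons, tl_cons]
    suffices h : ∀ acc, foldFn (fun w => select (w.hd.hd.nth w.tl.hd.len)
        (cons (cons w.tl.hd (w.hd.tl.nth w.tl.hd.len)) w.tl.tl) w.tl.tl) (cons M v) (num m) acc =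
        ofList (((List.range m).filter fun i => (M.nth i).truth).map
          (fun i => cons (num i) (v.nth i)) ++ acc.toList) by
      simpa [leakList] using h Val.nil
    induction m with
    | zero => intro acc; simp [num_zero, foldFn]
    | succ m ih =>
      intro acc
      simp only [num_succ, foldFn, hd_cons, tl_cons, len_num, ih, List.range_succ,
        List.filter_append, List.map_append, List.append_assoc]
      cases h : M.nth m <;> simp [h]

/-- The first stage of the hybrid adversary: run `A₁` and challenge on the `j`-th bits. The index
`j` is part of the advice. -/
def hybridA₁ (N A₁ : Prog) : Prog :=
  pair (pair (hd ⨟ N) (pair hd (tl ⨟ hd))) (pair hd (tl ⨟ tl) ⨟ A₁) ⨟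
    pair (pair (pair (pair (tl ⨟ hd ⨟ tl ⨟ hd) (hd ⨟ tl ⨟ tl) ⨟ nth) nil)
      (pair (pair (tl ⨟ hd ⨟ tl ⨟ tl) (hd ⨟ tl ⨟ tl) ⨟ nth) nil)) id

/-- The second stage, if `j ∉ M`: generate the keys for the hybrid bits, put the challenge at the
`j`-th place, and play the rest of the game. The `j`-th trapdoor, which does not fit to the
challenge, has no influence on the entries in `M`. -/
def hybridRun (gen partInfo A₂ A₃ : Prog) : Prog :=
  pair id (pair (hd ⨟ hd ⨟ tl ⨟ hd) (hd ⨟ hybridBits) ⨟ concatGen gen) ⨟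
  pair (pair (hd ⨟ hd) (tl ⨟ tl)) (pair (hd ⨟ hd ⨟ tl ⨟ tl)
    (pair (pair (hd ⨟ hd ⨟ hd ⨟ tl ⨟ tl) (hd ⨟ tl)) (tl ⨟ hd) ⨟ replaceEntry) ⨟ A₂) ⨟
  pair id (pair (hd ⨟ hd ⨟ hd ⨟ tl ⨟ hd) (pair (hd ⨟ tl) (tl ⨟ hd)) ⨟ partInfo) ⨟
  pair (hd ⨟ tl ⨟ tl) (pair (hd ⨟ hd ⨟ hd ⨟ hd ⨟ hd) (pair (hd ⨟ hd ⨟ hd ⨟ tl ⨟ hd ⨟ hd) tl) ⨟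
    leakEntries) ⨟ A₃

/-- The second stage of the hybrid adversary. For `j ∈ M` the two challenges are the same bit unless
the attacked adversary has lost, and the guess is always `0`. -/
def hybridA₂ (gen partInfo A₂ A₃ : Prog) : Prog :=
  ite (hd ⨟ pair (tl ⨟ hd ⨟ hd) (hd ⨟ tl ⨟ tl) ⨟ nth) nil (hybridRun gen partInfo A₂ A₃)

theorem qpt_hybridA₁ {N A₁ : Prog} (hN : N.QPT) (h : A₁.QPT) : (hybridA₁ N A₁).QPT := by
  have := computes_nth.ppt.2
  unfold hybridA₁
  repeat' (with_reducible (first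
    | assumption | exact qpt_hd | exact qpt_tl | exact qpt_nil | exact qpt_id
    | apply qpt_pair | apply qpt_seq))

theorem qpt_hybridA₂ {gen partInfo A₂ A₃ : Prog} (h1 : gen.PPT) (h2 : partInfo.QPT) (h3 : A₂.QPT)
    (h4 : A₃.QPT) : (hybridA₂ gen partInfo A₂ A₃).QPT := by
  have := computes_nth.ppt.2
  have := computes_hybridBits.choose_spec.1.ppt.2
  have := computes_replaceEntry.choose_spec.1.ppt.2
  have := computes_leakEntries.choose_spec.1.ppt.2
  have := (ppt_concatGen h1).2
  unfold hybridA₂ hybridRun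
  repeat' (with_reducible (first
    | assumption | exact qpt_hd | exact qpt_tl | exact qpt_nil | exact qpt_id
    | apply qpt_pair | apply qpt_ite | apply qpt_seq))

/-- The inputs of the local key generations for the bits `e`. -/
def localInputs (κ : ℕ) (e : ℕ → Bool) (i : ℕ) : Val := cons (num κ) (cons (bit (e i)) Val.nil)

/-- The last stages of the game `IND-PARTIAL` on the outputs of the local key generations. -/
noncomputable def lastStagesOf (partInfo A₂ A₃ : Prog) (m κ : ℕ) (M st : Val) (ψ : QReg) (b : Bool)
    (ws : ℕ → Val) : ℝ :=
  lastStages partInfo A₂ A₃ m κ M st ψ (hit b) (ofList ((List.range m).map fun i => (ws i).hd))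
    (ofList ((List.range m).map fun i => (ws i).tl))

/-- The hybrid adversary simulates the last stages of `IND-PARTIAL` on the keys for the `j`-th
hybrid, with the challenge `k` in place of the `j`-th key. -/
theorem expect_hybridRun {gen : Prog} (hg : gen.Classical) (partInfo A₂ A₃ : Prog) (m κ j : ℕ)
    (u k : Val) (ψ : QReg) (g : Val → QReg → ℝ) :
    (hybridRun gen partInfo A₂ A₃).expect (fun q => q)
      (cons (cons (cons (num m) (cons (num κ) (num j))) u) k) ψ g =
    gen.meanPi (localInputs κ (hybrid u.hd.hd u.hd.tl.hd u.hd.tl.tl j)) m fun ws =>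
      lastStages partInfo A₂ A₃ m κ u.hd.hd u.tl ψ g
        (ofList ((List.range m).map fun i => if i = j then k else (ws i).hd))
        (ofList ((List.range m).map fun i => (ws i).tl)) := by
  obtain ⟨f, hf, hf'⟩ := computes_hybridBits
  obtain ⟨f₁, hf₁, hf₁'⟩ := computes_replaceEntry
  obtain ⟨f₂, hf₂, hf₂'⟩ := computes_leakEntries
  simp only [hybridRun, expect_seq, expect_pair, expect_id, expect_hd, expect_tl, hd_cons, tl_cons,
    hf.expect_eq, hf', hf₁.expect_eq, hf₁', hf₂.expect_eq, hf₂', expect_concatGen hg, len_ofList,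
    List.length_map, List.length_range]
  rw [meanPi_congr gen (x' := localInputs κ (hybrid u.hd.hd u.hd.tl.hd u.hd.tl.tl j))
    (fun i hi => by simp [nth_ofList, localInputs, hi])]
  congr 1
  ext ws
  unfold lastStages
  congr 3
  refine List.map_congr_left fun i hi => ?_
  rw [List.mem_range] at hi
  simp [nth_ofList, hi]

end Prog

namespace Prog

theorem lastStagesOf_add (partInfo A₂ A₃ : Prog) (m κ : ℕ) (M st : Val) (ψ : QReg)
    (ws : ℕ → Val) : lastStagesOf partInfo A₂ A₃ m κ M st ψ false ws +
      lastStagesOf partInfo A₂ A₃ m κ M st ψ true ws = QReg.normSq ψ :=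
  lastStages_add ..

variable {n : ℕ → ℕ} {N : Prog} {H : Algorithms}

theorem expect_concatInfo (hN : N.PPT) (hNn : ∀ κ, N.always (num κ) (· = num (n κ)))
    (hL : (localInfo H).PPT) (κ : ℕ) (T y : Val) (ψ : QReg) (g : Val → QReg → ℝ) :
    (concatInfo N H).expect (fun q => q) (cons (num κ) (cons T y)) ψ g =
      (localInfo H).meanPi (fun i => locInput κ i (T.nth i) y) (n κ) fun vs =>
        g (ofList ((List.range (n κ)).map vs)) ψ := by
  have hc := (computes_hd.seq computes_hd).pair (computes_tl.pair
    ((((computes_hd.seq (computes_tl.seq computes_hd)).pair computes_tl).seq computes_nth).pair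
      (computes_hd.seq (computes_tl.seq computes_tl))))
  have hcl : (infoAt H).Classical := ⟨hc.ppt.1, hL.1⟩
  simp only [concatInfo, expect_seq, expect_pair, expect_id, expect_hd, hd_cons,
    hN.1.expect_of_always (hNn κ), hcl.expect_tab, tl_cons, len_num]
  rw [infoAt, hc.meanPi_seq hL.1]
  simp [locInput]

/-- The leaked information does not contain the entries outside `M`. -/
theorem leakList_update {m j : ℕ} {M : Val} (hj : (M.nth j).truth = false) (vs : ℕ → Val)
    (w : Val) : leakList m M (ofList ((List.range m).map (Function.update vs j w))) =
      leakList m M (ofList ((List.range m).map vs)) := by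
  unfold leakList
  congr 1
  refine List.map_congr_left fun i hi => ?_
  obtain ⟨h1, h2⟩ := List.mem_filter.1 hi
  have hij : i ≠ j := by
    rintro rfl
    simp [hj] at h2
  simp [nth_ofList, List.mem_range.1 h1, Function.update_of_ne hij]

/-- A trapdoor at a position outside `M` has no influence on the rest of the game. -/
theorem lastStages_congr (hN : N.PPT) (hNn : ∀ κ, N.always (num κ) (· = num (n κ)))
    (hL : (localInfo H).PPT) (A₂ A₃ : Prog) {κ j : ℕ} (hj : j < n κ) {M : Val}
    (hM : (M.nth j).truth = false) (st : Val) (ψ : QReg) (g : Val → QReg → ℝ) (ks : Val)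
    (ts : ℕ → Val) (t : Val) :
    lastStages (concatInfo N H) A₂ A₃ (n κ) κ M st ψ g ks (ofList ((List.range (n κ)).map ts)) =
      lastStages (concatInfo N H) A₂ A₃ (n κ) κ M st ψ g ks
        (ofList ((List.range (n κ)).map (Function.update ts j t))) := by
  unfold lastStages
  refine expect_congr fun b _ χ => ?_
  rw [expect_concatInfo hN hNn hL, expect_concatInfo hN hNn hL,
    ← hL.1.meanPi_update_of_ignores _ hj (locInput κ j t b.val.hd)]
  · refine meanPi_congr _ (fun i hi => ?_) _
    by_cases hij : i = j
    · subst hij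
      simp [nth_ofList, hi]
    · simp [Function.update_of_ne hij, nth_ofList, hi]
  · intro ws w
    rw [leakList_update hM]

/-- The hybrid adversary interpolates between two consecutive hybrids. -/
theorem sum_expect_hybridA₂ {gen : Prog} (hg : gen.PPT) (hN : N.PPT)
    (hNn : ∀ κ, N.always (num κ) (· = num (n κ))) (hL : (localInfo H).PPT) (A₂ A₃ : Prog)
    {κ j : ℕ} (hj : j < n κ) (u : Val) (ψ : QReg) :
    ∑ b : Bool, gen.expect (fun q => q) (cons (num κ)
      (cons (bit ((if b then u.hd.tl.tl else u.hd.tl.hd).nth j).truth) Val.nil)) ψ (fun kt φ =>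
        (hybridA₂ gen (concatInfo N H) A₂ A₃).expect (fun q => q)
          (cons (cons (cons (num (n κ)) (cons (num κ) (num j))) u) kt.hd) φ (hit b)) =
    gen.meanPi (localInputs κ (hybrid u.hd.hd u.hd.tl.hd u.hd.tl.tl j)) (n κ)
        (lastStagesOf (concatInfo N H) A₂ A₃ (n κ) κ u.hd.hd u.tl ψ false) +
      gen.meanPi (localInputs κ (hybrid u.hd.hd u.hd.tl.hd u.hd.tl.tl (j + 1))) (n κ)
        (lastStagesOf (concatInfo N H) A₂ A₃ (n κ) κ u.hd.hd u.tl ψ true) := by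
  simp only [hybridA₂, expect_ite, expect_seq, expect_pair, expect_hd, expect_tl, hd_cons, tl_cons,
    computes_nth.expect_eq, expect_nil, len_num, hg.1.expect_eq, expect_hybridRun hg.1]
  generalize u.hd.hd = M
  generalize u.hd.tl.hd = d₀
  generalize u.hd.tl.tl = d₁
  generalize u.tl = st
  have hsel : ∀ c : Val, c.truth = true → c ≠ Val.nil := fun c h e => by simp [e] at h
  -- If `j ∈ M`, the hybrids `j` and `j + 1` agree, and on both sides the two values of `b` share
  -- the norm of the register.
  by_cases hM : (M.nth j).truth = true
  · have he : hybrid M d₀ d₁ (j + 1) = hybrid M d₀ d₁ j := by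
      ext i
      unfold hybrid
      refine if_congr ⟨fun ⟨h1, h2⟩ => ⟨?_, h2⟩, fun ⟨h1, h2⟩ => ⟨by omega, h2⟩⟩ rfl rfl
      rcases Nat.lt_succ_iff_lt_or_eq.1 h1 with h | rfl
      · exact h
      · rw [hM] at h2
        cases h2
    rw [he, ← meanPi_add]
    simp only [lastStagesOf_add, select_of_ne _ _ (hsel _ hM), hg.1.mean_const, hg.1.meanPi_const]
    simp [hit]
  · rw [Bool.not_eq_true] at hM
    have hnil : M.nth j = Val.nil := by
      cases h : M.nth j with
      | nil => rfl
      | cons a b => simp [h] at hM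
    simp only [hnil, select_nil]
    have key : ∀ b : Bool, gen.mean
        (cons (num κ) (cons (bit ((if b then d₁ else d₀).nth j).truth) Val.nil)) (fun kt =>
          gen.meanPi (localInputs κ (hybrid M d₀ d₁ j)) (n κ) fun ws =>
            lastStages (concatInfo N H) A₂ A₃ (n κ) κ M st ψ (hit b)
              (ofList ((List.range (n κ)).map fun i => if i = j then kt.hd else (ws i).hd))
              (ofList ((List.range (n κ)).map fun i => (ws i).tl))) =
        gen.meanPi (localInputs κ (hybrid M d₀ d₁ (if b then j + 1 else j))) (n κ)
          (lastStagesOf (concatInfo N H) A₂ A₃ (n κ) κ M st ψ b) := by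
      intro b
      rw [← meanPi_mean_comm]
      have hx : localInputs κ (hybrid M d₀ d₁ (if b then j + 1 else j)) =
          Function.update (localInputs κ (hybrid M d₀ d₁ j)) j
            (cons (num κ) (cons (bit ((if b then d₁ else d₀).nth j).truth) Val.nil)) := by
        ext i
        by_cases hi : i = j
        · subst hi
          rw [Function.update_self]
          cases b <;> simp [localInputs, hybrid, hM]
        · rw [Function.update_of_ne hi]
          cases b
          · rfl
          · have : i < j + 1 ↔ i < j := by omega
            simp [localInputs, hybrid, this]
      -- The challenge is a fresh sample in the place of the `j`-th one; its trapdoor may be put in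
      -- the place of the `j`-th trapdoor as well.
      rw [hx, ← hg.1.meanPi_update _ hj]
      refine congrArg (gen.meanPi _ _) (funext fun ws =>
        congrArg (gen.mean _) (funext fun kt => ?_))
      rw [lastStages_congr hN hNn hL A₂ A₃ hj hM _ _ _ _ _ kt.tl, lastStagesOf]
      congr 2
      · refine List.map_congr_left fun i _ => ?_
        by_cases hi : i = j
        · subst hi; simp
        · simp [hi]
      · refine List.map_congr_left fun i _ => ?_
        by_cases hi : i = j
        · subst hi; simp
        · simp [hi]
    rw [Fintype.sum_bool, key true, key false, add_comm]
    simp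

/-- The telescoping sum over the hybrids. -/
theorem indPartial_le_sum {gen : Prog} (hg : gen.PPT) (hN : N.PPT)
    (hNn : ∀ κ, N.always (num κ) (· = num (n κ))) (hL : (localInfo H).PPT) (a : Advice)
    (A₁ A₂ A₃ : Prog) (κ : ℕ) :
    indPartial n (concatGen gen) (concatInfo N H) a A₁ A₂ A₃ κ + ((n κ : ℝ) - 1) / 2 ≤
      ∑ j ∈ Finset.range (n κ), indD0Value gen (hybridA₁ N A₁) (hybridA₂ gen (concatInfo N H) A₂ A₃)
        1 κ (cons (num j) (a.str κ)) (a.reg κ) := by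
  have hcl := hg.1
  have hcG := (ppt_concatGen hg).1
  rw [indPartial_eq]
  have e1 : ((n κ : ℝ) - 1) / 2 = A₁.expect (fun q => q) (cons (num κ) (a.str κ)) (a.reg κ)
      fun _ ψ => ((n κ : ℝ) - 1) / 2 * QReg.normSq ψ := by
    rw [expect_mul_left, expect_normSq, a.reg_unit, mul_one]
  rw [e1, ← expect_add]
  have e2 : ∀ j ∈ Finset.range (n κ), indD0Value gen (hybridA₁ N A₁)
      (hybridA₂ gen (concatInfo N H) A₂ A₃) 1 κ (cons (num j) (a.str κ)) (a.reg κ) =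
      A₁.expect (fun q => q) (cons (num κ) (a.str κ)) (a.reg κ) fun u ψ => 1 / 2 *
        (gen.meanPi (localInputs κ (hybrid u.hd.hd u.hd.tl.hd u.hd.tl.tl j)) (n κ)
          (lastStagesOf (concatInfo N H) A₂ A₃ (n κ) κ u.hd.hd u.tl ψ false) +
        gen.meanPi (localInputs κ (hybrid u.hd.hd u.hd.tl.hd u.hd.tl.tl (j + 1))) (n κ)
          (lastStagesOf (concatInfo N H) A₂ A₃ (n κ) κ u.hd.hd u.tl ψ true)) := by
    intro j hj
    simp only [indD0Value, hybridA₁, expect_seq, expect_pair, expect_hd, expect_tl, expect_id,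
      expect_nil, hd_cons, tl_cons, hN.1.expect_of_always (hNn κ), computes_nth.expect_eq, len_num]
    refine expect_congr fun c _ ψ => ?_
    rw [← Finset.mul_sum, ← sum_expect_hybridA₂ hg hN hNn hL A₂ A₃ (Finset.mem_range.1 hj)]
    rfl
  rw [Finset.sum_congr rfl e2, ← expect_sum]
  refine expect_mono fun u ψ => ?_
  rw [← Finset.mul_sum (Finset.range (n κ))]
  set M := u.hd.hd
  set d₀ := u.hd.tl.hd
  set d₁ := u.hd.tl.tl
  -- The (unnormalized) probability that the adversary guesses `b`, given the keys of the
  -- `j`-th hybrid.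
  set p : Bool → ℕ → ℝ := fun b j => gen.meanPi (localInputs κ (hybrid M d₀ d₁ j)) (n κ)
    (lastStagesOf (concatInfo N H) A₂ A₃ (n κ) κ M u.tl ψ b) with hp
  have hW : ∀ j, p false j + p true j = QReg.normSq ψ := fun j => by
    simp only [hp]
    rw [← meanPi_add]
    simp only [lastStagesOf_add, hcl.meanPi_const]
  have hp0 : ∀ b j, 0 ≤ p b j := fun b j => by
    rw [← hcl.meanPi_const (localInputs κ (hybrid M d₀ d₁ j)) (n κ) 0]
    exact meanPi_mono fun ws => lastStages_nonneg ..
  have hsum : ∑ j ∈ Finset.range (n κ), (p false j + p true (j + 1)) =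
      n κ * QReg.normSq ψ + (p true (n κ) - p true 0) := by
    rw [← Finset.sum_range_sub (p true)]
    have : ∀ j ∈ Finset.range (n κ), p false j + p true (j + 1) =
        QReg.normSq ψ + (p true (j + 1) - p true j) := fun j _ => by linarith [hW j]
    rw [Finset.sum_congr rfl this, Finset.sum_add_distrib]
    simp
  change _ ≤ 1 / 2 * ∑ j ∈ Finset.range (n κ), (p false j + p true (j + 1))
  rw [hsum]
  split_ifs with hbad
  -- If `d₀` and `d₁` differ on `M`, the game is lost, while the sum is at least `(n - 1) / 2` times
  -- the norm.
  · have := hW 0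
    have := hp0 false 0
    have := hp0 true (n κ)
    linarith
  -- Otherwise the first hybrid is the game for `b = 0`, and the last one that for `b = 1`.
  · have hgame : ∀ b : Bool, (concatGen gen).expect (fun q => q)
        (genInput κ fun i : Fin (n κ) => ((if b then d₁ else d₀).nth i).truth) ψ (fun kt φ =>
          lastStages (concatInfo N H) A₂ A₃ (n κ) κ M u.tl φ (hit b) kt.hd kt.tl) =
        p b (if b then n κ else 0) := by
      intro b
      rw [hcG.expect_eq, mean_concatGen hg]
      refine meanPi_congr _ (fun i hi => ?_) _
      rw [nth_ofBits_ofFn _ (⟨i, hi⟩ : Fin (n κ)), localInputs]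
      congr 3
      simp only [not_exists, not_and, not_not] at hbad
      cases b
      · simp [hybrid]
      · by_cases hM : (M.nth i).truth = true
        · simpa [hybrid, hM] using (hbad ⟨i, hi⟩ hM).symm
        · simp [hybrid, hM, hi]
    rw [Fintype.sum_bool, hgame true, hgame false]
    simp only [if_true, Bool.false_eq_true, if_false]
    linarith [hW 0]

end Prog

section
open Prog

variable {n : ℕ → ℕ} {F : Family fun _ => 1} {H : Algorithms} {δ : ℕ → ℝ} {N : Prog}

theorem Prog.Classical.prob_nonneg {p : Prog} (hp : p.Classical) (v : Val) (S : Val → Prop) :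
    0 ≤ p.prob v S := by
  rw [hp.prob_eq]
  exact (hp.mean_const v 0).symm.trans_le (mean_mono fun w => by split_ifs <;> simp)

/-! ### Security -/

/-- The advice with an index added to the string. -/
noncomputable def Advice.withIndex (a : Advice) (j n : ℕ → ℕ) (hj : ∀ κ, j κ < n κ)
    (hn : ∃ P : Polynomial ℕ, ∀ κ, n κ ≤ P.eval κ) : Advice where
  str κ := cons (num (j κ)) (a.str κ)
  reg := a.reg
  str_poly := by
    obtain ⟨P, hP⟩ := hn
    obtain ⟨Q, hQ⟩ := a.str_poly
    refine ⟨2 + 2 * P + Q, fun κ => ?_⟩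
    have := hP κ
    have := hQ κ
    have := hj κ
    simp [size_num]
    omega
  reg_unit := a.reg_unit
  reg_poly := a.reg_poly

/-- Security in the game `IND-PARTIAL`: an advantage yields, for one of the `n κ` hybrid steps, at
least its `n κ`-th part as advantage in `IND-D0` for the given family. -/
theorem IsHGHZCapable.concat_partInfo_secure (hF : IsHGHZCapable F H δ) (hN : N.PPT)
    (hNn : ∀ κ, N.always (num κ) (· = num (n κ)))
    (hn : ∃ P : Polynomial ℕ, ∀ κ, n κ ≤ P.eval κ) (hn1 : ∀ κ, 1 ≤ n κ) (a : Advice)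
    {A₁ A₂ A₃ : Prog} (h1 : A₁.QPT) (h2 : A₂.QPT) (h3 : A₃.QPT) :
    ∃ μ, Negligible μ ∧ ∀ κ,
      indPartial n (concatGen H.gen) (concatInfo N H) a A₁ A₂ A₃ κ ≤ 1 / 2 + μ κ := by
  have hL := ppt_localInfo hF.invert_ppt hF.support_ppt hF.hash_ppt
  have hP := ppt_concatInfo hN hL
  -- The adversary's advice names the hybrid step in which it is most successful.
  have hmax : ∀ κ, ∃ j < n κ, ∀ i < n κ,
      indD0Value H.gen (hybridA₁ N A₁) (hybridA₂ H.gen (concatInfo N H) A₂ A₃) 1 κ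
        (cons (num i) (a.str κ)) (a.reg κ) ≤
      indD0Value H.gen (hybridA₁ N A₁) (hybridA₂ H.gen (concatInfo N H) A₂ A₃) 1 κ
        (cons (num j) (a.str κ)) (a.reg κ) := fun κ => by
    obtain ⟨j, hj, h⟩ := Finset.exists_max_image (Finset.range (n κ))
      (fun i => indD0Value H.gen (hybridA₁ N A₁) (hybridA₂ H.gen (concatInfo N H) A₂ A₃) 1 κ
        (cons (num i) (a.str κ)) (a.reg κ)) ⟨0, Finset.mem_range.2 (hn1 κ)⟩
    exact ⟨j, Finset.mem_range.1 hj, fun i hi => h i (Finset.mem_range.2 hi)⟩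
  choose j hj hmax using hmax
  obtain ⟨μ, hμ, h⟩ := hF.indistinguishability (a.withIndex j n hj hn) (hybridA₁ N A₁)
    (hybridA₂ H.gen (concatInfo N H) A₂ A₃) (qpt_hybridA₁ hN.2 h1)
    (qpt_hybridA₂ hF.gen_ppt hP.2 h2 h3)
  obtain ⟨P, hPn⟩ := hn
  refine ⟨fun κ => n κ * μ κ, hμ.natCast_mul hPn, fun κ => ?_⟩
  have hs := indPartial_le_sum hF.gen_ppt hN hNn hL a A₁ A₂ A₃ κ
  have hκ := h κ
  rw [indD0_eq] at hκ
  have hb := Finset.sum_le_card_nsmul (Finset.range (n κ)) _ _ fun i hi =>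
    (hmax κ i (Finset.mem_range.1 hi)).trans hκ
  rw [Finset.card_range, nsmul_eq_mul] at hb
  linarith

/-- The game `IND-D0` is `IND-PARTIAL` with `M = ∅`, for an adversary that asks for the partial
information of a fixed `y` and ignores it. -/
theorem indD0_eq_indPartial (gen : Prog) {partInfo : Prog} (hP : partInfo.PPT) (a : Advice)
    (A₁ A₂ : Prog) (κ : ℕ) : indD0 n gen a A₁ A₂ κ = indPartial n gen partInfo a
      (A₁ ⨟ pair (pair nil hd) tl) (A₂ ⨟ pair nil id) hd κ := by
  rw [indD0_eq, indPartial_eq, indD0Value]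
  simp only [expect_seq, expect_pair, expect_nil, expect_hd, expect_tl, hd_cons, tl_cons, nth_nil,
    truth_nil, Bool.false_eq_true, false_and, exists_false, if_false, lastStages, expect_id,
    hP.1.expect_eq, hP.1.mean_const]

theorem IsHGHZCapable.concat_indistinguishability (hF : IsHGHZCapable F H δ) (hN : N.PPT)
    (hNn : ∀ κ, N.always (num κ) (· = num (n κ)))
    (hn : ∃ P : Polynomial ℕ, ∀ κ, n κ ≤ P.eval κ) (hn1 : ∀ κ, 1 ≤ n κ) (a : Advice)
    {A₁ A₂ : Prog} (h1 : A₁.QPT) (h2 : A₂.QPT) :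
    ∃ μ, Negligible μ ∧ ∀ κ, indD0 n (concatGen H.gen) a A₁ A₂ κ ≤ 1 / 2 + μ κ := by
  obtain ⟨μ, hμ, h⟩ := hF.concat_partInfo_secure hN hNn hn hn1 a
    (qpt_seq h1 (qpt_pair (qpt_pair qpt_nil qpt_hd) qpt_tl))
    (qpt_seq h2 (qpt_pair qpt_nil qpt_id)) qpt_hd
  have hL := ppt_localInfo hF.invert_ppt hF.support_ppt hF.hash_ppt
  exact ⟨μ, hμ, fun κ => indD0_eq_indPartial _ (ppt_concatInfo hN hL) a A₁ A₂ κ ▸ h κ⟩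

/-! ### The concatenated family is capable -/

theorem Family.part_join {κ : ℕ} {c : Bool} {z : ℕ → List Bool}
    (hz : ∀ i < n κ, (z i).length = F.l κ - 1) (i : Fin (n κ)) :
    F.part κ (c :: join z (n κ)) i = c :: z i := by
  rw [Family.part_cons, blockOf_join hz i.2]

theorem IsHGHZCapable.concat_gen_overwhelming (hF : IsHGHZCapable F H δ)
    (hn : ∃ P : Polynomial ℕ, ∀ κ, n κ ≤ P.eval κ) (hn1 : ∀ κ, 1 ≤ n κ) :
    ∃ μ, Negligible μ ∧ ∀ κ (d : Fin (n κ) → Bool),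
      1 - μ κ ≤ (concatGen H.gen).prob (genInput κ d) fun v =>
        v.hd ∈ (F.concat n).K κ ∧ (F.concat n).IsTrapdoor κ v.hd v.tl := by
  obtain ⟨μ, hμ, h⟩ := hF.gen_overwhelming
  obtain ⟨P, hP⟩ := hn
  refine ⟨fun κ => n κ * μ κ, hμ.natCast_mul hP, fun κ d => ?_⟩
  -- `μ` may exceed one, and the factors of a product estimate have to be nonnegative.
  calc 1 - n κ * μ κ ≤ max 0 (1 - μ κ) ^ n κ :=
        one_sub_mul_le_pow (le_max_left _ _) (le_max_right _ _) (hn1 κ)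
    _ = ∏ i : Fin (n κ), max 0 (1 - μ κ) := by simp
    _ ≤ ∏ i : Fin (n κ), H.gen.prob (genInput κ (fun _ : Fin 1 => d i)) fun v =>
          v.hd ∈ F.K κ ∧ F.IsTrapdoor κ v.hd v.tl := by
        refine Finset.prod_le_prod (fun _ _ => le_max_left _ _) fun i _ => max_le ?_ (h κ _)
        exact hF.gen_ppt.1.prob_nonneg _ _
    _ ≤ _ := prod_prob_le_prob_concatGen hF.gen_ppt κ d _ _ fun ws hws =>
        ⟨⟨_, fun i => (hws i).1, rfl⟩, ⟨_, _, rfl, rfl, fun i => (hws i).2⟩⟩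

theorem IsHGHZCapable.concat_d₀_gen (hF : IsHGHZCapable F H δ) (κ : ℕ) (d : Fin (n κ) → Bool) :
    (concatGen H.gen).always (genInput κ d) fun v =>
      v.hd ∈ (F.concat n).K κ → (F.concat n).d₀ κ v.hd = d := by
  refine always_mono (always_concatGen κ d (R := fun i v => v.hd ∈ F.K κ → F.d₀ κ v.hd 0 = d i)
    fun i => ?_) ?_
  · refine always_mono ((forall_run_iff _ _ QReg.zeroState fun v =>
      v.hd ∈ F.K κ → F.d₀ κ v.hd = fun _ => d i).1 (hF.d₀_gen κ _)) fun v hv hk => ?_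
    rw [hv hk]
  · rintro _ ⟨ws, hws, rfl⟩ ⟨ks, hks, e⟩
    have e' := tuple_injective e
    ext i
    have : (ws i).hd = ks i := congrFun e' i
    simpa [Family.concat] using hws i (this ▸ hks i)

theorem IsHGHZCapable.concat_xor_h (hF : IsHGHZCapable F H δ) (hT : F.LabelledTwins) {κ : ℕ}
    {ks : Fin (n κ) → Val} (hks : ∀ i, ks i ∈ F.K κ) {y : Val} {x x' : List Bool}
    (h : (F.concat n).Twin κ (tuple ks) y x x') (i : Fin (n κ)) :
    xor ((F.concat n).h κ x i) ((F.concat n).h κ x' i) = (F.concat n).d₀ κ (tuple ks) i := by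
  obtain ⟨ys, z, z', rfl, h', e⟩ := hT.twins_of_twin_concat hks h
  have hz : ∀ i < n κ, (z i).length = F.l κ - 1 := fun i hi =>
    (Family.length_of_cons_mem (h' ⟨i, hi⟩).left.1).1
  have hz' : ∀ i < n κ, (z' i).length = F.l κ - 1 := fun i hi =>
    (Family.length_of_cons_mem (h' ⟨i, hi⟩).right.1).1
  have hx := hF.xor_h κ (ks i) (hks i) (ys i) _ _ (h' i) 0
  rcases e with ⟨rfl, rfl⟩ | ⟨rfl, rfl⟩
  · simpa [Family.concat, Family.part_join hz, Family.part_join hz'] using hx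
  · simpa [Family.concat, Family.part_join hz, Family.part_join hz', Bool.xor_comm] using hx

/-- The algorithms of the concatenated family; `N` computes the number of components. -/
def concatAlgorithms (N : Prog) (H : Algorithms) : Algorithms where
  gen := concatGen H.gen
  evaluate := concatEvaluate H.evaluate
  invert := concatInvert H.invert
  support := concatSupport H.support
  hash := concatHash N H.hash
  superpose := concatSuperpose N H.superpose

theorem Family.exists_of_isTrapdoor_concat {κ : ℕ} {ks : Fin (n κ) → Val} {t : Val}
    (h : (F.concat n).IsTrapdoor κ (tuple ks) t) :
    ∃ ts : Fin (n κ) → Val, t = tuple ts ∧ ∀ i, F.IsTrapdoor κ (ks i) (ts i) := by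
  obtain ⟨ks', ts, e, rfl, hts⟩ := h
  rw [tuple_injective e]
  exact ⟨ts, rfl, hts⟩

theorem IsHGHZCapable.concat (hF : IsHGHZCapable F H δ) (hT : F.LabelledTwins) (hN : N.PPT)
    (hNn : ∀ κ, N.always (num κ) (· = num (n κ)))
    (hn : ∃ P : Polynomial ℕ, ∀ κ, n κ ≤ P.eval κ) (hn1 : ∀ κ, 1 ≤ n κ)
    (hδ : ∀ κ, δ κ ≤ 1) :
    IsHGHZCapable (F.concat n) (concatAlgorithms N H) fun κ => 1 - (1 - δ κ) ^ n κ where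
  maps_to := by
    rintro κ _ ⟨ks, hks, rfl⟩ x hx
    rw [Family.concat_f]
    exact ⟨_, fun i => hF.maps_to κ _ (hks i) _ (hx.2 i), rfl⟩
  gen_ppt := ppt_concatGen hF.gen_ppt
  gen_overwhelming := hF.concat_gen_overwhelming hn hn1
  eval_ppt := ppt_concatEvaluate hF.eval_ppt
  eval_correct := by
    rintro κ _ ⟨ks, hks, rfl⟩ x hx
    exact (outputs_iff _ _ _).2 (hF.always_concatEvaluate (hn1 κ) hks hx)
  invert_ppt := ppt_concatInvert hF.invert_ppt
  invert_correct := by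
    rintro κ _ ⟨ks, hks, rfl⟩ t ht _ ⟨ys, hys, rfl⟩
    obtain ⟨ts, rfl, hts⟩ := Family.exists_of_isTrapdoor_concat ht
    exact (forall_run_iff _ _ _ _).2 (hF.always_concatInvert hT (hn1 κ) hks hts hys)
  superpose_qpt := qpt_concatSuperpose hN.2 hF.superpose_qpt
  superpose_correct := by
    obtain ⟨μ, hμ, h⟩ := hF.superpose_correct
    obtain ⟨P, hP⟩ := hn
    refine ⟨fun κ => n κ * μ κ, hμ.natCast_mul hP, fun κ => ?_⟩
    have hκ := h κ
    rw [total_overlap] at hκ ⊢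
    exact (one_sub_mul_le_pow (expect_nonneg (overlap_nonneg F κ)) hκ (hn1 κ)).trans
      (overlap_le hN hNn hT (hn1 κ))
  two_to_one := by
    rintro κ _ ⟨ks, hks, rfl⟩
    rw [sub_sub_cancel]
    exact hT.concat_two_to_one hks (by linarith [hδ κ]) fun i => hF.two_to_one κ _ (hks i)
  hash_ppt := ppt_concatHash hN hF.hash_ppt
  hash_correct κ x hx := (outputs_iff _ _ _).2 (hF.always_concatHash hNn (hn1 κ) hx)
  xor_h := by
    rintro κ _ ⟨ks, hks, rfl⟩ y x x' h i
    exact hF.concat_xor_h hT hks h i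
  d₀_gen κ d := (forall_run_iff _ _ _ fun v =>
    v.hd ∈ (F.concat n).K κ → (F.concat n).d₀ κ v.hd = d).2 (hF.concat_d₀_gen κ d)
  support_ppt := ppt_concatSupport hF.support_ppt
  support_correct := by
    rintro κ _ ⟨ks, hks, rfl⟩ t ht
    obtain ⟨ts, rfl, hts⟩ := Family.exists_of_isTrapdoor_concat ht
    exact (outputs_iff _ _ _).2 (hF.always_concatSupport hks hts)
  indistinguishability a _ _ h1 h2 := hF.concat_indistinguishability hN hNn hn hn1 a h1 h2

theorem Family.partInfoLoc_ne_bot_iff {κ : ℕ} {k y : Val} : F.partInfoLoc κ k y ≠ Info.bot ↔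
    ∃ z z', F.Twin κ k y (false :: z) (true :: z') := by
  by_cases h : ∃ z z', F.Twin κ k y (false :: z) (true :: z')
  · obtain ⟨z, z', h'⟩ := h
    rw [Family.partInfoLoc_of_twin h']
    refine ⟨fun _ => ⟨z, z', h'⟩, fun _ => ?_⟩
    split_ifs <;> simp
  · simp [Family.partInfoLoc_of_not h, h]

theorem IsHGHZCapable.concat_isGHZCanCapable (hF : IsHGHZCapable F H δ) (hT : F.LabelledTwins)
    (hN : N.PPT) (hNn : ∀ κ, N.always (num κ) (· = num (n κ)))
    (hn : ∃ P : Polynomial ℕ, ∀ κ, n κ ≤ P.eval κ) (hn1 : ∀ κ, 1 ≤ n κ)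
    (hδ : ∀ κ, δ κ ≤ 1) :
    IsGHZCanCapable (F.concat n) (concatAlgorithms N H) (concatInfo N H)
      fun κ => 1 - (1 - δ κ) ^ n κ where
  hghz := hF.concat hT hN hNn hn hn1 hδ
  partInfo_ppt := ppt_concatInfo hN (ppt_localInfo hF.invert_ppt hF.support_ppt hF.hash_ppt)
  partInfo_correct := by
    rintro κ _ ⟨ks, hks, rfl⟩ t ht _ ⟨ys, hys, rfl⟩ c hc
    obtain ⟨ts, rfl, hts⟩ := Family.exists_of_isTrapdoor_concat ht
    have hv := (forall_run_iff _ _ _ _).2 (hF.always_concatInfo hNn hT hks hts hys) c hc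
    have hd : ∀ i, (F.concat n).d₀ κ (tuple ks) i = F.d₀ κ (ks i) 0 := fun i => by
      simp [Family.concat]
    refine ⟨fun i => F.partInfoLoc κ (ks i) (ys i), hv, ?_, fun i => ⟨fun b hb => ?_, fun hb => ?_⟩,
      fun x x' h => ?_⟩
    · simp only [hT.exists_twin_concat_iff hks, Family.partInfoLoc_ne_bot_iff]
    · change F.partInfoLoc κ (ks i) (ys i) = _ at hb
      obtain ⟨z, z', h⟩ := Family.partInfoLoc_ne_bot_iff.1 (hb ▸ Info.noConfusion :
        F.partInfoLoc κ (ks i) (ys i) ≠ Info.bot)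
      rw [Family.partInfoLoc_of_twin h] at hb
      rw [hd]
      by_contra hcon
      rw [if_pos (Bool.not_eq_true _ ▸ hcon)] at hb
      cases hb
    · change F.partInfoLoc κ (ks i) (ys i) = _ at hb
      obtain ⟨z, z', h⟩ := Family.partInfoLoc_ne_bot_iff.1 (hb ▸ Info.noConfusion :
        F.partInfoLoc κ (ks i) (ys i) ≠ Info.bot)
      rw [Family.partInfoLoc_of_twin h] at hb
      rw [hd]
      by_contra hcon
      rw [if_neg hcon] at hb
      cases hb
    · obtain ⟨ys', z, z', e, h', hx⟩ := hT.twins_of_twin_concat hks h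
      obtain rfl := tuple_injective e
      have hz : ∀ i < n κ, (z i).length = F.l κ - 1 := fun i hi =>
        (Family.length_of_cons_mem (h' ⟨i, hi⟩).left.1).1
      refine ⟨(F.concat n).h κ (false :: join z (n κ)), ?_, fun i hi => ?_⟩
      · rcases hx with ⟨rfl, _⟩ | ⟨_, rfl⟩
        exacts [Or.inl rfl, Or.inr rfl]
      · rw [hd] at hi
        change F.partInfoLoc κ (ks i) (ys i) = _
        rw [Family.partInfoLoc_of_twin (h' i), if_neg (by simp [hi])]
        simp [Family.concat, Family.part_join hz]
  partInfo_secure a _ _ _ h1 h2 h3 := hF.concat_partInfo_secure hN hNn hn hn1 a h1 h2 h3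

/-! ### The concatenated family is distributable -/

theorem innerBits_cons (b x : Bool) (v w : List Bool) :
    innerBits (b :: v) (x :: w) = xor (b && x) (innerBits v w) := rfl

theorem innerBits_append {v v' w w' : List Bool} (h : v.length = w.length) :
    innerBits (v ++ v') (w ++ w') = xor (innerBits v w) (innerBits v' w') := by
  induction v generalizing w with
  | nil =>
    obtain rfl := List.eq_nil_of_length_eq_zero h.symm
    simp [innerBits]
  | cons b v ih =>
    cases w with
    | nil => simp at h
    | cons x w =>
      simp only [List.cons_append, innerBits_cons, ih (by simpa using h), Bool.xor_assoc]

theorem xorBits_comm (x x' : List Bool) : xorBits x x' = xorBits x' x :=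
  List.zipWith_comm_of_comm Bool.xor_comm

/-- The inner product is additive over the blocks. -/
theorem innerBits_join {β z z' : ℕ → List Bool} {m N : ℕ} (hβ : ∀ i < N, (β i).length = m)
    (hz : ∀ i < N, (z i).length = m) (hz' : ∀ i < N, (z' i).length = m) :
    innerBits (join β N) (xorBits (join z N) (join z' N)) =
      ((List.range N).map fun i => innerBits (β i) (xorBits (z i) (z' i))).foldr xor false := by
  induction N generalizing β z z' with
  | zero => simp [join, innerBits]
  | succ N ih =>
    have h0 := hβ 0 (by omega)
    have h1 := hz 0 (by omega)
    have h2 := hz' 0 (by omega)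
    rw [join_succ, join_succ, join_succ, xorBits, List.zipWith_append (by omega), ← xorBits,
      ← xorBits, innerBits_append (by simp [xorBits, h0, h1, h2]),
      ih (fun i hi => hβ (i + 1) (by omega)) (fun i hi => hz (i + 1) (by omega))
        fun i hi => hz' (i + 1) (by omega), List.range_succ_eq_map]
    simp [Function.comp_def]

/-- The contributions of the components, the first of which accounts for the first bit. -/
theorem innerBits_concat {c c' b₀ : Bool} (hc : xor c c' = true) {b : List Bool}
    {z z' : ℕ → List Bool} {m N : ℕ} (hN : 1 ≤ N) (hb : b.length = N * m)
    (hz : ∀ i < N, (z i).length = m) (hz' : ∀ i < N, (z' i).length = m) :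
    innerBits (b₀ :: b) (xorBits (c :: join z N) (c' :: join z' N)) =
      (List.ofFn fun i : Fin N => if (i : ℕ) = 0 then
        xor b₀ (innerBits (blockOf m b i) (xorBits (z i) (z' i)))
        else innerBits (blockOf m b i) (xorBits (z i) (z' i))).foldr xor false := by
  obtain ⟨r, rfl⟩ : ∃ r, N = r + 1 := ⟨N - 1, by omega⟩
  have h := innerBits_join (fun i hi => length_blockOf hb hi) hz hz'
  rw [join_blockOf hb] at h
  have e : xorBits (c :: join z (r + 1)) (c' :: join z' (r + 1)) =
      true :: xorBits (join z (r + 1)) (join z' (r + 1)) := by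
    rw [← hc]
    rfl
  rw [e, innerBits_cons, h, List.range_succ_eq_map, List.ofFn_succ]
  simp only [List.map_cons, List.map_map, List.foldr_cons, Fin.val_zero, if_true, Bool.and_true,
    Fin.val_succ, Nat.add_eq_zero_iff, one_ne_zero, and_false, if_false, Bool.xor_assoc]
  congr 3
  apply List.ext_getElem <;> simp

theorem IsHGHZCapable.concat_isDistributable (hF : IsHGHZCapable F H δ) (hT : F.LabelledTwins)
    (hN : N.PPT) (hNn : ∀ κ, N.always (num κ) (· = num (n κ))) (hn1 : ∀ κ, 1 ≤ n κ) :
    IsDistributable (F.concat n) (concatAlgorithms N H) (concatInfo N H) F.toLocalKeys H.gen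
      (localInfo H) (localAlpha H.invert) where
  K_eq _ := rfl
  trapdoor_iff _ _ _ := Iff.rfl
  d₀_eq κ ks hks i := by simp [Family.concat, Family.toLocalKeys]
  genLoc_ppt := hF.gen_ppt
  gen_eq κ d ks ts := prob_concatGen hF.gen_ppt κ d ks ts
  partInfoLoc_ppt := ppt_localInfo hF.invert_ppt hF.support_ppt hF.hash_ppt
  partInfo_eq κ ks ts hks hts y hy v := prob_concatInfo hN hNn
    (ppt_localInfo hF.invert_ppt hF.support_ppt hF.hash_ppt) κ ts _ y
  partAlphaLoc_ppt := ppt_localAlpha hF.invert_ppt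
  partAlpha_correct := by
    intro κ ks ts hks hts y x x' b h hb
    obtain ⟨ys, z, z', rfl, h', e⟩ := hT.twins_of_twin_concat hks h
    have hz : ∀ i < n κ, (z i).length = F.l κ - 1 := fun i hi =>
      (Family.length_of_cons_mem (h' ⟨i, hi⟩).left.1).1
    have hz' : ∀ i < n κ, (z' i).length = F.l κ - 1 := fun i hi =>
      (Family.length_of_cons_mem (h' ⟨i, hi⟩).right.1).1
    obtain ⟨b₀, b, rfl⟩ : ∃ b₀ b', b = b₀ :: b' := by
      cases b with
      | nil =>
        have : 0 = 1 + n κ * (F.l κ - 1) := hb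
        omega
      | cons b₀ b => exact ⟨b₀, b, rfl⟩
    have hb' : b.length = n κ * (F.l κ - 1) := by
      have : b.length + 1 = 1 + n κ * (F.l κ - 1) := hb
      omega
    refine ⟨fun i => if (i : ℕ) = 0 then
      xor b₀ (innerBits (blockOf (F.l κ - 1) b i) (xorBits (z i) (z' i)))
      else innerBits (blockOf (F.l κ - 1) b i) (xorBits (z i) (z' i)), fun i => ?_, ?_⟩
    rotate_left
    · rcases e with ⟨rfl, rfl⟩ | ⟨rfl, rfl⟩
      · exact innerBits_concat rfl (hn1 κ) hb' hz hz'
      · rw [xorBits_comm]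
        exact innerBits_concat rfl (hn1 κ) hb' hz hz'
    · have hys : ys i ∈ F.Y κ := (h' i).left.2 ▸ hF.maps_to κ _ (hks i) _ (h' i).left.1
      have := hF.always_localAlpha hT (ys := ys) i (hks i) (hts i) hys hb
      rw [Family.partAlphaLoc_of_twin (h' i)] at this
      exact (outputs_iff _ _ _).2 this

end

theorem one_sub_pow_le {δ : ℝ} (hδ : δ ∈ Set.Icc (0 : ℝ) 1) (n : ℕ) :
    1 - (1 - δ) ^ n ≤ δ * n := by
  have := one_add_mul_le_pow (a := -δ) (by linarith [hδ.2]) n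
  rw [← sub_eq_add_neg] at this
  linarith

end GHZ

theorem mainTheorem4 (n : ℕ → ℕ) (hn : PolyTimeComputable n) (hn1 : ∀ κ, 1 ≤ n κ)
    (δ : ℕ → ℝ) (hδ : ∀ κ, δ κ ∈ Set.Icc (0 : ℝ) 1)
    (F : Family fun _ => 1) (H : Algorithms) (hF : IsHGHZCapable F H δ) (hT : F.LabelledTwins) :
    (∃ (A : Algorithms) (partInfo partInfoLoc partAlphaLoc : Prog),
      IsGHZCanCapable (F.concat n) A partInfo (fun κ => 1 - (1 - δ κ) ^ n κ) ∧
      IsDistributable (F.concat n) A partInfo F.toLocalKeys H.gen partInfoLoc partAlphaLoc ∧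
      ∀ κ (ks ts ys : Fin (n κ) → Val), (∀ i, ks i ∈ F.K κ) →
        (∀ i, F.IsTrapdoor κ (ks i) (ts i)) → (∀ i, ys i ∈ F.Y κ) → ∀ i : Fin (n κ),
          partInfoLoc.Outputs (locInput κ i (ts i) (Val.tuple ys))
            (F.partInfoLoc κ (ks i) (ys i)).enc ∧
          ∀ b : List Bool, b.length = (F.concat n).l κ →
            partAlphaLoc.Outputs (alphaInput κ i (ts i) (Val.tuple ys) b)
              (F.partAlphaLoc κ i (ks i) (ys i) b).enc) ∧
    (∀ κ, 1 - (1 - δ κ) ^ n κ ≤ δ κ * n κ) ∧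
    (Negligible δ → Negligible fun κ => 1 - (1 - δ κ) ^ n κ) ∧
    (∀ chk : Prog, IsCheckTrapdoor F chk → IsLocalCheckTrapdoor F.toLocalKeys chk) := by
  have hP := hn.exists_polynomial
  obtain ⟨N, hN, hNn⟩ := hn
  have hNn' : ∀ κ, N.always (Val.num κ) (· = Val.num (n κ)) := fun κ =>
    (Prog.outputs_iff _ _ _).1 (hNn κ)
  refine ⟨⟨concatAlgorithms N H, Prog.concatInfo N H, Prog.localInfo H, Prog.localAlpha H.invert,
    hF.concat_isGHZCanCapable hT hN hNn' hP hn1 fun κ => (hδ κ).2,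
    hF.concat_isDistributable hT hN hNn' hn1, fun κ ks ts ys hks hts hys i => ⟨?_, fun b hb => ?_⟩⟩,
    fun κ => one_sub_pow_le (hδ κ) _, fun h => ?_, fun chk h => ⟨h.1, fun κ d t k => ?_⟩⟩
  · have := hF.always_localInfo hT (y := Val.tuple ys) (i := i) (hks i) (hts i)
      (by simpa using hys i)
    rw [Val.nth_tuple] at this
    exact (Prog.outputs_iff _ _ _).2 this
  · exact (Prog.outputs_iff _ _ _).2 (hF.always_localAlpha hT i (hks i) (hts i) (hys i) hb)
  · obtain ⟨P, hP⟩ := hP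
    refine (h.natCast_mul hP).mono fun κ => ?_
    have h1 : (1 - δ κ) ^ n κ ≤ 1 := pow_le_one₀ (by linarith [(hδ κ).2]) (by linarith [(hδ κ).1])
    rw [abs_of_nonneg (by linarith), abs_of_nonneg (mul_nonneg (Nat.cast_nonneg _) (hδ κ).1),
      mul_comm]
    exact one_sub_pow_le (hδ κ) _
  · have := h.2 κ (fun _ => d) t k
    have e : F.d₀ κ k = (fun _ => d) ↔ F.d₀ κ k 0 = d :=
      ⟨fun h => congrFun h 0, fun h => funext fun i => by rw [Subsingleton.elim i 0, h]⟩
    simp only [e] at this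
    exact this
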